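/- **Setting.** There are $n\ge1$ clients, each holding $m$ data samples $D_i=(d_{i,j})_{j\le m}$ from a data domain $\mathcal Z$. Let $f_{i,j}(x)=\ell(x;d_{i,j})$ on $\mathbb R^d$ ($d\ge1$), $f_i=\frac1m\sum_j f_{i,j}$ and $f=\frac1n\sum_i f_i$. For some $L,G>0$ and every sample $z\in\mathcal Z$, $\ell(\cdot;z)$ is differentiable with $L$-Lipschitz gradient and $\|\nabla\ell(x;z)\|\le G$ for all $x$. For each client $i$ and round $t$, $\mathcal C_i^t$ is a randomized map on $\mathbb R^d$ with $\mathbb E[\mathcal C_i^t(x)]=x$ and $\mathbb E\|\mathcal C_i^t(x)-x\|^2\le\omega\|x\|^2$ for all $x$, where $\omega\ge0$; all of these maps are drawn independently. **Algorithm (SoteriaFL-SAGA, $T$ rounds).** Start from $x^0$, $s_i^0=s^0=0$, $w_{i,j}^0=x^0$. In round $t=0,\dots,T-1$ every client $i$ draws a minibatch $\mathcal I_i^t\subseteq\{1,\dots,m\}$ that contains each index independently with probability $b/m$, and $\xi_i^t\sim\mathcal N(0,\sigma_p^2I)$, and computes $$\tilde g_i^t=\frac1b\sum_{j\in\mathcal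 I_i^t}\big(\nabla f_{i,j}(x^t)-\nabla f_{i,j}(w_{i,j}^t)\big)+\frac1m\sum_{j=1}^m\nabla f_{i,j}(w_{i,j}^t).$$ It sends $v_i^t=\mathcal C_i^t(\tilde g_i^t+\xi_i^t-s_i^t)$ to the server and sets $s_i^{t+1}=s_i^t+\gamma v_i^t$, and $w_{i,j}^{t+1}=x^t$ if $j\in\mathcal I_i^t$, $w_{i,j}^{t+1}=w_{i,j}^t$ otherwise. The server sets $x^{t+1}=x^t-\eta\big(s^t+\frac1n\sum_iv_i^t\big)$ and $s^{t+1}=s^t+\gamma\frac1n\sum_iv_i^t$. All minibatches, perturbations and compressors are independent. The output is the collection of all messages $(v_i^t)_{i\le n,\,t<T}$. The algorithm is $(\epsilon,\delta)$-LDP if, for every client $i$, all datasets of the other clients, every two datasets of client $i$ that differ in one entry, and every event $S$, the output probabilities $P,P'$ for the two datasets satisfy $P(S)\le e^\epsilon P'(S)+\delta$. **Parameters.** $b=3m^{2/3}$ (assume $b\le m$), $\tau=\frac{(1+\omega)^{3/2}}{n^{1/2}}$, $\beta=\frac{(1+\omega)^2\min\{1,n/(1+\omega)^3\}}{3n}$,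 $\eta_{\max}=\frac{\min\{1,\sqrt{n/(1+\omega)^3}\}}{3L}$, $0<\eta\le\eta_{\max}$, $\gamma=\sqrt{\frac{1+2\omega}{2(1+\omega)^3}}$, and $$R=\frac{\sqrt{nL}\,m\epsilon}{G\sqrt{(1+\omega)d\log(1/\delta)}}\max\{1,\tau\},\qquad Y=\frac{G\sqrt{(1+\omega)Ld\log(1/\delta)}}{\sqrt n\,m\epsilon},$$ $$\Phi_0=f(x^0)-\inf f+\frac{\beta}{Ln}\sum_{i=1}^n\|\nabla f_i(x^0)\|^2 .$$ **Theorem.** For every $K>0$ there are constants $c,c',C>0$ depending only on $K$ such that the following holds in the above setting. Let $\epsilon>0$ and $\delta\in(0,1)$ with $\epsilon\le K\log(1/\delta)$, let $T$ be an integer with $\epsilon<c'b^2T/m^2$ and $aR\le T\le AR$ for some reals $a,A$ with $a>0$ (that is, $T$ is of order $R$), and let $\sigma_p^2=c\,\frac{G^2T\log(1/\delta)}{m^2\epsilon^2}$. Then SoteriaFL-SAGA is $(\epsilon,\delta)$-LDP, and for all datasets for which $f$ is bounded below $$\frac1T\sum_{t=0}^{T-1}\mathbb E\|\nabla f(x^t)\|^2\le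 C\,\frac{\eta_{\max}}{\eta}\Big(\frac{\Phi_0}{a}+A\Big)\,Y .$$ In particular, for $\eta=\eta_{\max}$ and $T=O(R)$ of exact order $R$, the utility is $O(Y)$, where the hidden constant depends only on $K$, on the constants in the choice of $T$ and on $\Phi_0$; if $T$ is of order $\sqrt{\Phi_0}\,R$, the utility is $O(\sqrt{\Phi_0}\,Y)$. -/

import Mathlib

open MeasureTheory ProbabilityTheory
open scoped Gradient

namespace SoteriaFL

/-- The space `ℝᵈ` with its Euclidean norm. -/
abbrev Vec (d : ℕ) : Type := EuclideanSpace ℝ (Fin d)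

section Objective

variable {d n m : ℕ} {Z : Type*}

/-- `φ` is `L`-smooth: it is differentiable and its gradient is `L`-Lipschitz. -/
def IsLSmooth (L : ℝ) (φ : Vec d → ℝ) : Prop :=
  Differentiable ℝ φ ∧ ∀ x y : Vec d, ‖∇ φ x - ∇ φ y‖ ≤ L * ‖x - y‖

/-- The gradient of `φ` is bounded by `G` everywhere. -/
def HasBoundedGradient (G : ℝ) (φ : Vec d → ℝ) : Prop :=
  ∀ x : Vec d, ‖∇ φ x‖ ≤ G

/-- The loss of a client with local dataset `Di`: `f_i(x) = (1/m) ∑_j ℓ(x; d_{i,j})`. -/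
noncomputable def localLoss (ℓ : Z → Vec d → ℝ) (Di : Fin m → Z) (x : Vec d) : ℝ :=
  (1 / (m : ℝ)) * ∑ j, ℓ (Di j) x

/-- The global loss `f(x) = (1/n) ∑_i f_i(x)`. -/
noncomputable def globalLoss (ℓ : Z → Vec d → ℝ) (D : Fin n → Fin m → Z) (x : Vec d) : ℝ :=
  (1 / (n : ℝ)) * ∑ i, localLoss ℓ (D i) x

end Objective

section Compression

/-- The randomized map `x ↦ C u x` on `ℝᵈ`, with random seed `u` of law `ν`, is an `ω`-compression
operator: it is unbiased with variance at most `ω ‖x‖²`. -/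
structure IsCompressor {d : ℕ} {U : Type*} [MeasurableSpace U] (ω : ℝ) (ν : Measure U)
    (C : U → Vec d → Vec d) : Prop where
  measurable : Measurable (Function.uncurry C)
  integrable : ∀ x, Integrable (fun u => C u x) ν
  unbiased : ∀ x, ∫ u, C u x ∂ν = x
  integrable_sq : ∀ x, Integrable (fun u => ‖C u x - x‖ ^ 2) ν
  variance_le : ∀ x, ∫ u, ‖C u x - x‖ ^ 2 ∂ν ≤ ω * ‖x‖ ^ 2

end Compression

section Privacy

/-- Two local datasets are neighbors if they differ in at most one entry. -/
def Neighboring {m : ℕ} {Z : Type*} (A B : Fin m → Z) : Prop :=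
  ∃ j, ∀ k, k ≠ j → A k = B k

/-- A randomized mechanism `M`, with randomness of law `P`, that maps the datasets of all `n`
clients to an output in `R` is `(ε, δ)`-locally differentially private for client `i`: for all
datasets of the other clients, changing one entry in the dataset of client `i` changes the law of
the output by at most `(ε, δ)`. -/
def IsLDP {n m : ℕ} {Z Ω R : Type*} [MeasurableSpace Ω] [MeasurableSpace R]
    (ε δ : ℝ) (P : Measure Ω) (M : (Fin n → Fin m → Z) → Ω → R) (i : Fin n) : Prop :=
  ∀ D D' : Fin n → Fin m → Z, (∀ k, k ≠ i → D k = D' k) → Neighboring (D i) (D' i) →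
    ∀ S : Set R, MeasurableSet S →
      P {r | M D r ∈ S} ≤ ENNReal.ofReal (Real.exp ε) * P {r | M D' r ∈ S} + ENNReal.ofReal δ

end Privacy

section Algorithm

variable {d n m : ℕ} {Z U : Type*}

/-- The randomness of one client in one round: the minibatch `ℐ_b` (given by its indicator), the
Gaussian perturbation `ξ`, and the seed of the compression operator. -/
abbrev ClientNoise (d m : ℕ) (U : Type*) : Type _ := (Fin m → Bool) × Vec d × U

/-- The randomness of a whole run: one `ClientNoise` for each round and each client. -/
abbrev Noise (d n m : ℕ) (U : Type*) : Type _ := ℕ → Fin n → ClientNoise d m U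

/-- The Gaussian law `𝒩(0, v I)` on `ℝᵈ`. -/
noncomputable def gaussianLaw (d : ℕ) (v : ℝ) : Measure (Vec d) :=
  (stdGaussian (Vec d)).map fun z => √v • z

/-- The law of a minibatch: every `j` is included independently with probability `q ∈ [0, 1]`. -/
noncomputable def batchLaw (m : ℕ) (q : ℝ) : Measure (Fin m → Bool) :=
  Measure.pi fun _ => bernoulliMeasure true false (Set.projIcc (0 : ℝ) 1 zero_le_one q)

/-- The law of the randomness of a run: all minibatches (sampling probability `q`), perturbations
(variance `v` per coordinate) and compression seeds, over all rounds and clients, are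
independent. -/
noncomputable def noiseLaw [MeasurableSpace U] (d n m : ℕ) (q v : ℝ) (ν : ℕ → Fin n → Measure U) :
    Measure (Noise d n m U) :=
  Measure.infinitePi fun t => Measure.pi fun i =>
    (batchLaw m q).prod ((gaussianLaw d v).prod (ν t i))

/-- The state of the algorithm at the beginning of a round. -/
structure State (d n m : ℕ) where
  /-- the model `x^t` -/
  x : Vec d
  /-- the references `s_i^t` of the clients -/
  shift : Fin n → Vec d
  /-- the reference `s^t` of the server -/
  serverShift : Vec d
  /-- the SAGA points `w_{i,j}^t` -/
  table : Fin n → Fin m → Vec d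

/-- The state before the first round: `s_i^0 = s^0 = 0` and `w_{i,j}^0 = x^0`. -/
def initState (n m : ℕ) (x₀ : Vec d) : State d n m where
  x := x₀
  shift := fun _ => 0
  serverShift := 0
  table := fun _ _ => x₀

/-- The local SAGA estimator
`(1/b) ∑_{j ∈ ℐ_b} (∇ℓ(x; d_j) - ∇ℓ(w_j; d_j)) + (1/m) ∑_j ∇ℓ(w_j; d_j)`. -/
noncomputable def sagaEstimator (ℓ : Z → Vec d → ℝ) (b : ℝ) (Di : Fin m → Z) (x : Vec d)
    (w : Fin m → Vec d) (batch : Fin m → Bool) : Vec d :=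
  (1 / b) • ∑ j with batch j = true, (∇ (ℓ (Di j)) x - ∇ (ℓ (Di j)) (w j))
    + (1 / (m : ℝ)) • ∑ j, ∇ (ℓ (Di j)) (w j)

/-- The message `v_i^t = C_i^t(g̃_i^t + ξ_i^t - s_i^t)` of client `i` to the server; here `C` is the
family of compression operators of the round. -/
noncomputable def message (ℓ : Z → Vec d → ℝ) (b : ℝ) (C : Fin n → U → Vec d → Vec d)
    (D : Fin n → Fin m → Z) (st : State d n m) (r : Fin n → ClientNoise d m U) (i : Fin n) :
    Vec d :=
  C i (r i).2.2 (sagaEstimator ℓ b (D i) st.x (st.table i) (r i).1 + (r i).2.1 - st.shift i)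

/-- One round of SoteriaFL-SAGA, with stepsize `η`, shift stepsize `γ` and minibatch size `b`. -/
noncomputable def round (ℓ : Z → Vec d → ℝ) (η γ b : ℝ) (C : Fin n → U → Vec d → Vec d)
    (D : Fin n → Fin m → Z) (st : State d n m) (r : Fin n → ClientNoise d m U) : State d n m where
  x := st.x - η • (st.serverShift + (1 / (n : ℝ)) • ∑ i, message ℓ b C D st r i)
  shift := fun i => st.shift i + γ • message ℓ b C D st r i
  serverShift := st.serverShift + γ • ((1 / (n : ℝ)) • ∑ i, message ℓ b C D st r i)
  table := fun i j => if (r i).1 j = true then st.x else st.table i j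

/-- The state of SoteriaFL-SAGA after `t` rounds. -/
noncomputable def run (ℓ : Z → Vec d → ℝ) (η γ b : ℝ) (C : ℕ → Fin n → U → Vec d → Vec d)
    (x₀ : Vec d) (D : Fin n → Fin m → Z) (r : Noise d n m U) : ℕ → State d n m
  | 0 => initState n m x₀
  | t + 1 => round ℓ η γ b (C t) D (run ℓ η γ b C x₀ D r t) (r t)

/-- The output of `T` rounds of SoteriaFL-SAGA as a mechanism: all messages that the clients send to
the server. -/
noncomputable def transcript (ℓ : Z → Vec d → ℝ) (η γ b : ℝ) (C : ℕ → Fin n → U → Vec d → Vec d)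
    (x₀ : Vec d) (T : ℕ) (D : Fin n → Fin m → Z) (r : Noise d n m U) : Fin T → Fin n → Vec d :=
  fun t i => message ℓ b (C t) D (run ℓ η γ b C x₀ D r t) (r t) i

end Algorithm

section Parameters

/-- The minibatch size `b = 3 m^{2/3}`. -/
noncomputable def batchSize (m : ℕ) : ℝ := 3 * (m : ℝ) ^ (2 / 3 : ℝ)

/-- `β = (1+ω)² min{1, n/(1+ω)³} / (3n)`. -/
noncomputable def betaParam (n : ℕ) (ω : ℝ) : ℝ :=
  (1 + ω) ^ 2 * min 1 (n / (1 + ω) ^ 3) / (3 * n)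

/-- The largest stepsize `min{1, √(n/(1+ω)³)} / (3L)`. -/
noncomputable def maxStepsize (n : ℕ) (ω L : ℝ) : ℝ :=
  min 1 (√(n / (1 + ω) ^ 3)) / (3 * L)

/-- The shift stepsize `γ = √((1+2ω) / (2(1+ω)³))`. -/
noncomputable def shiftStepsize (ω : ℝ) : ℝ := √((1 + 2 * ω) / (2 * (1 + ω) ^ 3))

/-- `τ = (1+ω)^{3/2} / n^{1/2}`. -/
noncomputable def tau (n : ℕ) (ω : ℝ) : ℝ := (1 + ω) ^ (3 / 2 : ℝ) / (n : ℝ) ^ (1 / 2 : ℝ)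

/-- The order of the number of communication rounds,
`√(nL) m ε / (G √((1+ω) d log(1/δ))) · max{1, τ}`. -/
noncomputable def roundsOrder (d n m : ℕ) (G L ω ε δ : ℝ) : ℝ :=
  √(n * L) * m * ε / (G * √((1 + ω) * d * Real.log (1 / δ))) * max 1 (tau n ω)

/-- The order of the utility, `G √((1+ω) L d log(1/δ)) / (√n m ε)`. -/
noncomputable def utilityOrder (d n m : ℕ) (G L ω ε δ : ℝ) : ℝ :=
  G * √((1 + ω) * L * d * Real.log (1 / δ)) / (√n * m * ε)

/-- The initial potential `Φ₀ = f(x⁰) - f^* + (β/(Ln)) ∑_i ‖∇f_i(x⁰) - s_i⁰‖²` with `s_i⁰ = 0`. -/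
noncomputable def initialPotential {d n m : ℕ} {Z : Type*} (ℓ : Z → Vec d → ℝ) (L ω : ℝ)
    (D : Fin n → Fin m → Z) (x₀ : Vec d) : ℝ :=
  globalLoss ℓ D x₀ - (⨅ x, globalLoss ℓ D x)
    + betaParam n ω / (L * n) * ∑ i, ‖∇ (localLoss ℓ (D i)) x₀‖ ^ 2

end Parameters

end SoteriaFL

/-! Privacy. Let the two datasets of client `i` differ in the sample `z`. In a given round, `z`
influences the message of client `i` only through the mean of a Gaussian. In units of the noise
`√v`, the shift is always `u = ∇ℓ(w;z)/(m√v)`, and a further `Δ = (∇ℓ(x;z) - ∇ℓ(w;z))/(b√v)` is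
added with probability `q = b/m`. For `κ = G/(b√v)` this gives `‖u‖ ≤ qκ` and `‖Δ‖ ≤ 2κ`. The
mixture density with respect to the unshifted Gaussian is therefore a perturbation of `1` of size
`qκ`, and its moments of order `N` or `-N` are `exp(O((Nqκ)²))` while `Nκ²` is small. This is
amplification by subsampling, proved in `HasGaussianMgf.integral_one_add_pow_le` and
`lintegral_mixDensity_ratio_le`.

The difficulty is that the SAGA point `w` of the differing sample is not a function of the messages:
it records when the sample was last drawn, which is secret, and its posterior law depends on the
dataset. So the rounds cannot be composed with `w` treated as public. Instead,
`expectedValue_le_of_moment` carries two families of unnormalized posterior weights `a`, `a'` on one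
finite set of candidate points. A round splits each candidate into two (kept, or replaced by `x`)
and multiplies the weights by likelihoods. All the remaining randomness is coupled so that messages
and states agree except at `w` (`recordedRound_shiftedNoise`). Since `(X, Y) ↦ X^(N+1)/Y^N` is
jointly convex and homogeneous of degree one, the quantity `(∑ a)^(N+1)/(∑ a')^N` grows in mean by
at most the one-round factor `Λ` (`sum_pow_div_sum_pow_le`). After the last round a Markov-type
inequality turns this moment into `(ε, δ)`, with `N` of order `log(1/δ)/ε` (`exists_moment_order`).

Utility. The Lyapunov function is the suboptimality plus weighted mean squared errors of the shifts
`s_i` and of the SAGA points. The server direction is unbiased, because `s` stays the average of the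
`s_i`; its variance is controlled by these two errors and the Gaussian noise, divided by `n` through
independence (`variance_direction_le`). Both errors contract, at rates of order `γ` and `q`, up to
multiples of the squared direction. With the weights of `admissibleWeights` every feedback term is
absorbed, and each round gains `η/5 ‖∇f‖²` up to a fixed noise increment
(`integral_potentialBound_le`). Telescoping and the identity `3 η_max R Y = 1` give the rate
(`utility_bound_of_descent`). -/

namespace SoteriaFL

open scoped ENNReal

/-! ### Resampling one coordinate of a product measure -/

section Resampling

variable {ι : Type*} [DecidableEq ι] {X : ι → Type*} [∀ i, MeasurableSpace (X i)]

lemma measurable_update_prod (i : ι) :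
    Measurable fun p : (∀ j, X j) × X i => Function.update p.1 i p.2 := by
  refine measurable_pi_lambda _ fun j => ?_
  by_cases h : j = i
  · subst h; simpa using measurable_snd
  · simp only [Function.update_of_ne h]; fun_prop

/-- Resampling one coordinate of an infinite product leaves the product law unchanged. -/
lemma infinitePi_map_update (μ : ∀ i, Measure (X i)) [∀ i, IsProbabilityMeasure (μ i)] (i : ι) :
    ((Measure.infinitePi μ).prod (μ i)).map (fun p => Function.update p.1 i p.2)
      = Measure.infinitePi μ := by
  refine Measure.eq_infinitePi (μ := μ) fun s t ht => ?_
  rw [Measure.map_apply (measurable_update_prod i)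
    (MeasurableSet.pi s.countable_toSet fun i _ => ht i)]
  by_cases hi : i ∈ s
  · have : (fun p : (∀ j, X j) × X i => Function.update p.1 i p.2) ⁻¹' Set.pi s t
        = (Set.pi (s.erase i : Finset ι) t) ×ˢ t i := by
      ext ⟨p, y⟩
      simp only [Set.mem_preimage, Set.mem_pi, Finset.mem_coe, Set.mem_prod, Finset.mem_erase]
      refine ⟨fun h => ⟨fun j hj => by simpa [hj.1] using h j hj.2, by simpa using h i hi⟩,
        fun h j hj => ?_⟩
      by_cases hji : j = i
      · subst hji; simpa using h.2
      · simpa [hji] using h.1 j ⟨hji, hj⟩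
    rw [this, Measure.prod_prod, Measure.infinitePi_pi _ (fun i _ => ht i),
      Finset.prod_erase_mul _ _ hi]
  · have : (fun p : (∀ j, X j) × X i => Function.update p.1 i p.2) ⁻¹' Set.pi s t
        = (Set.pi s t) ×ˢ Set.univ := by
      ext ⟨p, y⟩
      simp only [Set.mem_preimage, Set.mem_pi, Finset.mem_coe, Set.mem_prod, Set.mem_univ, and_true]
      refine forall₂_congr fun j hj => ?_
      rw [Function.update_of_ne (fun h : j = i => hi (h ▸ hj))]
    rw [this, Measure.prod_prod, measure_univ, mul_one, Measure.infinitePi_pi _ (fun i _ => ht i)]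

lemma lintegral_infinitePi_update (μ : ∀ i, Measure (X i)) [∀ i, IsProbabilityMeasure (μ i)]
    (i : ι) {F : (∀ i, X i) → ℝ≥0∞} (hF : Measurable F) :
    ∫⁻ r, F r ∂(Measure.infinitePi μ)
      = ∫⁻ r, ∫⁻ y, F (Function.update r i y) ∂(μ i) ∂(Measure.infinitePi μ) := by
  conv_lhs => rw [← infinitePi_map_update μ i]
  rw [lintegral_map hF (measurable_update_prod i)]
  exact lintegral_prod _ (hF.comp (measurable_update_prod i)).aemeasurable

lemma lintegral_pi_update [Fintype ι] (μ : ∀ i, Measure (X i)) [∀ i, IsProbabilityMeasure (μ i)]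
    (i : ι) {F : (∀ i, X i) → ℝ≥0∞} (hF : Measurable F) :
    ∫⁻ r, F r ∂(Measure.pi μ)
      = ∫⁻ r, ∫⁻ y, F (Function.update r i y) ∂(μ i) ∂(Measure.pi μ) := by
  rw [← Measure.infinitePi_eq_pi]
  exact lintegral_infinitePi_update μ i hF

end Resampling

/-! ### Change of measure for Gaussian shifts -/

section Gaussian

lemma gaussianReal_eq_withDensity (a : ℝ) :
    gaussianReal a 1
      = (gaussianReal 0 1).withDensity fun x => ENNReal.ofReal (Real.exp (a * x - a ^ 2 / 2)) := by
  rw [gaussianReal_of_var_ne_zero _ one_ne_zero, gaussianReal_of_var_ne_zero _ one_ne_zero,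
    ← withDensity_mul _ (by fun_prop) (by fun_prop)]
  congr 1
  ext x
  simp only [gaussianPDF, Pi.mul_apply, gaussianPDFReal]
  rw [← ENNReal.ofReal_mul (by positivity)]
  have : Real.exp (-(x - a) ^ 2 / (2 * (1 : NNReal)))
      = Real.exp (-(x - 0) ^ 2 / (2 * (1 : NNReal))) * Real.exp (a * x - a ^ 2 / 2) := by
    rw [← Real.exp_add]
    congr 1
    simp only [NNReal.coe_one]
    ring
  rw [this]
  congr 1
  ring

lemma pi_withDensity {ι : Type*} [Fintype ι] {X : ι → Type*} [∀ i, MeasurableSpace (X i)]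
    (μ : ∀ i, Measure (X i)) [∀ i, IsProbabilityMeasure (μ i)] (ρ : ∀ i, X i → ℝ≥0∞)
    (hρ : ∀ i, Measurable (ρ i)) [∀ i, IsProbabilityMeasure ((μ i).withDensity (ρ i))] :
    Measure.pi (fun i => (μ i).withDensity (ρ i))
      = (Measure.pi μ).withDensity fun x => ∏ i, ρ i (x i) := by
  refine Measure.pi_eq fun s hs => ?_
  rw [withDensity_apply _ (MeasurableSet.univ_pi hs), ← lintegral_indicator (MeasurableSet.univ_pi hs)]
  have : (Set.univ.pi s).indicator (fun x : ∀ i, X i => ∏ i, ρ i (x i))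
      = fun x => ∏ i, (s i).indicator (ρ i) (x i) := by
    ext x
    by_cases hx : x ∈ Set.univ.pi s
    · rw [Set.indicator_of_mem hx]
      exact Finset.prod_congr rfl fun i _ => by rw [Set.indicator_of_mem (hx i trivial)]
    · rw [Set.indicator_of_notMem hx]
      simp only [Set.mem_pi, Set.mem_univ, true_imp_iff, not_forall] at hx
      obtain ⟨i, hi⟩ := hx
      exact (Finset.prod_eq_zero (Finset.mem_univ i) (Set.indicator_of_notMem hi _)).symm
  have hm : ∀ i, Measurable ((s i).indicator (ρ i)) := fun i => (hρ i).indicator (hs i)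
  rw [this, lintegral_prod_eq_prod_lintegral_of_indepFun Finset.univ
    (fun i (x : ∀ i, X i) => (s i).indicator (ρ i) (x i))
    (iIndepFun_pi fun i => (hm i).aemeasurable) (fun i => (hm i).comp (measurable_pi_apply i))]
  refine Finset.prod_congr rfl fun i _ => ?_
  refine ((measurePreserving_eval μ i).lintegral_comp (hm i)).trans ?_
  rw [lintegral_indicator (hs i), withDensity_apply _ (hs i)]

variable {d : ℕ}

/-- The log-density of the shift by `a` of the standard Gaussian law on `ℝᵈ`. -/
noncomputable def logShift (a z : Vec d) : ℝ := inner ℝ a z - ‖a‖ ^ 2 / 2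

@[fun_prop]
lemma measurable_logShift (a : Vec d) : Measurable (logShift a) := by
  unfold logShift; fun_prop

/-- The Cameron--Martin formula for the standard Gaussian law on `ℝᵈ`. -/
lemma lintegral_stdGaussian_add (a : Vec d) {F : Vec d → ℝ≥0∞} (hF : Measurable F) :
    ∫⁻ z, F (z + a) ∂(stdGaussian (Vec d))
      = ∫⁻ z, ENNReal.ofReal (Real.exp (logShift a z)) * F z ∂(stdGaussian (Vec d)) := by
  have hmap : Measure.pi (fun i : Fin d => gaussianReal (a i) 1)
      = (Measure.pi fun _ : Fin d => gaussianReal 0 1).map fun x i => x i + a i := by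
    have h (i : Fin d) : (gaussianReal 0 1).map (fun x => x + a i) = gaussianReal (a i) 1 := by
      rw [gaussianReal_map_add_const]; simp
    have (i : Fin d) : SigmaFinite ((gaussianReal 0 1).map (fun x => x + a i)) := by
      rw [h]; infer_instance
    rw [Measure.pi_map_pi (f := fun i x => x + a i) (fun i => by fun_prop)]
    simp_rw [h]
  have hdens : Measure.pi (fun i : Fin d => gaussianReal (a i) 1)
      = (Measure.pi fun _ : Fin d => gaussianReal 0 1).withDensity
        fun x => ∏ i, ENNReal.ofReal (Real.exp (a i * x i - a i ^ 2 / 2)) := by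
    have (i : Fin d) : IsProbabilityMeasure ((gaussianReal 0 1).withDensity
        fun x => ENNReal.ofReal (Real.exp (a i * x - a i ^ 2 / 2))) := by
      rw [← gaussianReal_eq_withDensity]; infer_instance
    rw [← pi_withDensity (fun _ : Fin d => gaussianReal 0 1)
      (fun i x => ENNReal.ofReal (Real.exp (a i * x - a i ^ 2 / 2))) (fun i => by fun_prop)]
    simp_rw [← gaussianReal_eq_withDensity]
  have hm : Measurable (WithLp.toLp 2 : (Fin d → ℝ) → Vec d) := by fun_prop
  rw [← map_pi_eq_stdGaussian, lintegral_map (by fun_prop) hm, lintegral_map (by fun_prop) hm]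
  have h1 : ∫⁻ x : Fin d → ℝ, F (WithLp.toLp 2 x + a) ∂(Measure.pi fun _ => gaussianReal 0 1)
      = ∫⁻ x, F (WithLp.toLp 2 x) ∂(Measure.pi (fun i : Fin d => gaussianReal (a i) 1)) := by
    rw [hmap, lintegral_map (by fun_prop) (by fun_prop)]
    rfl
  rw [h1, hdens, lintegral_withDensity_eq_lintegral_mul _ (by fun_prop) (by fun_prop)]
  refine lintegral_congr fun x => ?_
  simp only [Pi.mul_apply]
  congr 1
  rw [← ENNReal.ofReal_prod_of_nonneg (fun i _ => (Real.exp_pos _).le), ← Real.exp_sum,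
    Finset.sum_sub_distrib, logShift, EuclideanSpace.real_norm_sq_eq, Finset.sum_div,
    PiLp.inner_apply]
  simp [mul_comm]

/-- The Cameron–Martin formula applied to the constant `1` says that `exp(logShift a)` has mean one;
the moment generating function is read off from this. -/
lemma integral_exp_inner_stdGaussian (a : Vec d) :
    Integrable (fun z => Real.exp (inner ℝ a z)) (stdGaussian (Vec d)) ∧
    ∫ z, Real.exp (inner ℝ a z) ∂(stdGaussian (Vec d)) = Real.exp (‖a‖ ^ 2 / 2) := by
  have h := lintegral_stdGaussian_add a (F := fun _ => 1) measurable_const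
  simp only [lintegral_const, measure_univ, mul_one] at h
  have h2 : ∫⁻ z, ENNReal.ofReal (Real.exp (inner ℝ a z)) ∂(stdGaussian (Vec d))
      = ENNReal.ofReal (Real.exp (‖a‖ ^ 2 / 2)) := by
    have : ∀ z : Vec d, ENNReal.ofReal (Real.exp (inner ℝ a z))
        = ENNReal.ofReal (Real.exp (‖a‖ ^ 2 / 2)) * ENNReal.ofReal (Real.exp (logShift a z)) := by
      intro z
      rw [← ENNReal.ofReal_mul (Real.exp_pos _).le, ← Real.exp_add, logShift]
      congr 2; ring
    simp_rw [this]
    rw [lintegral_const_mul _ (by fun_prop), ← h, mul_one]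
  have hi : Integrable (fun z : Vec d => Real.exp (inner ℝ a z)) (stdGaussian (Vec d)) := by
    refine ⟨by fun_prop, ?_⟩
    rw [hasFiniteIntegral_iff_ofReal (.of_forall fun z => (Real.exp_pos _).le), h2]
    exact ENNReal.ofReal_lt_top
  refine ⟨hi, ?_⟩
  rw [integral_eq_lintegral_of_nonneg_ae (.of_forall fun z => (Real.exp_pos _).le) (by fun_prop),
    h2, ENNReal.toReal_ofReal (Real.exp_pos _).le]

end Gaussian


/-! ### Moments of small multiplicative perturbations of one -/

section Moments

/-- A second-order Bernoulli inequality. Keeping the linear term exact matters: `R` will have almost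
zero mean, so only the quadratic remainder contributes. -/
lemma one_add_pow_le_of_abs {R : ℝ} (hR : 0 ≤ 1 + R) (N : ℕ) :
    (1 + R) ^ N ≤ 1 + N * R + (N : ℝ) ^ 2 * (R ^ 2 * (1 + |R|) ^ N) := by
  induction N with
  | zero => simp
  | succ N ih =>
    have hX : (1 : ℝ) ≤ 1 + |R| := by linarith [abs_nonneg R]
    have hX1 : 1 + R ≤ 1 + |R| := by linarith [le_abs_self R]
    have h1 := mul_le_mul_of_nonneg_right ih hR
    have h2 : (N : ℝ) ^ 2 * (R ^ 2 * (1 + |R|) ^ N) * (1 + R)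
        ≤ (N : ℝ) ^ 2 * (R ^ 2 * (1 + |R|) ^ (N + 1)) := by
      refine (mul_le_mul_of_nonneg_left hX1 (by positivity)).trans (le_of_eq ?_)
      ring
    have h3 : (N : ℝ) * R ^ 2 ≤ (N : ℝ) * (R ^ 2 * (1 + |R|) ^ (N + 1)) :=
      mul_le_mul_of_nonneg_left (le_mul_of_one_le_right (sq_nonneg R) (one_le_pow₀ hX))
        (Nat.cast_nonneg N)
    have h4 : 0 ≤ ((N : ℝ) + 1) * (R ^ 2 * (1 + |R|) ^ (N + 1)) := by positivity
    push_cast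
    rw [pow_succ (1 + R) N]
    nlinarith

lemma exp_sub_one_le_mul_exp (t : ℝ) : Real.exp t - 1 ≤ t * Real.exp t := by
  have h := Real.add_one_le_exp (-t)
  have h2 : Real.exp t * Real.exp (-t) = 1 := by rw [← Real.exp_add]; simp
  nlinarith [Real.exp_pos t]

/-- Combines `eᵗ - 1 ≤ t eᵗ` with `(t/κ)ᵏ/k! ≤ e^(t/κ)`. For `t` of typical size `κ` the exponential
has bounded mean, so the factor `κᵏ` is the true order of the `k`-th moment. -/
lemma exp_sub_one_pow_le {t κ : ℝ} (ht : 0 ≤ t) (hκ : 0 < κ) (k : ℕ) :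
    (Real.exp t - 1) ^ k ≤ k.factorial * κ ^ k * Real.exp ((κ⁻¹ + k) * t) := by
  have h0 : 0 ≤ Real.exp t - 1 := by linarith [Real.one_le_exp ht]
  have h1 := pow_le_pow_left₀ h0 (exp_sub_one_le_mul_exp t) k
  have h2 := Real.pow_div_factorial_le_exp (κ⁻¹ * t) (by positivity) k
  rw [div_le_iff₀ (by positivity), mul_pow] at h2
  have h3 : t ^ k ≤ k.factorial * κ ^ k * Real.exp (κ⁻¹ * t) := by
    have := mul_le_mul_of_nonneg_left h2 (show 0 ≤ κ ^ k by positivity)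
    rw [← mul_assoc, ← mul_pow, mul_inv_cancel₀ hκ.ne', one_pow, one_mul] at this
    linarith
  calc _ ≤ _ := h1
    _ = t ^ k * Real.exp (k * t) := by rw [mul_pow, ← Real.exp_nat_mul]
    _ ≤ k.factorial * κ ^ k * Real.exp (κ⁻¹ * t) * Real.exp (k * t) := by gcongr
    _ = _ := by rw [mul_assoc, ← Real.exp_add]; ring_nf

/-- For `t ≤ 1`, linearizing the exponential keeps the gain from `q`. For `t ≥ 1` this gain is given
up, and the event is paid for by `e^(l(t-1)) ≥ 1`, with `l` free. -/
lemma one_add_mul_exp_sub_one_pow_le {q t l : ℝ} (hq0 : 0 ≤ q) (hq1 : q ≤ 1) (ht : 0 ≤ t)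
    (hl : 0 ≤ l) (M : ℕ) :
    (1 + q * (Real.exp t - 1)) ^ M
      ≤ Real.exp ((2 * q * M) * t) + Real.exp (-l) * Real.exp ((M + l) * t) := by
  have h0 : 0 ≤ Real.exp t - 1 := by linarith [Real.one_le_exp ht]
  rcases le_total t 1 with h | h
  · have h1 : Real.exp t - 1 ≤ 2 * t := by
      have := Real.abs_exp_sub_one_sub_id_le (x := t) (by rwa [abs_of_nonneg ht])
      have := (abs_le.mp this).2
      nlinarith
    have h2 : 1 + q * (Real.exp t - 1) ≤ Real.exp (2 * q * t) := by
      have := Real.add_one_le_exp (2 * q * t)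
      nlinarith
    calc _ ≤ Real.exp (2 * q * t) ^ M := pow_le_pow_left₀ (by positivity) h2 M
      _ = Real.exp ((2 * q * M) * t) := by rw [← Real.exp_nat_mul]; ring_nf
      _ ≤ _ := le_add_of_nonneg_right (by positivity)
  · have h2 : 1 + q * (Real.exp t - 1) ≤ Real.exp t := by nlinarith
    calc _ ≤ Real.exp t ^ M := pow_le_pow_left₀ (by positivity) h2 M
      _ = Real.exp (M * t) := by rw [← Real.exp_nat_mul]
      _ ≤ Real.exp (-l) * Real.exp ((M + l) * t) := by
        rw [← Real.exp_add]
        refine Real.exp_le_exp.mpr ?_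
        nlinarith
      _ ≤ _ := le_add_of_nonneg_left (by positivity)

variable {Ω : Type*} [MeasurableSpace Ω]

/-- `t` is a nonnegative random variable with the moment generating function bounds of a Gaussian
of standard deviation `κ`. -/
structure HasGaussianMgf (C₀ C₁ κ : ℝ) (t : Ω → ℝ) (μ : Measure Ω) : Prop where
  measurable : Measurable t
  nonneg : ∀ x, 0 ≤ t x
  integrable : ∀ l, 0 ≤ l → Integrable (fun x => Real.exp (l * t x)) μ
  integral_le : ∀ l, 0 ≤ l → ∫ x, Real.exp (l * t x) ∂μ ≤ C₀ * Real.exp (C₁ * l ^ 2 * κ ^ 2)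

variable {μ : Measure Ω} {C₀ C₁ κ q : ℝ} {t : Ω → ℝ}

lemma HasGaussianMgf.integrable_exp_sub_one_pow (h : HasGaussianMgf C₀ C₁ κ t μ) (k : ℕ) :
    Integrable (fun x => (Real.exp (t x) - 1) ^ k) μ := by
  have hm := h.measurable
  refine (h.integrable k (Nat.cast_nonneg k)).mono' (by fun_prop) (.of_forall fun x => ?_)
  have h1 := Real.one_le_exp (h.nonneg x)
  rw [Real.norm_of_nonneg (pow_nonneg (by linarith) k), Real.exp_nat_mul]
  exact pow_le_pow_left₀ (by linarith) (by linarith) k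

lemma HasGaussianMgf.integral_exp_sub_one_pow_le (h : HasGaussianMgf C₀ C₁ κ t μ) (hκ : 0 < κ)
    (hκ1 : κ ≤ 1) (hC₀ : 0 ≤ C₀) (hC₁ : 0 ≤ C₁) (k : ℕ) :
    ∫ x, (Real.exp (t x) - 1) ^ k ∂μ
      ≤ k.factorial * C₀ * Real.exp (C₁ * (1 + k) ^ 2) * κ ^ k := by
  have hl : 0 ≤ κ⁻¹ + k := by positivity
  calc _ ≤ ∫ x, k.factorial * κ ^ k * Real.exp ((κ⁻¹ + k) * t x) ∂μ :=
        integral_mono (h.integrable_exp_sub_one_pow k) ((h.integrable _ hl).const_mul _)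
          fun x => exp_sub_one_pow_le (h.nonneg x) hκ k
    _ = k.factorial * κ ^ k * ∫ x, Real.exp ((κ⁻¹ + k) * t x) ∂μ := integral_const_mul _ _
    _ ≤ k.factorial * κ ^ k * (C₀ * Real.exp (C₁ * (κ⁻¹ + k) ^ 2 * κ ^ 2)) := by
        gcongr; exact h.integral_le _ hl
    _ ≤ k.factorial * κ ^ k * (C₀ * Real.exp (C₁ * (1 + k) ^ 2)) := by
        gcongr _ * (_ * Real.exp ?_)
        rw [mul_assoc, ← mul_pow, add_mul, inv_mul_cancel₀ hκ.ne']
        have : (k : ℝ) * κ ≤ k := mul_le_of_le_one_right (Nat.cast_nonneg k) hκ1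
        gcongr
    _ = _ := by ring

lemma HasGaussianMgf.integrable_one_add_mul_pow (h : HasGaussianMgf C₀ C₁ κ t μ)
    (hq0 : 0 ≤ q) (hq1 : q ≤ 1) (M : ℕ) :
    Integrable (fun x => (1 + q * (Real.exp (t x) - 1)) ^ M) μ := by
  have hm := h.measurable
  refine (h.integrable M (Nat.cast_nonneg M)).mono' (by fun_prop) (.of_forall fun x => ?_)
  have h1 := Real.one_le_exp (h.nonneg x)
  have h2 : 0 ≤ q * (Real.exp (t x) - 1) := mul_nonneg hq0 (by linarith)
  rw [Real.norm_of_nonneg (pow_nonneg (by linarith) M), Real.exp_nat_mul]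
  exact pow_le_pow_left₀ (by linarith) (by nlinarith) M

lemma HasGaussianMgf.integral_one_add_mul_pow_le (h : HasGaussianMgf C₀ C₁ κ t μ) (hκ : 0 < κ)
    (hC₀ : 0 ≤ C₀) (hC₁ : 0 < C₁) (hq0 : 0 ≤ q) (hq1 : q ≤ 1) {M : ℕ}
    (hM : 4 * C₁ * M * κ ^ 2 ≤ 1) :
    ∫ x, (1 + q * (Real.exp (t x) - 1)) ^ M ∂μ
      ≤ C₀ * Real.exp (4 * C₁ * (q * M * κ) ^ 2) + C₀ := by
  -- With this `l`, the hypothesis reads `M ≤ l`, and the tail exponent `C₁ (M + l)² κ² ≤ 4 C₁ l² κ²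
  -- = l` is cancelled by the factor `e^(-l)`.
  set l : ℝ := (4 * C₁ * κ ^ 2)⁻¹ with hl
  have hl0 : 0 < l := by positivity
  have hlk : 4 * C₁ * κ ^ 2 * l = 1 := mul_inv_cancel₀ (by positivity)
  have hMl : (M : ℝ) ≤ l := by
    rw [hl, ← one_div, le_div_iff₀ (by positivity)]; linarith
  have h1 : 0 ≤ 2 * q * M := by positivity
  have h2 : 0 ≤ M + l := by positivity
  calc _ ≤ ∫ x, (Real.exp ((2 * q * M) * t x) + Real.exp (-l) * Real.exp ((M + l) * t x)) ∂μ :=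
        integral_mono (h.integrable_one_add_mul_pow hq0 hq1 M)
          ((h.integrable _ h1).add ((h.integrable _ h2).const_mul _))
          fun x => one_add_mul_exp_sub_one_pow_le hq0 hq1 (h.nonneg x) hl0.le M
    _ = ∫ x, Real.exp ((2 * q * M) * t x) ∂μ
          + Real.exp (-l) * ∫ x, Real.exp ((M + l) * t x) ∂μ := by
        rw [integral_add (h.integrable _ h1) ((h.integrable _ h2).const_mul _),
          integral_const_mul]
    _ ≤ C₀ * Real.exp (C₁ * (2 * q * M) ^ 2 * κ ^ 2)
          + Real.exp (-l) * (C₀ * Real.exp (C₁ * (M + l) ^ 2 * κ ^ 2)) := by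
        gcongr
        · exact h.integral_le _ h1
        · exact h.integral_le _ h2
    _ ≤ C₀ * Real.exp (C₁ * (2 * q * M) ^ 2 * κ ^ 2)
          + Real.exp (-l) * (C₀ * Real.exp l) := by
        gcongr _ + _ * (_ * Real.exp ?_)
        calc C₁ * (M + l) ^ 2 * κ ^ 2 ≤ C₁ * (l + l) ^ 2 * κ ^ 2 := by gcongr
          _ = (4 * C₁ * κ ^ 2 * l) * l := by ring
          _ = l := by rw [hlk, one_mul]
    _ = _ := by
        rw [mul_left_comm, ← Real.exp_add, neg_add_cancel, Real.exp_zero, mul_one]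
        ring_nf

/-- The constant in the moment bound for subsampled perturbations of `1`. -/
noncomputable def momentConst (C₀ C₁ : ℝ) : ℝ :=
  2 * C₀ * Real.exp (C₁ * 3 ^ 2) + 24 * C₀ * Real.exp (C₁ * 5 ^ 2) + C₀ + 16 * C₁

/-- If `1 + R` is a nonnegative random variable with nearly unit mean such that `R` is dominated
by `q (eᵗ - 1)` with `t` of size `κ`, then its `N`-th moment is `exp (O((N q κ)²))`, as long as
`N κ²` is bounded. -/
lemma HasGaussianMgf.integral_one_add_pow_le [IsProbabilityMeasure μ] (h : HasGaussianMgf C₀ C₁ κ t μ) (hκ : 0 < κ)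
    (hκ1 : κ ≤ 1) (hC₀ : 0 ≤ C₀) (hC₁ : 0 < C₁) (hq0 : 0 < q) (hq1 : q ≤ 1) {R : Ω → ℝ}
    (hRm : Measurable R) (hR0 : ∀ x, 0 ≤ 1 + R x) (hR : ∀ x, |R x| ≤ q * (Real.exp (t x) - 1))
    (hRi : ∫ x, R x ∂μ ≤ q ^ 2 * ∫ x, (Real.exp (t x) - 1) ^ 2 ∂μ) {N : ℕ}
    (hN : 8 * C₁ * N * κ ^ 2 ≤ 1) :
    Integrable (fun x => (1 + R x) ^ N) μ ∧
    ∫ x, (1 + R x) ^ N ∂μ ≤ Real.exp (momentConst C₀ C₁ * (N * q * κ) ^ 2) := by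
  have hpos : ∀ x, 0 ≤ Real.exp (t x) - 1 := fun x => by
    linarith [Real.one_le_exp (h.nonneg x)]
  have hRint : Integrable R μ := by
    have := (h.integrable_exp_sub_one_pow 1).const_mul q
    simp only [pow_one] at this
    exact this.mono' hRm.aestronglyMeasurable (.of_forall hR)
  have hint : Integrable (fun x => (1 + R x) ^ N) μ := by
    refine (h.integrable_one_add_mul_pow hq0.le hq1 N).mono' (by fun_prop) (.of_forall fun x => ?_)
    rw [Real.norm_of_nonneg (pow_nonneg (hR0 x) N)]
    exact pow_le_pow_left₀ (hR0 x) (by linarith [le_abs_self (R x), hR x]) N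
  refine ⟨hint, ?_⟩
  have hqκ : 0 < q * κ := by positivity
  have hpt : ∀ x, (1 + R x) ^ N ≤ 1 + N * R x + (N : ℝ) ^ 2 / 2 *
      ((q / κ) ^ 2 * (Real.exp (t x) - 1) ^ 4
        + (q * κ) ^ 2 * (1 + q * (Real.exp (t x) - 1)) ^ (2 * N)) := by
    intro x
    refine (one_add_pow_le_of_abs (hR0 x) N).trans ?_
    set E := Real.exp (t x) - 1
    have hE := hpos x
    have h1 : R x ^ 2 ≤ (q * E) ^ 2 := by
      rw [← sq_abs]; exact pow_le_pow_left₀ (abs_nonneg _) (hR x) 2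
    have h2 : (1 + |R x|) ^ N ≤ (1 + q * E) ^ N :=
      pow_le_pow_left₀ (by positivity) (by linarith [hR x]) N
    have h3 : R x ^ 2 * (1 + |R x|) ^ N ≤ (q * E) ^ 2 * (1 + q * E) ^ N :=
      mul_le_mul h1 h2 (by positivity) (by positivity)
    -- The two factors are not independent, so AM–GM separates them. The weights `q/κ` and `qκ` are
    -- balanced: `(q/κ)² E⁴` has mean of order `(q/κ)² κ⁴ = (qκ)²`, like the second term.
    have h4 : (q * E) ^ 2 * (1 + q * E) ^ N
        ≤ ((q / κ) ^ 2 * E ^ 4 + (q * κ) ^ 2 * (1 + q * E) ^ (2 * N)) / 2 := by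
      have := two_mul_le_add_sq (q / κ * E ^ 2) (q * κ * (1 + q * E) ^ N)
      have e1 : 2 * (q / κ * E ^ 2) * (q * κ * (1 + q * E) ^ N)
          = 2 * ((q * E) ^ 2 * (1 + q * E) ^ N) := by field_simp
      have e2 : (q / κ * E ^ 2) ^ 2 = (q / κ) ^ 2 * E ^ 4 := by ring
      have e3 : (q * κ * (1 + q * E) ^ N) ^ 2 = (q * κ) ^ 2 * (1 + q * E) ^ (2 * N) := by ring
      rw [e1, e2, e3] at this
      linarith
    have := mul_le_mul_of_nonneg_left (h3.trans h4) (sq_nonneg (N : ℝ))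
    linarith
  have i1 : Integrable (fun x => 1 + N * R x) μ := (integrable_const _).add (hRint.const_mul _)
  have i2 := (h.integrable_exp_sub_one_pow 4).const_mul ((q / κ) ^ 2)
  have i3 := (h.integrable_one_add_mul_pow hq0.le hq1 (2 * N)).const_mul ((q * κ) ^ 2)
  have b2 := h.integral_exp_sub_one_pow_le hκ hκ1 hC₀ hC₁.le 2
  have b4 := h.integral_exp_sub_one_pow_le hκ hκ1 hC₀ hC₁.le 4
  have bM := h.integral_one_add_mul_pow_le hκ hC₀ hC₁ hq0.le hq1 (M := 2 * N)
    (by push_cast; linarith)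
  set y : ℝ := (N * q * κ) ^ 2 with hy
  have hy0 : 0 ≤ y := sq_nonneg _
  set A := 2 * C₀ * Real.exp (C₁ * 3 ^ 2) with hA
  set B := 24 * C₀ * Real.exp (C₁ * 5 ^ 2) with hB
  have hA0 : 0 ≤ A := by positivity
  have hB0 : 0 ≤ B := by positivity
  have b2' : ∫ x, (Real.exp (t x) - 1) ^ 2 ∂μ ≤ A * κ ^ 2 := by
    refine b2.trans (le_of_eq ?_); norm_num [hA, Nat.factorial]
  have b4' : ∫ x, (Real.exp (t x) - 1) ^ 4 ∂μ ≤ B * κ ^ 4 := by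
    refine b4.trans (le_of_eq ?_); norm_num [hB, Nat.factorial]
  have bM' : ∫ x, (1 + q * (Real.exp (t x) - 1)) ^ (2 * N) ∂μ
      ≤ C₀ * Real.exp (16 * C₁ * y) + C₀ := by
    refine bM.trans (le_of_eq ?_)
    rw [hy]; push_cast; ring_nf
  -- Lets the linear term, whose mean is `O(q²κ²)`, be absorbed in the quadratic scale `(Nqκ)²`.
  have hNN : (N : ℝ) ≤ (N : ℝ) ^ 2 := by
    rcases Nat.eq_zero_or_pos N with h0 | h0
    · simp [h0]
    · have : (1 : ℝ) ≤ N := by exact_mod_cast h0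
      nlinarith
  calc ∫ x, (1 + R x) ^ N ∂μ ≤ _ := integral_mono hint (i1.add ((i2.add i3).const_mul _)) hpt
    _ = 1 + N * ∫ x, R x ∂μ + (N : ℝ) ^ 2 / 2 * ((q / κ) ^ 2 * ∫ x, (Real.exp (t x) - 1) ^ 4 ∂μ
        + (q * κ) ^ 2 * ∫ x, (1 + q * (Real.exp (t x) - 1)) ^ (2 * N) ∂μ) := by
      have e1 : ∫ x, (1 + N * R x) ∂μ = 1 + N * ∫ x, R x ∂μ := by
        rw [integral_add (integrable_const _) (hRint.const_mul _), integral_const_mul]; simp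
      have e2 := integral_add i2 i3
      rw [integral_const_mul, integral_const_mul] at e2
      rw [← e1, ← e2, ← integral_const_mul]
      exact integral_add i1 ((i2.add i3).const_mul _)
    _ ≤ 1 + (N : ℝ) ^ 2 * (q ^ 2 * (A * κ ^ 2)) + (N : ℝ) ^ 2 / 2 * ((q / κ) ^ 2 * (B * κ ^ 4)
        + (q * κ) ^ 2 * (C₀ * Real.exp (16 * C₁ * y) + C₀)) := by
      have h1 : N * ∫ x, R x ∂μ ≤ (N : ℝ) ^ 2 * (q ^ 2 * (A * κ ^ 2)) := by
        calc N * ∫ x, R x ∂μ ≤ N * (q ^ 2 * (A * κ ^ 2)) := by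
              gcongr; exact hRi.trans (by gcongr)
          _ ≤ _ := by gcongr
      gcongr
    _ = 1 + y * (A + B / 2 + C₀ / 2) + y * (C₀ / 2) * Real.exp (16 * C₁ * y) := by
      rw [hy]; field_simp; ring
    _ ≤ Real.exp (16 * C₁ * y) * (1 + y * (A + B + C₀)) := by
      have h1 : 1 ≤ Real.exp (16 * C₁ * y) := Real.one_le_exp (by positivity)
      have h2 : 0 ≤ 1 + y * (A + B / 2 + C₀ / 2) := by positivity
      have h3 := mul_le_mul_of_nonneg_right h1 h2
      have h4 : 0 ≤ Real.exp (16 * C₁ * y) * (y * (B / 2)) := by positivity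
      linarith
    _ ≤ Real.exp (16 * C₁ * y) * Real.exp (y * (A + B + C₀)) := by
      gcongr; linarith [Real.add_one_le_exp (y * (A + B + C₀))]
    _ = _ := by
      rw [← Real.exp_add, momentConst, hA, hB]; ring_nf

end Moments


/-! ### Likelihood ratios of subsampled Gaussian mixtures -/

section Mixture

variable {d : ℕ} {q κ : ℝ} {u Δ : Vec d}

lemma integrable_exp_logShift (a : Vec d) :
    Integrable (fun z => Real.exp (logShift a z)) (stdGaussian (Vec d)) := by
  simp only [logShift, Real.exp_sub]
  exact (integral_exp_inner_stdGaussian a).1.div_const _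

lemma integral_exp_logShift (a : Vec d) :
    ∫ z, Real.exp (logShift a z) ∂(stdGaussian (Vec d)) = 1 := by
  simp only [logShift, Real.exp_sub]
  rw [integral_div, (integral_exp_inner_stdGaussian a).2, div_self (Real.exp_pos _).ne']

/-- The density, with respect to the standard Gaussian law, of the mixture with weights `1 - q` and
`q` of its shifts by `u` and `u + Δ`. -/
noncomputable def mixDensity (q : ℝ) (u Δ z : Vec d) : ℝ :=
  (1 - q) * Real.exp (logShift u z) + q * Real.exp (logShift (u + Δ) z)

@[fun_prop]
lemma measurable_mixDensity (q : ℝ) (u Δ : Vec d) : Measurable (mixDensity q u Δ) := by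
  unfold mixDensity; fun_prop

/-- A random variable that controls the fluctuations of `mixDensity`. -/
noncomputable def mixControl (κ q : ℝ) (u Δ z : Vec d) : ℝ :=
  |inner ℝ (q⁻¹ • u) z| + |inner ℝ Δ z| + 5 * κ ^ 2

lemma mixControl_nonneg (κ q : ℝ) (u Δ z : Vec d) : 0 ≤ mixControl κ q u Δ z := by
  unfold mixControl; positivity

lemma exp_abs_add_abs_le (a b : ℝ) :
    Real.exp (|a| + |b|)
      ≤ Real.exp (a + b) + Real.exp (a - b) + Real.exp (-a + b) + Real.exp (-a - b) := by
  have h1 := Real.exp_pos (a + b)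
  have h2 := Real.exp_pos (a - b)
  have h3 := Real.exp_pos (-a + b)
  have h4 := Real.exp_pos (-a - b)
  rcases abs_cases a with ⟨ha, -⟩ | ⟨ha, -⟩ <;> rcases abs_cases b with ⟨hb, -⟩ | ⟨hb, -⟩ <;>
    rw [ha, hb] <;> first | linarith | (rw [← sub_eq_add_neg]; linarith)

/-- The exponential of a sum of absolute values is dominated by the four sign choices, each a
Gaussian exponential with vector of norm at most `3κ`. The factor `5` is what the inverse density
needs below. -/
lemma hasGaussianMgf_mixControl (hq : 0 < q) (hκ : 0 < κ) (hκ1 : κ ≤ 1) (hu : ‖u‖ ≤ q * κ)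
    (hΔ : ‖Δ‖ ≤ 2 * κ) :
    HasGaussianMgf (4 * Real.exp 13) 125 κ (fun z => 5 * mixControl κ q u Δ z)
      (stdGaussian (Vec d)) := by
  have hu' : ‖q⁻¹ • u‖ ≤ κ := by
    rw [norm_smul, Real.norm_of_nonneg (by positivity), inv_mul_le_iff₀ hq]; exact hu
  have hsum (s : ℝ) (hs : s = 1 ∨ s = -1) (s' : ℝ) (hs' : s' = 1 ∨ s' = -1) :
      ‖s • (q⁻¹ • u) + s' • Δ‖ ≤ 3 * κ := by
    refine (norm_add_le _ _).trans ?_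
    have h1 : ‖s • (q⁻¹ • u)‖ = ‖q⁻¹ • u‖ := by rcases hs with rfl | rfl <;> simp
    have h2 : ‖s' • Δ‖ = ‖Δ‖ := by rcases hs' with rfl | rfl <;> simp
    rw [h1, h2]; linarith
  let g (l s s' : ℝ) (z : Vec d) : ℝ :=
    Real.exp (inner ℝ ((5 * l) • (s • (q⁻¹ • u) + s' • Δ)) z)
  have hpt (l : ℝ) (hl : 0 ≤ l) (z : Vec d) : Real.exp (l * (5 * mixControl κ q u Δ z))
      ≤ Real.exp (25 * l * κ ^ 2) * (g l 1 1 z + g l 1 (-1) z + g l (-1) 1 z + g l (-1) (-1) z) := by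
    have h := exp_abs_add_abs_le ((5 * l) * inner ℝ (q⁻¹ • u) z) ((5 * l) * inner ℝ Δ z)
    have e5 : |5 * l| = 5 * l := abs_of_nonneg (by positivity)
    rw [abs_mul (5 * l), abs_mul (5 * l), e5] at h
    have e : l * (5 * mixControl κ q u Δ z) = 25 * l * κ ^ 2
        + (5 * l * |inner ℝ (q⁻¹ • u) z| + 5 * l * |inner ℝ Δ z|) := by
      unfold mixControl; ring
    rw [e, Real.exp_add]
    refine mul_le_mul_of_nonneg_left (h.trans (le_of_eq ?_)) (Real.exp_pos _).le
    simp only [g, real_inner_smul_left, inner_add_left]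
    ring_nf
  have hint (l s s' : ℝ) : Integrable (g l s s') (stdGaussian (Vec d)) :=
    (integral_exp_inner_stdGaussian _).1
  have hbound (l : ℝ) (hl : 0 ≤ l) (s : ℝ) (hs : s = 1 ∨ s = -1) (s' : ℝ)
      (hs' : s' = 1 ∨ s' = -1) :
      ∫ z, g l s s' z ∂(stdGaussian (Vec d)) ≤ Real.exp (225 / 2 * l ^ 2 * κ ^ 2) := by
    refine (integral_exp_inner_stdGaussian _).2.trans_le (Real.exp_le_exp.mpr ?_)
    rw [norm_smul, Real.norm_of_nonneg (by positivity), mul_pow]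
    have : ‖s • (q⁻¹ • u) + s' • Δ‖ ^ 2 ≤ (3 * κ) ^ 2 :=
      pow_le_pow_left₀ (norm_nonneg _) (hsum s hs s' hs') 2
    nlinarith [mul_nonneg (sq_nonneg l) (sub_nonneg.mpr this)]
  have hmeas : Measurable fun z => 5 * mixControl κ q u Δ z := by unfold mixControl; fun_prop
  have hdom (l : ℝ) : Integrable (fun z => Real.exp (25 * l * κ ^ 2)
      * (g l 1 1 z + g l 1 (-1) z + g l (-1) 1 z + g l (-1) (-1) z)) (stdGaussian (Vec d)) :=
    ((((hint _ _ _).add (hint _ _ _)).add (hint _ _ _)).add (hint _ _ _)).const_mul _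
  have hI (l : ℝ) (hl : 0 ≤ l) : Integrable (fun z => Real.exp (l * (5 * mixControl κ q u Δ z)))
      (stdGaussian (Vec d)) := by
    refine (hdom l).mono' (hmeas.const_mul l).exp.aestronglyMeasurable (.of_forall fun z => ?_)
    rw [Real.norm_of_nonneg (Real.exp_pos _).le]
    exact hpt l hl z
  refine ⟨hmeas, fun z => mul_nonneg (by norm_num) (mixControl_nonneg ..), hI, fun l hl => ?_⟩
  refine (integral_mono (hI l hl) (hdom l) (hpt l hl)).trans ?_
  rw [integral_const_mul, integral_add (by exact ((hint _ _ _).add (hint _ _ _)).add (hint _ _ _))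
    (hint _ _ _), integral_add (by exact (hint _ _ _).add (hint _ _ _)) (hint _ _ _),
    integral_add (hint _ _ _) (hint _ _ _)]
  have e1 := hbound l hl 1 (.inl rfl) 1 (.inl rfl)
  have e2 := hbound l hl 1 (.inl rfl) (-1) (.inr rfl)
  have e3 := hbound l hl (-1) (.inr rfl) 1 (.inl rfl)
  have e4 := hbound l hl (-1) (.inr rfl) (-1) (.inr rfl)
  -- The deterministic part is made quadratic in `lκ` using `κ ≤ 1`; then `25/2 + 225/2 = 125`, and
  -- `13` rounds up `25/2`.
  have hk : 25 * l * κ ^ 2 ≤ 13 + 25 / 2 * l ^ 2 * κ ^ 2 := by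
    nlinarith [sq_nonneg (l * κ - 1), mul_nonneg (mul_nonneg hl hκ.le) (sub_nonneg.mpr hκ1)]
  calc _ ≤ Real.exp (25 * l * κ ^ 2) * (4 * Real.exp (225 / 2 * l ^ 2 * κ ^ 2)) :=
        mul_le_mul_of_nonneg_left (by linarith) (Real.exp_pos _).le
    _ = 4 * Real.exp (25 * l * κ ^ 2 + 225 / 2 * l ^ 2 * κ ^ 2) := by rw [Real.exp_add]; ring
    _ ≤ 4 * Real.exp (13 + 125 * l ^ 2 * κ ^ 2) := by
        refine mul_le_mul_of_nonneg_left (Real.exp_le_exp.mpr ?_) (by norm_num)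
        linarith
    _ = _ := by rw [Real.exp_add]; ring

lemma abs_exp_sub_one_le {x y : ℝ} (h : |x| ≤ y) : |Real.exp x - 1| ≤ Real.exp y - 1 := by
  have h1 := Real.exp_le_exp.mpr (abs_le.mp h).2
  have h2 := Real.exp_le_exp.mpr (abs_le.mp h).1
  have h3 : Real.exp y * Real.exp (-y) = 1 := by rw [← Real.exp_add]; simp
  have h4 := Real.exp_pos y
  have h5 := Real.exp_pos (-y)
  rw [abs_le]
  constructor
  · nlinarith [sq_nonneg (Real.exp y - 1)]
  · linarith

lemma exp_mul_sub_one_le {q t : ℝ} (hq0 : 0 ≤ q) (hq1 : q ≤ 1) :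
    Real.exp (q * t) - 1 ≤ q * (Real.exp t - 1) := by
  have := convexOn_exp.2 (Set.mem_univ 0) (Set.mem_univ t) (sub_nonneg.mpr hq1) hq0 (by ring)
  simp only [smul_eq_mul, mul_zero, zero_add, Real.exp_zero, mul_one] at this
  linarith

/-- The shift `u` is present with or without sampling, so its log-density must itself carry the
factor `q`; this is why `mixControl` contains the rescaled vector `q⁻¹ • u`. -/
lemma abs_logShift_le (hq : 0 < q) (hq1 : q ≤ 1) (hu : ‖u‖ ≤ q * κ) (z : Vec d) :
    |logShift u z| ≤ q * mixControl κ q u Δ z := by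
  have e : inner ℝ u z = q * inner ℝ (q⁻¹ • u) z := by
    rw [← real_inner_smul_left, smul_smul, mul_inv_cancel₀ hq.ne', one_smul]
  have h1 : ‖u‖ ^ 2 ≤ (q * κ) ^ 2 := by gcongr
  have h2 : q ^ 2 * κ ^ 2 ≤ q * κ ^ 2 := by nlinarith [sq_nonneg κ, mul_nonneg hq.le (sq_nonneg κ)]
  refine (abs_sub _ _).trans ?_
  rw [e, abs_mul, abs_of_pos hq, abs_of_nonneg (show 0 ≤ ‖u‖ ^ 2 / 2 by positivity)]
  unfold mixControl
  nlinarith [mul_nonneg hq.le (abs_nonneg (inner ℝ Δ z)), mul_nonneg hq.le (sq_nonneg κ)]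

/-- No factor `q` is needed here, since this component has weight `q` in the mixture. The summand
`5κ²` of `mixControl` covers `‖u + Δ‖²/2 ≤ 9κ²/2`. -/
lemma abs_logShift_add_le (hq : 0 < q) (hq1 : q ≤ 1) (hκ : 0 < κ) (hu : ‖u‖ ≤ q * κ)
    (hΔ : ‖Δ‖ ≤ 2 * κ) (z : Vec d) :
    |logShift (u + Δ) z| ≤ mixControl κ q u Δ z := by
  have e : inner ℝ u z = q * inner ℝ (q⁻¹ • u) z := by
    rw [← real_inner_smul_left, smul_smul, mul_inv_cancel₀ hq.ne', one_smul]
  have h0 : ‖u + Δ‖ ≤ 3 * κ := by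
    refine (norm_add_le _ _).trans ?_
    nlinarith
  have h1 : ‖u + Δ‖ ^ 2 ≤ (3 * κ) ^ 2 := by gcongr
  refine (abs_sub _ _).trans ?_
  rw [abs_of_nonneg (show 0 ≤ ‖u + Δ‖ ^ 2 / 2 by positivity), inner_add_left]
  have h2 := abs_add_le (inner ℝ u z) (inner ℝ Δ z)
  have h3 : |inner ℝ u z| ≤ |inner ℝ (q⁻¹ • u) z| := by
    rw [e, abs_mul, abs_of_pos hq]
    exact mul_le_of_le_one_left (abs_nonneg _) hq1
  unfold mixControl
  nlinarith [sq_nonneg κ]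

lemma mixDensity_pos (hq0 : 0 ≤ q) (hq1 : q ≤ 1) (z : Vec d) : 0 < mixDensity q u Δ z := by
  unfold mixDensity
  have h1 := Real.exp_pos (logShift u z)
  have h2 := Real.exp_pos (logShift (u + Δ) z)
  rcases hq0.eq_or_lt with rfl | hq
  · simpa using h1
  · have : 0 ≤ (1 - q) * Real.exp (logShift u z) := mul_nonneg (by linarith) h1.le
    positivity

/-- Both components deviate by at most `q(eᵗ - 1)`, one through the smallness of its shift
(convexity of `exp`), the other through its weight; then `2(eᵗ - 1) ≤ e^(2t) - 1`. -/
lemma abs_mixDensity_sub_one_le (hq : 0 < q) (hq1 : q ≤ 1) (hκ : 0 < κ) (hu : ‖u‖ ≤ q * κ)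
    (hΔ : ‖Δ‖ ≤ 2 * κ) (z : Vec d) :
    |mixDensity q u Δ z - 1| ≤ q * (Real.exp (2 * mixControl κ q u Δ z) - 1) := by
  set t := mixControl κ q u Δ z
  have ht : 0 ≤ t := mixControl_nonneg ..
  have h1 := (abs_exp_sub_one_le (abs_logShift_le (Δ := Δ) hq hq1 hu z)).trans
    (exp_mul_sub_one_le (t := t) hq.le hq1)
  have h2 := abs_exp_sub_one_le (abs_logShift_add_le hq hq1 hκ hu hΔ z)
  have e : mixDensity q u Δ z - 1 = (1 - q) * (Real.exp (logShift u z) - 1)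
      + q * (Real.exp (logShift (u + Δ) z) - 1) := by unfold mixDensity; ring
  rw [e]
  refine (abs_add_le _ _).trans ?_
  rw [abs_mul, abs_mul, abs_of_pos hq, abs_of_nonneg (show 0 ≤ 1 - q by linarith)]
  have hE := Real.one_le_exp ht
  have e2 : Real.exp (2 * t) = Real.exp t ^ 2 := by rw [← Real.exp_nat_mul]; norm_num
  rw [e2]
  calc (1 - q) * |Real.exp (logShift u z) - 1| + q * |Real.exp (logShift (u + Δ) z) - 1|
      ≤ 1 * (q * (Real.exp t - 1)) + q * (Real.exp t - 1) := by gcongr; linarith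
    _ = q * (2 * Real.exp t - 2) := by ring
    _ ≤ q * (Real.exp t ^ 2 - 1) := by
      exact mul_le_mul_of_nonneg_left (by nlinarith [sq_nonneg (Real.exp t - 1)]) hq.le

lemma exp_neg_le_mixDensity (hq : 0 < q) (hq1 : q ≤ 1) (hκ : 0 < κ) (hu : ‖u‖ ≤ q * κ)
    (hΔ : ‖Δ‖ ≤ 2 * κ) (z : Vec d) :
    Real.exp (-mixControl κ q u Δ z) ≤ mixDensity q u Δ z := by
  have ht : 0 ≤ mixControl κ q u Δ z := mixControl_nonneg ..
  have h1 := abs_logShift_le (Δ := Δ) hq hq1 hu z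
  have h2 := abs_logShift_add_le hq hq1 hκ hu hΔ z
  have h3 : Real.exp (-mixControl κ q u Δ z) ≤ Real.exp (logShift u z) := by
    refine Real.exp_le_exp.mpr ?_
    nlinarith [(abs_le.mp h1).1]
  have h4 : Real.exp (-mixControl κ q u Δ z) ≤ Real.exp (logShift (u + Δ) z) :=
    Real.exp_le_exp.mpr (abs_le.mp h2).1
  unfold mixDensity
  nlinarith

/-- The constant in the moment bounds for the densities of subsampled Gaussian mixtures. -/
noncomputable def renyiConst : ℝ := momentConst (4 * Real.exp 13) 125

lemma renyiConst_pos : 0 < renyiConst := by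
  unfold renyiConst momentConst; positivity

lemma integral_mixDensity (q : ℝ) (u Δ : Vec d) :
    Integrable (mixDensity q u Δ) (stdGaussian (Vec d)) ∧
    ∫ z, mixDensity q u Δ z ∂(stdGaussian (Vec d)) = 1 := by
  have h1 := (integrable_exp_logShift u).const_mul (1 - q)
  have h2 := (integrable_exp_logShift (u + Δ)).const_mul q
  refine ⟨h1.add h2, ?_⟩
  unfold mixDensity
  rw [integral_add h1 h2, integral_const_mul, integral_const_mul, integral_exp_logShift,
    integral_exp_logShift]
  ring

/-- The perturbation `mixDensity - 1` has mean exactly zero. The constant `1000` is `8 * 125`, with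
the `125` of `hasGaussianMgf_mixControl`. -/
lemma integral_mixDensity_pow_le (hq : 0 < q) (hq1 : q ≤ 1) (hκ : 0 < κ) (hκ1 : κ ≤ 1)
    (hu : ‖u‖ ≤ q * κ) (hΔ : ‖Δ‖ ≤ 2 * κ) {N : ℕ} (hN : 1000 * N * κ ^ 2 ≤ 1) :
    Integrable (fun z => mixDensity q u Δ z ^ N) (stdGaussian (Vec d)) ∧
    ∫ z, mixDensity q u Δ z ^ N ∂(stdGaussian (Vec d))
      ≤ Real.exp (renyiConst * (N * q * κ) ^ 2) := by
  have h := (hasGaussianMgf_mixControl hq hκ hκ1 hu hΔ).integral_one_add_pow_le hκ hκ1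
    (by positivity) (by norm_num) hq hq1 (R := fun z => mixDensity q u Δ z - 1) (N := N)
    (by fun_prop) (fun z => by linarith [mixDensity_pos (u := u) (Δ := Δ) hq.le hq1 z])
    (fun z => (abs_mixDensity_sub_one_le hq hq1 hκ hu hΔ z).trans (by
      refine mul_le_mul_of_nonneg_left (sub_le_sub_right (Real.exp_le_exp.mpr ?_) 1) hq.le
      linarith [mixControl_nonneg κ q u Δ z]))
    (by
      have := integral_mixDensity q u Δ
      rw [integral_sub this.1 (integrable_const _), this.2]
      simp only [integral_const, probReal_univ, smul_eq_mul, mul_one, sub_self]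
      exact mul_nonneg (sq_nonneg q) (integral_nonneg fun z => sq_nonneg _))
    (by linarith)
  simpa [renyiConst] using h

/-- Here the mean of the perturbation is not zero, but it is of second order: `1/f - 1 = (1 - f) +
(f - 1)²/f`, and `1 - f` integrates to zero. The factor `1/f ≤ eᵗ` is absorbed by passing from
`e^(2t) - 1` to `e^(5t) - 1`. -/
lemma integral_inv_mixDensity_pow_le (hq : 0 < q) (hq1 : q ≤ 1) (hκ : 0 < κ) (hκ1 : κ ≤ 1)
    (hu : ‖u‖ ≤ q * κ) (hΔ : ‖Δ‖ ≤ 2 * κ) {N : ℕ} (hN : 1000 * N * κ ^ 2 ≤ 1) :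
    Integrable (fun z => (mixDensity q u Δ z)⁻¹ ^ N) (stdGaussian (Vec d)) ∧
    ∫ z, (mixDensity q u Δ z)⁻¹ ^ N ∂(stdGaussian (Vec d))
      ≤ Real.exp (renyiConst * (N * q * κ) ^ 2) := by
  have hmgf := hasGaussianMgf_mixControl (d := d) hq hκ hκ1 hu hΔ
  have hf := fun z => mixDensity_pos (u := u) (Δ := Δ) hq.le hq1 z
  have hinv : ∀ z, (mixDensity q u Δ z)⁻¹ ≤ Real.exp (mixControl κ q u Δ z) := fun z => by
    rw [inv_le_comm₀ (hf z) (Real.exp_pos _), ← Real.exp_neg]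
    exact exp_neg_le_mixDensity hq hq1 hκ hu hΔ z
  have habs := fun z => abs_mixDensity_sub_one_le (u := u) (Δ := Δ) hq hq1 hκ hu hΔ z
  have hexp (z : Vec d) (k : ℕ) : Real.exp (k * mixControl κ q u Δ z)
      = Real.exp (mixControl κ q u Δ z) ^ k := Real.exp_nat_mul _ _
  have h2 := fun z => hexp z 2
  have h5 := fun z => hexp z 5
  push_cast at h2 h5
  have hE := fun z => Real.one_le_exp (mixControl_nonneg κ q u Δ z)
  have hpow : ∀ z, (Real.exp (2 * mixControl κ q u Δ z) - 1) * Real.exp (mixControl κ q u Δ z)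
      ≤ Real.exp (5 * mixControl κ q u Δ z) - 1 := fun z => by
    rw [h2, h5]
    have := hE z
    set x := Real.exp (mixControl κ q u Δ z)
    have : x ^ 3 ≤ x ^ 5 := pow_le_pow_right₀ this (by norm_num)
    nlinarith
  have hRabs : ∀ z, |(mixDensity q u Δ z)⁻¹ - 1|
      ≤ q * (Real.exp (5 * mixControl κ q u Δ z) - 1) := fun z => by
    have e : (mixDensity q u Δ z)⁻¹ - 1 = -(mixDensity q u Δ z - 1) * (mixDensity q u Δ z)⁻¹ := by
      have := (hf z).ne'
      field_simp; ring
    rw [e, abs_mul, abs_neg, abs_of_pos (inv_pos.mpr (hf z))]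
    calc _ ≤ q * (Real.exp (2 * mixControl κ q u Δ z) - 1) * Real.exp (mixControl κ q u Δ z) :=
          mul_le_mul (habs z) (hinv z) (inv_pos.mpr (hf z)).le ((abs_nonneg _).trans (habs z))
      _ ≤ _ := by rw [mul_assoc]; exact mul_le_mul_of_nonneg_left (hpow z) hq.le
  have hI2 := hmgf.integrable_exp_sub_one_pow 2
  have hI1 := (hmgf.integrable_exp_sub_one_pow 1).const_mul q
  simp only [pow_one] at hI1
  have hIf := integral_mixDensity q u Δ
  have hIinv : Integrable (fun z => (mixDensity q u Δ z)⁻¹ - 1) (stdGaussian (Vec d)) :=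
    hI1.mono' (by fun_prop) (.of_forall hRabs)
  have h := hmgf.integral_one_add_pow_le hκ hκ1
    (by positivity) (by norm_num) hq hq1 (R := fun z => (mixDensity q u Δ z)⁻¹ - 1) (N := N)
    (by fun_prop) (fun z => by linarith [inv_pos.mpr (hf z)]) hRabs
    (by
      have hle : ∀ z, (mixDensity q u Δ z)⁻¹ - 1 ≤ (1 - mixDensity q u Δ z)
          + q ^ 2 * (Real.exp (5 * mixControl κ q u Δ z) - 1) ^ 2 := fun z => by
        have e : (mixDensity q u Δ z)⁻¹ - 1 = (1 - mixDensity q u Δ z)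
            + (mixDensity q u Δ z - 1) ^ 2 * (mixDensity q u Δ z)⁻¹ := by
          have := (hf z).ne'
          field_simp; ring
        rw [e]
        refine add_le_add_right ?_ _
        have a1 : (mixDensity q u Δ z - 1) ^ 2
            ≤ (q * (Real.exp (2 * mixControl κ q u Δ z) - 1)) ^ 2 := by
          rw [← sq_abs]; exact pow_le_pow_left₀ (abs_nonneg _) (habs z) 2
        have a0 : 0 ≤ Real.exp (2 * mixControl κ q u Δ z) - 1 := by
          linarith [Real.one_le_exp (show 0 ≤ 2 * mixControl κ q u Δ z by
            linarith [mixControl_nonneg κ q u Δ z])]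
        calc _ ≤ (q * (Real.exp (2 * mixControl κ q u Δ z) - 1)) ^ 2
              * Real.exp (mixControl κ q u Δ z) :=
              mul_le_mul a1 (hinv z) (inv_pos.mpr (hf z)).le (sq_nonneg _)
          _ ≤ (q * (Real.exp (2 * mixControl κ q u Δ z) - 1)) ^ 2
              * Real.exp (mixControl κ q u Δ z) ^ 2 := by
              gcongr; exact le_self_pow₀ (hE z) (by norm_num)
          _ = q ^ 2 * ((Real.exp (2 * mixControl κ q u Δ z) - 1)
              * Real.exp (mixControl κ q u Δ z)) ^ 2 := by ring
          _ ≤ _ := by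
              refine mul_le_mul_of_nonneg_left (pow_le_pow_left₀ ?_ (hpow z) 2) (sq_nonneg q)
              exact mul_nonneg a0 (Real.exp_pos _).le
      refine (integral_mono hIinv (((integrable_const 1).sub hIf.1).add
        (hI2.const_mul (q ^ 2))) hle).trans (le_of_eq ?_)
      simp only [Pi.add_apply, Pi.sub_apply]
      rw [integral_add (by exact (integrable_const 1).sub hIf.1) (hI2.const_mul (q ^ 2)),
        integral_sub (integrable_const 1) hIf.1, hIf.2, integral_const_mul]
      simp)
    (by linarith)
  simpa [renyiConst] using h

/-- Moment bound for the likelihood ratio of two subsampled Gaussian mixtures. -/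
lemma lintegral_mixDensity_ratio_le {u' Δ' : Vec d} (hq : 0 < q) (hq1 : q ≤ 1) (hκ : 0 < κ)
    (hκ1 : κ ≤ 1) (hu : ‖u‖ ≤ q * κ) (hΔ : ‖Δ‖ ≤ 2 * κ) (hu' : ‖u'‖ ≤ q * κ)
    (hΔ' : ‖Δ'‖ ≤ 2 * κ) {n : ℕ} (hn : 2000 * (n + 1) * κ ^ 2 ≤ 1) :
    ∫⁻ z, ENNReal.ofReal (mixDensity q u Δ z ^ (n + 1) / mixDensity q u' Δ' z ^ n)
        ∂(stdGaussian (Vec d))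
      ≤ ENNReal.ofReal (Real.exp (renyiConst * (2 * (n + 1) * q * κ) ^ 2)) := by
  have h1 := integral_mixDensity_pow_le (N := 2 * (n + 1)) hq hq1 hκ hκ1 hu hΔ
    (by push_cast; linarith)
  have h2 := integral_inv_mixDensity_pow_le (N := 2 * n) hq hq1 hκ hκ1 hu' hΔ'
    (by push_cast; nlinarith [sq_nonneg κ])
  -- AM–GM decouples the two densities, so each is compared with the standard Gaussian alone, at the
  -- cost of doubling the order of the moments.
  have hpt : ∀ z, mixDensity q u Δ z ^ (n + 1) / mixDensity q u' Δ' z ^ n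
      ≤ (mixDensity q u Δ z ^ (2 * (n + 1)) + (mixDensity q u' Δ' z)⁻¹ ^ (2 * n)) / 2 := fun z => by
    have := two_mul_le_add_sq (mixDensity q u Δ z ^ (n + 1)) ((mixDensity q u' Δ' z)⁻¹ ^ n)
    rw [div_eq_mul_inv, ← inv_pow]
    rw [← pow_mul, ← pow_mul] at this
    rw [mul_comm 2 (n + 1), mul_comm 2 n]
    linarith
  have hI := (h1.1.add h2.1).div_const 2
  calc _ ≤ ∫⁻ z, ENNReal.ofReal ((mixDensity q u Δ z ^ (2 * (n + 1))
          + (mixDensity q u' Δ' z)⁻¹ ^ (2 * n)) / 2) ∂(stdGaussian (Vec d)) :=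
        lintegral_mono fun z => ENNReal.ofReal_le_ofReal (hpt z)
    _ = ENNReal.ofReal (∫ z, (mixDensity q u Δ z ^ (2 * (n + 1))
          + (mixDensity q u' Δ' z)⁻¹ ^ (2 * n)) / 2 ∂(stdGaussian (Vec d))) := by
        refine (ofReal_integral_eq_lintegral_ofReal hI (.of_forall fun z => ?_)).symm
        have := (mixDensity_pos (u := u) (Δ := Δ) hq.le hq1 z).le
        have := (mixDensity_pos (u := u') (Δ := Δ') hq.le hq1 z).le
        simp only [Pi.zero_apply, Pi.add_apply]
        positivity
    _ ≤ _ := by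
        refine ENNReal.ofReal_le_ofReal ?_
        rw [integral_div, integral_add h1.1 h2.1]
        have h3 : Real.exp (renyiConst * ((2 * n : ℕ) * q * κ) ^ 2)
            ≤ Real.exp (renyiConst * (2 * (n + 1) * q * κ) ^ 2) := by
          have := renyiConst_pos
          gcongr
          push_cast; linarith
        have h4 := h1.2
        push_cast at h4
        linarith [h2.2]

end Mixture

/-! ### Joint convexity of the Rényi functional -/

section Jensen

/-- The tangent plane of a convex function, homogeneous of degree one, along the ray `x = r y`. It
is Bernoulli's inequality for `x/(yr)`. -/
lemma tangent_le_pow_div_pow {x y r : ℝ} (hx : 0 < x) (hy : 0 < y) (hr : 0 ≤ r) (n : ℕ) :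
    (n + 1) * r ^ n * x - n * r ^ (n + 1) * y ≤ x ^ (n + 1) / y ^ n := by
  rcases hr.eq_or_lt with rfl | hr
  · rcases Nat.eq_zero_or_pos n with rfl | hn
    · simp
    · have : (0 : ℝ) ≤ x ^ (n + 1) / y ^ n := by positivity
      simpa [hn.ne'] using this
  · have h := one_add_mul_le_pow (show -2 ≤ x / (y * r) - 1 by
      have : 0 < x / (y * r) := by positivity
      linarith) (n + 1)
    rw [add_sub_cancel, div_pow, le_div_iff₀ (by positivity)] at h
    rw [le_div_iff₀ (by positivity)]
    refine le_trans (le_of_eq ?_) h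
    push_cast
    field_simp
    ring

/-- Joint convexity of `(x, y) ↦ x^(n+1) / y^n`, for two independent averages. -/
lemma sum_pow_div_sum_pow_le {I : Type*} [Fintype I] {a a' f f' : I → ℝ} (ha : ∀ h, 0 ≤ a h)
    (ha' : ∀ h, 0 ≤ a' h) (hA : 0 < ∑ h, a h) (hA' : 0 < ∑ h, a' h) (hf : ∀ h, 0 < f h)
    (hf' : ∀ h, 0 < f' h) (n : ℕ) :
    (∑ h, a h * f h) ^ (n + 1) / (∑ h, a' h * f' h) ^ n
      ≤ ∑ h, ∑ k, a h * a' k * ((∑ h, a h) ^ n / (∑ h, a' h) ^ (n + 1))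
          * (f h ^ (n + 1) / f' k ^ n) := by
  set A := ∑ h, a h
  set A' := ∑ h, a' h
  set P := ∑ h, a h * f h with hP
  set P' := ∑ h, a' h * f' h with hP'
  have hpos {a f : I → ℝ} (ha : ∀ h, 0 ≤ a h) (hA : 0 < ∑ h, a h) (hf : ∀ h, 0 < f h) :
      0 < ∑ h, a h * f h := by
    obtain ⟨i, hi, hi'⟩ := Finset.exists_ne_zero_of_sum_ne_zero hA.ne'
    exact Finset.sum_pos' (fun h _ => mul_nonneg (ha h) (hf h).le)
      ⟨i, hi, mul_pos (lt_of_le_of_ne (ha i) (Ne.symm hi')) (hf i)⟩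
  have hP0 : 0 < P := hpos ha hA hf
  have hP0' : 0 < P' := hpos ha' hA' hf'
  -- The ratio of the two weighted means: along this ray the averaged tangent planes reproduce the
  -- left-hand side exactly.
  set r := P * A' / (P' * A) with hr
  have hr0 : 0 ≤ r := by positivity
  have hsum : ∑ h, ∑ k, a h * a' k * (A ^ n / A' ^ (n + 1))
      * ((n + 1) * r ^ n * f h - n * r ^ (n + 1) * f' k) = P ^ (n + 1) / P' ^ n := by
    have e1 : ∀ h k, a h * a' k * (A ^ n / A' ^ (n + 1))
        * ((n + 1) * r ^ n * f h - n * r ^ (n + 1) * f' k)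
        = (A ^ n / A' ^ (n + 1)) * ((n + 1) * r ^ n) * ((a h * f h) * a' k)
          - (A ^ n / A' ^ (n + 1)) * (n * r ^ (n + 1)) * (a h * (a' k * f' k)) := by
      intros; ring
    simp_rw [e1, Finset.sum_sub_distrib, ← Finset.mul_sum, ← Finset.sum_mul]
    change (A ^ n / A' ^ (n + 1)) * ((n + 1) * r ^ n) * (P * A')
      - (A ^ n / A' ^ (n + 1)) * (n * r ^ (n + 1)) * (A * P') = _
    have e2 : r ^ (n + 1) * (A * P') = r ^ n * (P * A') := by
      rw [pow_succ, hr]; field_simp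
    calc _ = (A ^ n / A' ^ (n + 1)) * ((n + 1) * (r ^ n * (P * A')) - n * (r ^ (n + 1) * (A * P'))) := by
          ring
      _ = (A ^ n / A' ^ (n + 1)) * (r ^ n * (P * A')) := by rw [e2]; ring
      _ = _ := by
          rw [hr, div_pow, mul_pow, mul_pow, pow_succ, pow_succ]; field_simp
  rw [← hsum]
  refine Finset.sum_le_sum fun h _ => Finset.sum_le_sum fun k _ => ?_
  exact mul_le_mul_of_nonneg_left (tangent_le_pow_div_pow (hf h) (hf' k) hr0 n)
    (mul_nonneg (mul_nonneg (ha h) (ha' k)) (by positivity))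

/-- The pairs `(h, k)` run over the full product, because the two weight families need not be
proportional. Their coefficients add up to `A A' · Aⁿ/A'^(n+1) = A^(n+1)/A'ⁿ`. -/
lemma lintegral_sum_pow_div_le {Ω I : Type*} [MeasurableSpace Ω] [Fintype I] (μ : Measure Ω)
    {a a' : I → ℝ} {f f' : I → Ω → ℝ} (ha : ∀ h, 0 ≤ a h)
    (ha' : ∀ h, 0 ≤ a' h) (hA : 0 < ∑ h, a h) (hA' : 0 < ∑ h, a' h) (hf : ∀ h x, 0 < f h x)
    (hf' : ∀ h x, 0 < f' h x) (hfm : ∀ h, Measurable (f h)) (hfm' : ∀ h, Measurable (f' h)) (n : ℕ)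
    {Λ : ℝ≥0∞}
    (hΛ : ∀ h k, ∫⁻ x, ENNReal.ofReal (f h x ^ (n + 1) / f' k x ^ n) ∂μ ≤ Λ) :
    ∫⁻ x, ENNReal.ofReal ((∑ h, a h * f h x) ^ (n + 1) / (∑ h, a' h * f' h x) ^ n) ∂μ
      ≤ Λ * ENNReal.ofReal ((∑ h, a h) ^ (n + 1) / (∑ h, a' h) ^ n) := by
  set A := ∑ h, a h
  set A' := ∑ h, a' h
  set w : I → I → ℝ := fun h k => a h * a' k * (A ^ n / A' ^ (n + 1)) with hw
  have hw0 : ∀ h k, 0 ≤ w h k := fun h k =>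
    mul_nonneg (mul_nonneg (ha h) (ha' k)) (by positivity)
  have hpt : ∀ x, ENNReal.ofReal ((∑ h, a h * f h x) ^ (n + 1) / (∑ h, a' h * f' h x) ^ n)
      ≤ ∑ h, ∑ k, ENNReal.ofReal (w h k) * ENNReal.ofReal (f h x ^ (n + 1) / f' k x ^ n) := by
    intro x
    refine (ENNReal.ofReal_le_ofReal (sum_pow_div_sum_pow_le ha ha' hA hA'
      (fun h => hf h x) (fun h => hf' h x) n)).trans (le_of_eq ?_)
    have h0 : ∀ h k, 0 ≤ w h k * (f h x ^ (n + 1) / f' k x ^ n) := fun h k =>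
      mul_nonneg (hw0 h k) (div_nonneg (pow_nonneg (hf h x).le _) (pow_nonneg (hf' k x).le _))
    rw [ENNReal.ofReal_sum_of_nonneg fun h _ => Finset.sum_nonneg fun k _ => h0 h k]
    refine Finset.sum_congr rfl fun h _ => ?_
    rw [ENNReal.ofReal_sum_of_nonneg fun k _ => h0 h k]
    exact Finset.sum_congr rfl fun k _ => ENNReal.ofReal_mul (hw0 h k)
  have hm : ∀ h k, Measurable fun x => ENNReal.ofReal (f h x ^ (n + 1) / f' k x ^ n) := by
    intro h k
    have := hfm h
    have := hfm' k
    fun_prop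
  calc _ ≤ _ := lintegral_mono hpt
    _ = ∑ h, ∑ k, ENNReal.ofReal (w h k)
          * ∫⁻ x, ENNReal.ofReal (f h x ^ (n + 1) / f' k x ^ n) ∂μ := by
        rw [lintegral_finsetSum _ fun h _ => Finset.measurable_sum _ fun k _ =>
          (hm h k).const_mul _]
        refine Finset.sum_congr rfl fun h _ => ?_
        rw [lintegral_finsetSum _ fun k _ => (hm h k).const_mul _]
        exact Finset.sum_congr rfl fun k _ => lintegral_const_mul _ (hm h k)
    _ ≤ ∑ h, ∑ k, ENNReal.ofReal (w h k) * Λ := by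
        gcongr with h _ k _; exact hΛ h k
    _ = Λ * ENNReal.ofReal (∑ h, ∑ k, w h k) := by
        rw [ENNReal.ofReal_sum_of_nonneg fun h _ => Finset.sum_nonneg fun k _ => hw0 h k,
          mul_comm, Finset.sum_mul]
        refine Finset.sum_congr rfl fun h _ => ?_
        rw [ENNReal.ofReal_sum_of_nonneg fun k _ => hw0 h k, Finset.sum_mul]
    _ = _ := by
        congr 2
        simp_rw [hw, ← Finset.sum_mul, ← Finset.mul_sum, ← Finset.sum_mul]
        change A * A' * (A ^ n / A' ^ (n + 1)) = _
        rw [pow_succ, pow_succ]; field_simp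

end Jensen


/-! ### Measurability of the state and of one round -/

section Measurability

variable {d n m : ℕ} {Z U P : Type*} [MeasurableSpace U] [MeasurableSpace P]

lemma IsLSmooth.continuous_gradient {L : ℝ} {φ : Vec d → ℝ} (h : IsLSmooth L φ) :
    Continuous (∇ φ) := by
  have : LipschitzWith L.toNNReal (∇ φ) := LipschitzWith.of_dist_le_mul fun x y => by
    rw [dist_eq_norm, dist_eq_norm]
    exact (h.2 x y).trans (mul_le_mul_of_nonneg_right (Real.le_coe_toNNReal L) (norm_nonneg _))
  exact this.continuous

instance : MeasurableSpace (State d n m) :=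
  MeasurableSpace.comap (fun s => (s.x, s.shift, s.serverShift, s.table)) inferInstance

lemma measurable_state_tuple :
    Measurable fun s : State d n m => (s.x, s.shift, s.serverShift, s.table) :=
  comap_measurable _

lemma measurable_state_mk {x : P → Vec d} {s : P → Fin n → Vec d} {s' : P → Vec d}
    {w : P → Fin n → Fin m → Vec d} (hx : Measurable x) (hs : Measurable s) (hs' : Measurable s')
    (hw : Measurable w) : Measurable fun p => (⟨x p, s p, s' p, w p⟩ : State d n m) :=
  measurable_comap_iff.mpr (hx.prodMk (hs.prodMk (hs'.prodMk hw)))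

lemma measurable_state_x : Measurable (State.x : State d n m → Vec d) :=
  measurable_fst.comp measurable_state_tuple

lemma measurable_state_shift : Measurable (State.shift : State d n m → Fin n → Vec d) :=
  (measurable_fst.comp measurable_snd).comp measurable_state_tuple

lemma measurable_state_serverShift : Measurable (State.serverShift : State d n m → Vec d) :=
  (measurable_fst.comp (measurable_snd.comp measurable_snd)).comp measurable_state_tuple

lemma measurable_state_table : Measurable (State.table : State d n m → Fin n → Fin m → Vec d) :=
  (measurable_snd.comp (measurable_snd.comp measurable_snd)).comp measurable_state_tuple

lemma measurableSet_bool_apply {β : P → Fin m → Bool} (hβ : Measurable β) (j : Fin m) :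
    MeasurableSet {p | β p j = true} :=
  ((measurable_pi_apply j).comp hβ) (measurableSet_singleton true)

lemma measurable_sagaEstimator {ℓ : Z → Vec d → ℝ} (hℓ : ∀ z, Measurable (∇ (ℓ z))) (b : ℝ)
    (Di : Fin m → Z) {x : P → Vec d} {w : P → Fin m → Vec d} {β : P → Fin m → Bool}
    (hx : Measurable x) (hw : Measurable w) (hβ : Measurable β) :
    Measurable fun p => sagaEstimator ℓ b Di (x p) (w p) (β p) := by
  unfold sagaEstimator
  simp_rw [Finset.sum_filter]
  have hw' : ∀ j, Measurable fun p => w p j := fun j => (measurable_pi_apply j).comp hw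
  refine ((Finset.measurable_sum _ fun j _ => ?_).const_smul (1 / b)).add
    ((Finset.measurable_sum _ fun j _ => (hℓ _).comp (hw' j)).const_smul (1 / (m : ℝ)))
  exact Measurable.ite (measurableSet_bool_apply hβ j)
    (((hℓ _).comp hx).sub ((hℓ _).comp (hw' j))) measurable_const

variable {ℓ : Z → Vec d → ℝ} {C : Fin n → U → Vec d → Vec d} {st : P → State d n m}
  {r : P → Fin n → ClientNoise d m U}

lemma measurable_message (hℓ : ∀ z, Measurable (∇ (ℓ z)))
    (hC : ∀ i, Measurable (Function.uncurry (C i))) (b : ℝ) (D : Fin n → Fin m → Z)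
    (hst : Measurable st) (hr : Measurable r) (i : Fin n) :
    Measurable fun p => message ℓ b C D (st p) (r p) i := by
  have hri : Measurable fun p => r p i := (measurable_pi_apply i).comp hr
  have h1 : Measurable fun p => (st p).table i :=
    (measurable_pi_apply i).comp (measurable_state_table.comp hst)
  have h2 : Measurable fun p => (st p).shift i :=
    (measurable_pi_apply i).comp (measurable_state_shift.comp hst)
  have h3 := measurable_sagaEstimator hℓ b (D i) (measurable_state_x.comp hst) h1
    (measurable_fst.comp hri)
  exact (hC i).comp ((measurable_snd.comp (measurable_snd.comp hri)).prodMk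
    ((h3.add (measurable_fst.comp (measurable_snd.comp hri))).sub h2))

lemma measurable_round (hℓ : ∀ z, Measurable (∇ (ℓ z)))
    (hC : ∀ i, Measurable (Function.uncurry (C i))) (η γ b : ℝ) (D : Fin n → Fin m → Z)
    (hst : Measurable st) (hr : Measurable r) :
    Measurable fun p => round ℓ η γ b C D (st p) (r p) := by
  have hmsg := fun i => measurable_message hℓ hC b D hst hr i
  have hx := measurable_state_x.comp hst
  have hs := measurable_state_shift.comp hst
  have hss := measurable_state_serverShift.comp hst
  have hw := measurable_state_table.comp hst
  have havg := (Finset.measurable_sum Finset.univ fun i _ => hmsg i).const_smul (1 / (n : ℝ))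
  refine measurable_state_mk (hx.sub ((hss.add havg).const_smul η))
    (measurable_pi_lambda _ fun i => ((measurable_pi_apply i).comp hs).add ((hmsg i).const_smul γ))
    (hss.add (havg.const_smul γ))
    (measurable_pi_lambda _ fun i => measurable_pi_lambda _ fun j => ?_)
  exact Measurable.ite (measurableSet_bool_apply (β := fun p => (r p i).1)
    (measurable_fst.comp ((measurable_pi_apply i).comp hr)) j) hx
    ((measurable_pi_apply j).comp ((measurable_pi_apply i).comp hw))

end Measurability

/-! ### Runs with a record of all messages -/

section Trajectory

variable {d n m : ℕ} {Z U : Type*} (ℓ : Z → Vec d → ℝ) (η γ b : ℝ)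
  (C : ℕ → Fin n → U → Vec d → Vec d)

lemma run_update (x₀ : Vec d) (D : Fin n → Fin m → Z) (r : Noise d n m U) {s t : ℕ} (h : t ≤ s)
    (y : Fin n → ClientNoise d m U) :
    run ℓ η γ b C x₀ D (Function.update r s y) t = run ℓ η γ b C x₀ D r t := by
  induction t with
  | zero => rfl
  | succ t ih =>
    simp only [run]
    rw [ih (by omega), Function.update_of_ne (by omega)]

/-- A round of the algorithm, together with a record of the messages of all rounds. -/
noncomputable def recordedRound (t : ℕ) (D : Fin n → Fin m → Z)
    (p : State d n m × (ℕ → Fin n → Vec d)) (r : Fin n → ClientNoise d m U) :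
    State d n m × (ℕ → Fin n → Vec d) :=
  (round ℓ η γ b (C t) D p.1 r, Function.update p.2 t (message ℓ b (C t) D p.1 r))

/-- The run of the algorithm, together with a record of the messages of all rounds. -/
noncomputable def recordedRun (x₀ : Vec d) (D : Fin n → Fin m → Z) (r : Noise d n m U) :
    ℕ → State d n m × (ℕ → Fin n → Vec d)
  | 0 => (initState n m x₀, 0)
  | t + 1 => recordedRound ℓ η γ b C t D (recordedRun x₀ D r t) (r t)

lemma recordedRun_fst (x₀ : Vec d) (D : Fin n → Fin m → Z) (r : Noise d n m U) (t : ℕ) :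
    (recordedRun ℓ η γ b C x₀ D r t).1 = run ℓ η γ b C x₀ D r t := by
  induction t with
  | zero => rfl
  | succ t ih => simp only [recordedRun, recordedRound, run, ih]

lemma recordedRun_snd (x₀ : Vec d) (D : Fin n → Fin m → Z) (r : Noise d n m U) {s t : ℕ}
    (h : s < t) : (recordedRun ℓ η γ b C x₀ D r t).2 s
      = message ℓ b (C s) D (run ℓ η γ b C x₀ D r s) (r s) := by
  induction t with
  | zero => omega
  | succ t ih =>
    simp only [recordedRun, recordedRound]
    by_cases hs : s = t
    · subst hs; rw [Function.update_self, recordedRun_fst]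
    · rw [Function.update_of_ne hs, ih (by omega)]

lemma recordedRun_update (x₀ : Vec d) (D : Fin n → Fin m → Z) (r : Noise d n m U) {s t : ℕ}
    (h : t ≤ s) (y : Fin n → ClientNoise d m U) :
    recordedRun ℓ η γ b C x₀ D (Function.update r s y) t = recordedRun ℓ η γ b C x₀ D r t := by
  induction t with
  | zero => rfl
  | succ t ih =>
    simp only [recordedRun]
    rw [ih (by omega), Function.update_of_ne (by omega)]

end Trajectory

/-! ### Backward recursion for the law of the transcript -/

section Law

variable {d n m : ℕ} {Z U : Type*} [MeasurableSpace U]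

instance (q : ℝ) : IsProbabilityMeasure (batchLaw m q) := by
  unfold batchLaw; infer_instance

instance (v : ℝ) : IsProbabilityMeasure (gaussianLaw d v) :=
  Measure.isProbabilityMeasure_map (by fun_prop)

/-- The law of the randomness of one round. -/
noncomputable def roundLaw (d n m : ℕ) (q v : ℝ) (ν : Fin n → Measure U) :
    Measure (Fin n → ClientNoise d m U) :=
  Measure.pi fun i => (batchLaw m q).prod ((gaussianLaw d v).prod (ν i))

instance (q v : ℝ) (ν : Fin n → Measure U) [∀ i, IsProbabilityMeasure (ν i)] :
    IsProbabilityMeasure (roundLaw d n m q v ν) := by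
  unfold roundLaw; infer_instance

lemma noiseLaw_eq (q v : ℝ) (ν : ℕ → Fin n → Measure U) :
    noiseLaw d n m q v ν = Measure.infinitePi fun t => roundLaw d n m q v (ν t) := rfl

instance (q v : ℝ) (ν : ℕ → Fin n → Measure U) [∀ t i, IsProbabilityMeasure (ν t i)] :
    IsProbabilityMeasure (noiseLaw d n m q v ν) := by
  rw [noiseLaw_eq]; infer_instance

/-- The noise of round `t` can be averaged out separately from the past. -/
lemma lintegral_noiseLaw_past {S : Type*} [MeasurableSpace S] (q v : ℝ)
    (ν : ℕ → Fin n → Measure U) [∀ t i, IsProbabilityMeasure (ν t i)] (t : ℕ)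
    {X : Noise d n m U → S} (hX : Measurable X) (hXt : ∀ r y, X (Function.update r t y) = X r)
    {F : S → (Fin n → ClientNoise d m U) → ℝ≥0∞} (hF : Measurable (Function.uncurry F)) :
    ∫⁻ r, F (X r) (r t) ∂(noiseLaw d n m q v ν)
      = ∫⁻ r, ∫⁻ ρ, F (X r) ρ ∂(roundLaw d n m q v (ν t)) ∂(noiseLaw d n m q v ν) := by
  have hm : Measurable fun r : Noise d n m U => F (X r) (r t) :=
    hF.comp (hX.prodMk (measurable_pi_apply t))
  rw [noiseLaw_eq, lintegral_infinitePi_update (fun t => roundLaw d n m q v (ν t)) t hm]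
  simp [hXt]

variable (ℓ : Z → Vec d → ℝ) (η γ b : ℝ) (C : ℕ → Fin n → U → Vec d → Vec d)

lemma measurable_run (hℓ : ∀ z, Measurable (∇ (ℓ z)))
    (hC : ∀ t i, Measurable (Function.uncurry (C t i))) (x₀ : Vec d) (D : Fin n → Fin m → Z)
    (t : ℕ) : Measurable fun r => run ℓ η γ b C x₀ D r t := by
  induction t with
  | zero => exact measurable_const
  | succ t ih => exact measurable_round hℓ (hC t) η γ b D ih (measurable_pi_apply t)

lemma measurable_recordedRound (hℓ : ∀ z, Measurable (∇ (ℓ z)))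
    (hC : ∀ t i, Measurable (Function.uncurry (C t i))) (t : ℕ) (D : Fin n → Fin m → Z)
    {P : Type*} [MeasurableSpace P] {p : P → State d n m × (ℕ → Fin n → Vec d)}
    {r : P → Fin n → ClientNoise d m U} (hp : Measurable p) (hr : Measurable r) :
    Measurable fun x => recordedRound ℓ η γ b C t D (p x) (r x) := by
  have h1 := measurable_fst.comp hp
  have h2 : Measurable fun x => (p x).2 := measurable_snd.comp hp
  refine (measurable_round hℓ (hC t) η γ b D h1 hr).prodMk (measurable_pi_lambda _ fun s => ?_)
  by_cases hs : s = t
  · subst hs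
    simp only [Function.update_self]
    exact measurable_pi_lambda _ fun i => measurable_message hℓ (hC s) b D h1 hr i
  · simp only [Function.update_of_ne hs]
    exact (measurable_pi_apply s).comp h2

lemma measurable_recordedRun (hℓ : ∀ z, Measurable (∇ (ℓ z)))
    (hC : ∀ t i, Measurable (Function.uncurry (C t i))) (x₀ : Vec d) (D : Fin n → Fin m → Z)
    (t : ℕ) : Measurable fun r => recordedRun ℓ η γ b C x₀ D r t := by
  induction t with
  | zero => exact measurable_const
  | succ t ih => exact measurable_recordedRound ℓ η γ b C hℓ hC t D ih (measurable_pi_apply t)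

/-- The expectation of a function `φ` of the recorded messages, when the algorithm is started at the
beginning of round `t` and run for `k` rounds. -/
noncomputable def expectedValue (q v : ℝ) (ν : ℕ → Fin n → Measure U) (D : Fin n → Fin m → Z)
    (φ : (ℕ → Fin n → Vec d) → ℝ≥0∞) : ℕ → ℕ → State d n m × (ℕ → Fin n → Vec d) → ℝ≥0∞
  | 0, _, p => φ p.2
  | k + 1, t, p => ∫⁻ r, expectedValue q v ν D φ k (t + 1) (recordedRound ℓ η γ b C t D p r)
      ∂(roundLaw d n m q v (ν t))

variable (q v : ℝ) (ν : ℕ → Fin n → Measure U) [∀ t i, IsProbabilityMeasure (ν t i)]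
  (D : Fin n → Fin m → Z) {φ : (ℕ → Fin n → Vec d) → ℝ≥0∞}

lemma measurable_expectedValue (hℓ : ∀ z, Measurable (∇ (ℓ z)))
    (hC : ∀ t i, Measurable (Function.uncurry (C t i))) (hφ : Measurable φ) (k t : ℕ) :
    Measurable (expectedValue ℓ η γ b C q v ν D φ k t) := by
  induction k generalizing t with
  | zero => exact hφ.comp measurable_snd
  | succ k ih =>
    simp only [expectedValue]
    exact ((ih (t + 1)).comp (measurable_recordedRound ℓ η γ b C hℓ hC t D measurable_fst
      measurable_snd)).lintegral_prod_right'

/-- The state at the start of round `t` does not depend on the noise of that round, so this noise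
can be integrated first. This turns the privacy statement into an induction on the number of
remaining rounds. -/
lemma lintegral_expectedValue (hℓ : ∀ z, Measurable (∇ (ℓ z)))
    (hC : ∀ t i, Measurable (Function.uncurry (C t i))) (hφ : Measurable φ) (x₀ : Vec d)
    (k t : ℕ) :
    ∫⁻ r, expectedValue ℓ η γ b C q v ν D φ k t (recordedRun ℓ η γ b C x₀ D r t)
        ∂(noiseLaw d n m q v ν)
      = ∫⁻ r, φ (recordedRun ℓ η γ b C x₀ D r (t + k)).2 ∂(noiseLaw d n m q v ν) := by
  induction k generalizing t with
  | zero => rfl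
  | succ k ih =>
    simp only [expectedValue]
    rw [← lintegral_noiseLaw_past q v ν t (measurable_recordedRun ℓ η γ b C hℓ hC x₀ D t)
      (fun r y => recordedRun_update ℓ η γ b C x₀ D r le_rfl y)
      (F := fun p ρ => expectedValue ℓ η γ b C q v ν D φ k (t + 1)
        (recordedRound ℓ η γ b C t D p ρ))
      ((measurable_expectedValue ℓ η γ b C q v ν D hℓ hC hφ k (t + 1)).comp
        (measurable_recordedRound ℓ η γ b C hℓ hC t D measurable_fst measurable_snd))]
    have := ih (t + 1)
    rw [show t + 1 + k = t + (k + 1) by ring] at this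
    exact this

lemma measure_transcript_mem (hℓ : ∀ z, Measurable (∇ (ℓ z)))
    (hC : ∀ t i, Measurable (Function.uncurry (C t i))) (x₀ : Vec d) (T : ℕ)
    {S : Set (Fin T → Fin n → Vec d)} (hS : MeasurableSet S) :
    noiseLaw d n m q v ν {r | transcript ℓ η γ b C x₀ T D r ∈ S}
      = expectedValue ℓ η γ b C q v ν D
          (Set.indicator {w | (fun (t : Fin T) i => w t i) ∈ S} 1) T 0 (initState n m x₀, 0) := by
  have hm : Measurable fun (w : ℕ → Fin n → Vec d) (t : Fin T) i => w t i := by fun_prop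
  have h := lintegral_expectedValue ℓ η γ b C q v ν D hℓ hC
    (φ := Set.indicator {w | (fun (t : Fin T) i => w t i) ∈ S} 1)
    (measurable_one.indicator (hm hS)) x₀ T 0
  simp only [recordedRun, zero_add, lintegral_const, measure_univ, mul_one] at h
  rw [h]
  have hS' : MeasurableSet {r | (fun (t : Fin T) i => (recordedRun ℓ η γ b C x₀ D r T).2 t i) ∈ S} :=
    (hm.comp (measurable_snd.comp (measurable_recordedRun ℓ η γ b C hℓ hC x₀ D T))) hS
  have e : {r | transcript ℓ η γ b C x₀ T D r ∈ S}
      = {r | (fun (t : Fin T) i => (recordedRun ℓ η γ b C x₀ D r T).2 t i) ∈ S} := by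
    ext r
    have : transcript ℓ η γ b C x₀ T D r
        = fun (t : Fin T) i => (recordedRun ℓ η γ b C x₀ D r T).2 t i := by
      ext t i
      rw [recordedRun_snd ℓ η γ b C x₀ D r t.2]
      rfl
    simp only [Set.mem_ofPred_eq, this]
  rw [e, ← lintegral_indicator_one hS']
  rfl

end Law


/-! ### Coupling two runs that differ in one sample and its SAGA point -/

section HiddenPoint

variable {d n m : ℕ} {Z U : Type*}

/-- Replace the SAGA point of the sample `j` of client `i`. -/
def State.setPoint (i : Fin n) (j : Fin m) (w : Vec d) (st : State d n m) : State d n m :=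
  { st with table := Function.update st.table i (Function.update (st.table i) j w) }

lemma State.setPoint_self (i : Fin n) (j : Fin m) (st : State d n m) :
    st.setPoint i j (st.table i j) = st := by
  simp [State.setPoint]

/-- The contribution of a sample `z` with SAGA point `w` to the local SAGA estimator, depending on
whether the sample belongs to the minibatch. -/
noncomputable def sampleTerm (ℓ : Z → Vec d → ℝ) (m : ℕ) (b : ℝ) (z : Z) (x w : Vec d) (B : Bool) :
    Vec d :=
  (1 / b) • (if B = true then ∇ (ℓ z) x - ∇ (ℓ z) w else 0) + (1 / (m : ℝ)) • ∇ (ℓ z) w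

/-- The contribution of all samples but the `j`-th one to the local SAGA estimator. -/
noncomputable def otherTerms (ℓ : Z → Vec d → ℝ) (b : ℝ) (Di : Fin m → Z) (j : Fin m) (x : Vec d)
    (w : Fin m → Vec d) (batch : Fin m → Bool) : Vec d :=
  (1 / b) • ∑ k ∈ Finset.univ.erase j,
      (if batch k = true then ∇ (ℓ (Di k)) x - ∇ (ℓ (Di k)) (w k) else 0)
    + (1 / (m : ℝ)) • ∑ k ∈ Finset.univ.erase j, ∇ (ℓ (Di k)) (w k)

lemma sagaEstimator_eq_otherTerms_add (ℓ : Z → Vec d → ℝ) (b : ℝ) (Di : Fin m → Z) (j : Fin m)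
    (x : Vec d) (w : Fin m → Vec d) (batch : Fin m → Bool) :
    sagaEstimator ℓ b Di x w batch
      = otherTerms ℓ b Di j x w batch + sampleTerm ℓ m b (Di j) x (w j) (batch j) := by
  unfold sagaEstimator otherTerms sampleTerm
  rw [Finset.sum_filter, ← Finset.sum_erase_add _ _ (Finset.mem_univ j),
    ← Finset.sum_erase_add _ (fun k => ∇ (ℓ (Di k)) (w k)) (Finset.mem_univ j),
    smul_add, smul_add]
  abel

lemma otherTerms_congr (ℓ : Z → Vec d → ℝ) (b : ℝ) {Di Di' : Fin m → Z} {j : Fin m} (x : Vec d)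
    {w w' : Fin m → Vec d} {β β' : Fin m → Bool} (hD : ∀ k, k ≠ j → Di k = Di' k)
    (hw : ∀ k, k ≠ j → w k = w' k) (hβ : ∀ k, k ≠ j → β k = β' k) :
    otherTerms ℓ b Di j x w β = otherTerms ℓ b Di' j x w' β' := by
  unfold otherTerms
  congr 2
  · refine Finset.sum_congr rfl fun k hk => ?_
    have hk := Finset.ne_of_mem_erase hk
    rw [hD k hk, hw k hk, hβ k hk]
  · refine Finset.sum_congr rfl fun k hk => ?_
    have hk := Finset.ne_of_mem_erase hk
    rw [hD k hk, hw k hk]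

variable (ℓ : Z → Vec d → ℝ) (η γ b : ℝ) (C : ℕ → Fin n → U → Vec d → Vec d) (t : ℕ)
  {D D' : Fin n → Fin m → Z} {i : Fin n} {j : Fin m}

/-- The noise of a round in which client `i` uses the minibatch `β`, updated at `j` to `B`, the seed
`u`, and a perturbation such that the contribution of its `j`-th sample to its perturbed estimator
is replaced by `ζ`. -/
noncomputable def shiftedNoise (D : Fin n → Fin m → Z) (i : Fin n) (j : Fin m)
    (st : State d n m) (r : Fin n → ClientNoise d m U) (β : Fin m → Bool) (u : U) (ζ : Vec d)
    (B : Bool) : Fin n → ClientNoise d m U :=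
  Function.update r i (Function.update β j B,
    ζ - sampleTerm ℓ m b (D i j) st.x (st.table i j) B, u)

/-- The perturbation compensates the contribution of the differing sample: their sum is prescribed
to be `ζ`. So neither the sample, nor its SAGA point, nor its minibatch bit can be seen in the
messages; they enter only through the likelihood of `ζ`. -/
lemma message_shiftedNoise (hD : ∀ k, k ≠ i → D k = D' k) (hDi : ∀ k, k ≠ j → D i k = D' i k)
    (st : State d n m) (w : Vec d) (r : Fin n → ClientNoise d m U) (β : Fin m → Bool) (u : U)
    (ζ : Vec d) (B : Bool) :
    message ℓ b (C t) D' (st.setPoint i j w)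
        (shiftedNoise ℓ b D' i j (st.setPoint i j w) r β u ζ B)
      = message ℓ b (C t) D st (shiftedNoise ℓ b D i j st r β u ζ false) := by
  ext1 k
  by_cases hk : k = i
  · subst hk
    simp only [message, shiftedNoise, Function.update_self]
    rw [sagaEstimator_eq_otherTerms_add (j := j), sagaEstimator_eq_otherTerms_add (j := j)]
    simp only [Function.update_self]
    rw [otherTerms_congr (w := st.table k) (β := Function.update β j false) ℓ b st.x hDi
      (w' := (st.setPoint k j w).table k) (β' := Function.update β j B)
      (fun l hl => by simp [State.setPoint, hl]) (fun l hl => by simp [hl])]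
    congr 1
    simp only [State.setPoint]
    abel
  · simp only [message, shiftedNoise, Function.update_of_ne hk, State.setPoint, hD k hk]

/-- Equal messages give equal updates of the model and of all shifts, so the only remaining trace of
the bit `B` is the SAGA point itself: the model `x` if the sample was drawn, the old `w` otherwise.
-/
lemma recordedRound_shiftedNoise (hD : ∀ k, k ≠ i → D k = D' k)
    (hDi : ∀ k, k ≠ j → D i k = D' i k) (st : State d n m) (rec : ℕ → Fin n → Vec d) (w : Vec d)
    (r : Fin n → ClientNoise d m U) (β : Fin m → Bool) (u : U) (ζ : Vec d) (B : Bool) :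
    recordedRound ℓ η γ b C t D' (st.setPoint i j w, rec)
        (shiftedNoise ℓ b D' i j (st.setPoint i j w) r β u ζ B)
      = Prod.map (State.setPoint i j (if B = true then st.x else w)) id
        (recordedRound ℓ η γ b C t D (st, rec) (shiftedNoise ℓ b D i j st r β u ζ false)) := by
  have h := message_shiftedNoise ℓ b C t hD hDi st w r β u ζ B
  simp only [recordedRound, round, h, Prod.map_apply, id]
  simp only [State.setPoint, shiftedNoise, Prod.mk.injEq, State.mk.injEq, and_true, true_and]
  ext1 k
  by_cases hk : k = i
  · subst hk
    ext1 l
    by_cases hl : l = j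
    · subst hl; simp
    · simp [hl]
  · simp [hk]

end HiddenPoint

/-! ### Isolating one minibatch bit and one Gaussian vector -/

section Splitting

variable {d n m : ℕ} {U : Type*} [MeasurableSpace U]

/-- The probability that the indicator of a minibatch takes the value `B`. -/
noncomputable def bitWeight (q : ℝ) (B : Bool) : ℝ := if B = true then q else 1 - q

lemma bitWeight_nonneg {q : ℝ} (hq0 : 0 ≤ q) (hq1 : q ≤ 1) (B : Bool) : 0 ≤ bitWeight q B := by
  unfold bitWeight; split_ifs <;> linarith

lemma lintegral_bernoulli {q : ℝ} (hq0 : 0 ≤ q) (hq1 : q ≤ 1) (F : Bool → ℝ≥0∞) :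
    ∫⁻ B, F B ∂(bernoulliMeasure true false (Set.projIcc (0 : ℝ) 1 zero_le_one q))
      = ∑ B, ENNReal.ofReal (bitWeight q B) * F B := by
  rw [Set.projIcc_of_mem _ ⟨hq0, hq1⟩, bernoulliMeasure_def, lintegral_add_measure,
    lintegral_smul_measure, lintegral_smul_measure, lintegral_dirac, lintegral_dirac,
    Fintype.sum_bool]
  simp only [bitWeight, if_true, Bool.false_eq_true, if_false]
  congr 1
  · congr 1
    exact (Real.toNNReal_of_nonneg hq0).symm
  · congr 1
    exact (Real.toNNReal_of_nonneg (show 0 ≤ 1 - q by linarith)).symm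

/-- The law of the part of the randomness of a round that does not decide whether a given sample
belongs to the minibatch of client `i`; the fresh Gaussian vector of client `i` comes last. -/
noncomputable def splitLaw (d n m : ℕ) (q v : ℝ) (ν : Fin n → Measure U) (i : Fin n) :
    Measure ((Fin n → ClientNoise d m U) × (Fin m → Bool) × U × Vec d) :=
  (roundLaw d n m q v ν).prod ((batchLaw m q).prod ((ν i).prod (stdGaussian (Vec d))))

lemma lintegral_splitLaw_snd (q v : ℝ) (ν : Fin n → Measure U) [∀ i, IsProbabilityMeasure (ν i)]
    (i : Fin n) {F : Vec d → ℝ≥0∞} (hF : Measurable F) :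
    ∫⁻ e, F e.2.2.2 ∂(splitLaw d n m q v ν i) = ∫⁻ z, F z ∂(stdGaussian (Vec d)) := by
  unfold splitLaw
  have h1 := (measurePreserving_snd (μ := roundLaw d n m q v ν)
    (ν := (batchLaw m q).prod ((ν i).prod (stdGaussian (Vec d)))))
  have h2 := (measurePreserving_snd (μ := batchLaw m q) (ν := (ν i).prod (stdGaussian (Vec d))))
  have h3 := (measurePreserving_snd (μ := ν i) (ν := stdGaussian (Vec d)))
  exact (h3.comp (h2.comp h1)).lintegral_comp hF

/-- The bit of the sample `j` is summed explicitly, and for each value `B` the Gaussian is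
translated by `a B`. The integration variable is then perturbation plus contribution, in units of
`√v`, with Cameron–Martin weight. The entry `j` of the integrated minibatch is a dummy, overwritten
by `B`. -/
lemma lintegral_clientLaw_split {q : ℝ} (hq0 : 0 ≤ q) (hq1 : q ≤ 1) {v : ℝ}
    (ν : Measure U) [IsProbabilityMeasure ν] (j : Fin m)
    {G : ClientNoise d m U → ℝ≥0∞} (hG : Measurable G) (a : Bool → Vec d) :
    ∫⁻ y, G y ∂((batchLaw m q).prod ((gaussianLaw d v).prod ν))
      = ∫⁻ e, ∑ B, ENNReal.ofReal (bitWeight q B)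
          * (ENNReal.ofReal (Real.exp (logShift (a B) e.2.2))
            * G (Function.update e.1 j B, √v • (e.2.2 - a B), e.2.1))
          ∂((batchLaw m q).prod (ν.prod (stdGaussian (Vec d)))) := by
  have hupd := measurable_update_prod (X := fun _ : Fin m => Bool) j
  have hm (B : Bool) : Measurable fun e : (Fin m → Bool) × U × Vec d =>
      ENNReal.ofReal (Real.exp (logShift (a B) e.2.2))
        * G (Function.update e.1 j B, √v • (e.2.2 - a B), e.2.1) := by
    have : Measurable fun e : (Fin m → Bool) × U × Vec d =>
        G (Function.update e.1 j B, √v • (e.2.2 - a B), e.2.1) :=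
      hG.comp ((hupd.comp (measurable_fst.prodMk measurable_const)).prodMk (by fun_prop))
    fun_prop
  have hH : Measurable fun β : Fin m → Bool => ∫⁻ y, G (β, y) ∂((gaussianLaw d v).prod ν) :=
    hG.lintegral_prod_right'
  rw [lintegral_prod _ hG.aemeasurable, lintegral_prod _
    (Finset.measurable_sum _ fun B _ => (hm B).const_mul _).aemeasurable]
  conv_lhs => rw [batchLaw, lintegral_pi_update _ j hH]
  refine lintegral_congr fun β => ?_
  rw [lintegral_bernoulli hq0 hq1]
  have hB (B : Bool) : Measurable fun y : U × Vec d =>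
      ENNReal.ofReal (Real.exp (logShift (a B) y.2))
        * G (Function.update β j B, √v • (y.2 - a B), y.1) := by
    have : Measurable fun y : U × Vec d => G (Function.update β j B, √v • (y.2 - a B), y.1) :=
      hG.comp (measurable_const.prodMk (by fun_prop))
    fun_prop
  dsimp only
  rw [lintegral_finsetSum _ fun B _ =>
    (hB B).const_mul (ENNReal.ofReal (bitWeight q B))]
  refine Finset.sum_congr rfl fun B _ => ?_
  rw [lintegral_const_mul _ (hB B), lintegral_prod _ (hB B).aemeasurable,
    lintegral_prod_symm (fun y => G (Function.update β j B, y))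
      (hG.comp measurable_prodMk_left).aemeasurable]
  refine congrArg _ ?_
  refine lintegral_congr fun u => ?_
  have hζ : Measurable fun ζ : Vec d => G (Function.update β j B, ζ, u) :=
    hG.comp (measurable_prodMk_left.comp measurable_prodMk_right)
  have := lintegral_stdGaussian_add (a B)
    (F := fun z => G (Function.update β j B, √v • (z - a B), u))
    (hζ.comp (by fun_prop : Measurable fun z : Vec d => √v • (z - a B)))
  simp only [add_sub_cancel_right] at this
  rw [← this, gaussianLaw]
  exact lintegral_map hζ (by fun_prop)

lemma lintegral_roundLaw_split {q : ℝ} (hq0 : 0 ≤ q) (hq1 : q ≤ 1) {v : ℝ}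
    (ν : Fin n → Measure U) [∀ i, IsProbabilityMeasure (ν i)] (i : Fin n) (j : Fin m)
    {F : (Fin n → ClientNoise d m U) → ℝ≥0∞} (hF : Measurable F) (a : Bool → Vec d) :
    ∫⁻ r, F r ∂(roundLaw d n m q v ν)
      = ∫⁻ e, ∑ B, ENNReal.ofReal (bitWeight q B)
          * (ENNReal.ofReal (Real.exp (logShift (a B) e.2.2.2))
            * F (Function.update e.1 i (Function.update e.2.1 j B, √v • (e.2.2.2 - a B), e.2.2.1)))
          ∂(splitLaw d n m q v ν i) := by
  have hupd := measurable_update_prod (X := fun _ : Fin n => ClientNoise d m U) i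
  have hupdj := measurable_update_prod (X := fun _ : Fin m => Bool) j
  have hm (B : Bool) : Measurable fun e : (Fin n → ClientNoise d m U) × (Fin m → Bool) × U × Vec d =>
      ENNReal.ofReal (Real.exp (logShift (a B) e.2.2.2))
        * F (Function.update e.1 i (Function.update e.2.1 j B, √v • (e.2.2.2 - a B), e.2.2.1)) := by
    have : Measurable fun e : (Fin n → ClientNoise d m U) × (Fin m → Bool) × U × Vec d =>
        F (Function.update e.1 i (Function.update e.2.1 j B, √v • (e.2.2.2 - a B), e.2.2.1)) := by
      refine hF.comp (hupd.comp (measurable_fst.prodMk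
        ((hupdj.comp ((measurable_fst.comp measurable_snd).prodMk measurable_const)).prodMk ?_)))
      fun_prop
    fun_prop
  rw [splitLaw, lintegral_prod _
    (Finset.measurable_sum _ fun B _ => (hm B).const_mul _).aemeasurable]
  conv_lhs => rw [roundLaw, lintegral_pi_update _ i hF]
  refine lintegral_congr fun r => ?_
  exact lintegral_clientLaw_split hq0 hq1 (ν i) j
    (G := fun y => F (Function.update r i y)) (hF.comp (hupd.comp measurable_prodMk_left)) a

end Splitting


/-! ### Composition of the privacy losses over the rounds -/

section PrivacyInduction

variable {d n m : ℕ} {Z U : Type*} [MeasurableSpace U]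

lemma measurable_setPoint (i : Fin n) (j : Fin m) {P : Type*} [MeasurableSpace P]
    {w : P → Vec d} {st : P → State d n m} (hw : Measurable w) (hst : Measurable st) :
    Measurable fun p => (st p).setPoint i j (w p) := by
  have hT := measurable_state_table.comp hst
  refine measurable_state_mk (measurable_state_x.comp hst) (measurable_state_shift.comp hst)
    (measurable_state_serverShift.comp hst) (measurable_pi_lambda _ fun k => ?_)
  by_cases hk : k = i
  · subst hk
    simp only [Function.update_self]
    refine measurable_pi_lambda _ fun l => ?_
    by_cases hl : l = j
    · subst hl; simpa using hw
    · simp only [Function.update_of_ne hl]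
      exact (measurable_pi_apply l).comp ((measurable_pi_apply k).comp hT)
  · simp only [Function.update_of_ne hk]
    exact (measurable_pi_apply k).comp hT

variable (ℓ : Z → Vec d → ℝ) (η γ b : ℝ) (C : ℕ → Fin n → U → Vec d → Vec d)
  (q v : ℝ) (ν : ℕ → Fin n → Measure U) (D : Fin n → Fin m → Z) (i : Fin n) (j : Fin m)

/-- A round of the algorithm as a function of the split noise, up to the SAGA point of the sample
`j` of client `i`. -/
noncomputable def splitRound (t : ℕ) (p : State d n m × (ℕ → Fin n → Vec d))
    (e : (Fin n → ClientNoise d m U) × (Fin m → Bool) × U × Vec d) :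
    State d n m × (ℕ → Fin n → Vec d) :=
  recordedRound ℓ η γ b C t D p
    (shiftedNoise ℓ b D i j p.1 e.1 e.2.1 e.2.2.1 (√v • e.2.2.2) false)

lemma measurable_splitRound (hℓ : ∀ z, Measurable (∇ (ℓ z)))
    (hC : ∀ t i, Measurable (Function.uncurry (C t i))) (t : ℕ)
    (p : State d n m × (ℕ → Fin n → Vec d)) :
    Measurable (splitRound ℓ η γ b C v D i j t p) := by
  refine measurable_recordedRound ℓ η γ b C hℓ hC t D measurable_const ?_
  have hupd := measurable_update_prod (X := fun _ : Fin n => ClientNoise d m U) i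
  have hupdj := measurable_update_prod (X := fun _ : Fin m => Bool) j
  refine hupd.comp (measurable_fst.prodMk
    ((hupdj.comp ((measurable_fst.comp measurable_snd).prodMk measurable_const)).prodMk ?_))
  fun_prop

variable {q v D i j} {D' : Fin n → Fin m → Z} [∀ t i, IsProbabilityMeasure (ν t i)]

/-- The noise is split with `a B` equal to the normalized contribution of the differing sample. The
outcome `splitRound` is computed from `D` and does not involve `w`, `D'` or `B`, so both datasets
can be compared pointwise in the split noise. -/
lemma expectedValue_succ_setPoint (hℓ : ∀ z, Measurable (∇ (ℓ z)))
    (hC : ∀ t i, Measurable (Function.uncurry (C t i))) (hq0 : 0 ≤ q) (hq1 : q ≤ 1) (hv : 0 < v)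
    (hD : ∀ k, k ≠ i → D k = D' k) (hDi : ∀ k, k ≠ j → D i k = D' i k)
    {φ : (ℕ → Fin n → Vec d) → ℝ≥0∞} (hφ : Measurable φ) (k t : ℕ) (w : Vec d)
    (p : State d n m × (ℕ → Fin n → Vec d)) :
    expectedValue ℓ η γ b C q v ν D' φ (k + 1) t (p.1.setPoint i j w, p.2)
      = ∫⁻ e, ∑ B, ENNReal.ofReal (bitWeight q B * Real.exp (logShift
            ((√v)⁻¹ • sampleTerm ℓ m b (D' i j) p.1.x w B) e.2.2.2))
          * expectedValue ℓ η γ b C q v ν D' φ k (t + 1)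
            ((splitRound ℓ η γ b C v D i j t p e).1.setPoint i j (if B = true then p.1.x else w),
              (splitRound ℓ η γ b C v D i j t p e).2) ∂(splitLaw d n m q v (ν t) i) := by
  have hV := measurable_expectedValue ℓ η γ b C q v ν D' hℓ hC hφ k (t + 1)
  rw [expectedValue, lintegral_roundLaw_split (F := fun r =>
    expectedValue ℓ η γ b C q v ν D' φ k (t + 1)
      (recordedRound ℓ η γ b C t D' (p.1.setPoint i j w, p.2) r)) hq0 hq1 (ν t) i j
    (hV.comp (measurable_recordedRound ℓ η γ b C hℓ hC t D' measurable_const measurable_id))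
    (fun B => (√v)⁻¹ • sampleTerm ℓ m b (D' i j) p.1.x w B)]
  refine lintegral_congr fun e => Finset.sum_congr rfl fun B _ => ?_
  rw [← mul_assoc, ← ENNReal.ofReal_mul (bitWeight_nonneg hq0 hq1 B)]
  congr 2
  have h := recordedRound_shiftedNoise ℓ η γ b C t hD hDi p.1 p.2 w e.1 e.2.1 e.2.2.1
    (√v • e.2.2.2) B
  refine Eq.trans ?_ h
  simp only [shiftedNoise, smul_sub, smul_smul, mul_inv_cancel₀ (Real.sqrt_pos.mpr hv).ne',
    one_smul]
  simp [State.setPoint]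

lemma sum_bitWeight_mul_exp_eq_mixDensity (s : ℝ) (z : Z) (x w y : Vec d) :
    ∑ B, bitWeight q B * Real.exp (logShift (s • sampleTerm ℓ m b z x w B) y)
      = mixDensity q (s • ((1 / (m : ℝ)) • ∇ (ℓ z) w)) (s • ((1 / b) • (∇ (ℓ z) x - ∇ (ℓ z) w))) y := by
  rw [Fintype.sum_bool, mixDensity, add_comm, add_comm (s • _) (s • _)]
  simp [bitWeight, sampleTerm]

/-- The `(N+1)`-st Rényi moments of the weights control the difference of the two values. -/
lemma le_exp_mul_add_moment {A A' ε : ℝ} (hA : 0 < A) (hA' : 0 < A') (N : ℕ) :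
    A ≤ Real.exp ε * A' + Real.exp (-(ε * N)) * (A ^ (N + 1) / A' ^ N) := by
  have h0 : 0 ≤ Real.exp (-(ε * N)) * (A ^ (N + 1) / A' ^ N) := by positivity
  rcases le_total A (Real.exp ε * A') with h | h
  · linarith
  · have h1 := pow_le_pow_left₀ (by positivity) h N
    rw [mul_pow, ← Real.exp_nat_mul] at h1
    have h2 : A ≤ Real.exp (-(ε * N)) * (A ^ (N + 1) / A' ^ N) := by
      have h3 : Real.exp (-(ε * N)) * Real.exp (N * ε) = 1 := by
        rw [← Real.exp_add]; simp [mul_comm]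
      rw [pow_succ, mul_div_right_comm, ← mul_assoc]
      refine le_mul_of_one_le_left hA.le ?_
      rw [← mul_div_assoc, le_div_iff₀ (by positivity), one_mul]
      calc A' ^ N = Real.exp (-(ε * N)) * (Real.exp (N * ε) * A' ^ N) := by
            rw [← mul_assoc, h3, one_mul]
        _ ≤ _ := by gcongr
    have : 0 ≤ Real.exp ε * A' := by positivity
    linarith

variable {κ ε : ℝ} {N : ℕ} {Λ : ℝ≥0∞} {φ : (ℕ → Fin n → Vec d) → ℝ≥0∞}

/-- Composition of the privacy losses of all rounds, where the SAGA point of the differing sample is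
hidden: it is averaged over finitely many points with weights that depend on the past messages. -/
lemma expectedValue_le_of_moment (hℓ : ∀ z, Measurable (∇ (ℓ z)))
    (hC : ∀ t i, Measurable (Function.uncurry (C t i))) (hq0 : 0 ≤ q) (hq1 : q ≤ 1) (hv : 0 < v)
    (hD : ∀ k, k ≠ i → D k = D' k) (hDi : ∀ k, k ≠ j → D i k = D' i k)
    (hφ : Measurable φ) (hφ1 : ∀ w, φ w ≤ 1) (hΛtop : Λ ≠ ∞)
    (hu : ∀ z (w : Vec d), ‖(√v)⁻¹ • ((1 / (m : ℝ)) • ∇ (ℓ z) w)‖ ≤ q * κ)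
    (hΔ : ∀ z (x w : Vec d), ‖(√v)⁻¹ • ((1 / b) • (∇ (ℓ z) x - ∇ (ℓ z) w))‖ ≤ 2 * κ)
    (hΛ : ∀ u Δ u' Δ' : Vec d, ‖u‖ ≤ q * κ → ‖Δ‖ ≤ 2 * κ → ‖u'‖ ≤ q * κ → ‖Δ'‖ ≤ 2 * κ →
      ∫⁻ z, ENNReal.ofReal (mixDensity q u Δ z ^ (N + 1) / mixDensity q u' Δ' z ^ N)
        ∂(stdGaussian (Vec d)) ≤ Λ)
    (k : ℕ) : ∀ (t : ℕ) (I : Type) [Fintype I] (w : I → Vec d) (a a' : I → ℝ),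
      (∀ h, 0 ≤ a h) → (∀ h, 0 ≤ a' h) → 0 < ∑ h, a h → 0 < ∑ h, a' h →
      ∀ p : State d n m × (ℕ → Fin n → Vec d),
      ∑ h, ENNReal.ofReal (a h)
          * expectedValue ℓ η γ b C q v ν D φ k t (p.1.setPoint i j (w h), p.2)
        ≤ ENNReal.ofReal (Real.exp ε) * (∑ h, ENNReal.ofReal (a' h)
          * expectedValue ℓ η γ b C q v ν D' φ k t (p.1.setPoint i j (w h), p.2))
          + ENNReal.ofReal (Real.exp (-(ε * N))) * Λ ^ k
            * ENNReal.ofReal ((∑ h, a h) ^ (N + 1) / (∑ h, a' h) ^ N) := by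
  induction k with
  | zero =>
    intro t I _ w a a' ha ha' hA hA' p
    simp only [expectedValue, ← Finset.sum_mul, pow_zero, mul_one]
    rw [← ENNReal.ofReal_sum_of_nonneg fun h _ => ha h,
      ← ENNReal.ofReal_sum_of_nonneg fun h _ => ha' h, ← mul_assoc,
      ← ENNReal.ofReal_mul (Real.exp_pos _).le, ← ENNReal.ofReal_mul (Real.exp_pos _).le]
    -- No rounds remain: every candidate has the same value `φ p.2 ≤ 1`, and only the total weights
    -- are compared.
    have h := ENNReal.ofReal_le_ofReal (le_exp_mul_add_moment (ε := ε) hA hA' N)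
    rw [ENNReal.ofReal_add (by positivity) (by positivity)] at h
    calc _ ≤ _ := mul_le_mul_left h _
      _ ≤ _ := by
        rw [add_mul]
        gcongr
        exact mul_le_of_le_one_right zero_le (hφ1 _)
  | succ k ih =>
    intro t I _ w a a' ha ha' hA hA' p
    set X := splitRound ℓ η γ b C v D i j t p with hX
    have hXm : Measurable X := measurable_splitRound ℓ η γ b C v D i j hℓ hC t p
    let E (D₀ : Fin n → Fin m → Z) (h : I) (B : Bool) (z : Vec d) : ℝ :=
      bitWeight q B * Real.exp (logShift ((√v)⁻¹ • sampleTerm ℓ m b (D₀ i j) p.1.x (w h) B) z)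
    let V (D₀ : Fin n → Fin m → Z) (h : I) (B : Bool)
        (e : (Fin n → ClientNoise d m U) × (Fin m → Bool) × U × Vec d) : ℝ≥0∞ :=
      expectedValue ℓ η γ b C q v ν D₀ φ k (t + 1)
        ((X e).1.setPoint i j (if B = true then p.1.x else w h), (X e).2)
    have hE0 (D₀ h B z) : 0 ≤ E D₀ h B z :=
      mul_nonneg (bitWeight_nonneg hq0 hq1 B) (Real.exp_pos _).le
    have hEm (D₀ h B) : Measurable fun e : (Fin n → ClientNoise d m U) × (Fin m → Bool) × U × Vec d =>
        ENNReal.ofReal (E D₀ h B e.2.2.2) := by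
      fun_prop
    have hVm (D₀ h B) : Measurable (V D₀ h B) :=
      (measurable_expectedValue ℓ η γ b C q v ν D₀ hℓ hC hφ k (t + 1)).comp
        ((measurable_setPoint i j measurable_const (measurable_fst.comp hXm)).prodMk
          (measurable_snd.comp hXm))
    have hsum (D₀ : Fin n → Fin m → Z) (hD₀ : ∀ k, k ≠ i → D k = D₀ k)
        (hD₀i : ∀ k, k ≠ j → D i k = D₀ i k) (c : I → ℝ) (hc : ∀ h, 0 ≤ c h) :
        ∑ h, ENNReal.ofReal (c h)
          * expectedValue ℓ η γ b C q v ν D₀ φ (k + 1) t (p.1.setPoint i j (w h), p.2)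
        = ∫⁻ e, ∑ y : I × Bool, ENNReal.ofReal (c y.1 * E D₀ y.1 y.2 e.2.2.2) * V D₀ y.1 y.2 e
          ∂(splitLaw d n m q v (ν t) i) := by
      simp_rw [expectedValue_succ_setPoint ℓ η γ b C ν hℓ hC hq0 hq1 hv hD₀ hD₀i hφ k t _ p]
      simp_rw [Fintype.sum_prod_type, ENNReal.ofReal_mul (hc _), mul_assoc, ← Finset.mul_sum]
      have hm (h : I) : Measurable fun e => ∑ B, ENNReal.ofReal (E D₀ h B e.2.2.2) * V D₀ h B e :=
        Finset.measurable_sum _ fun B _ => (hEm D₀ h B).mul (hVm D₀ h B)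
      rw [lintegral_finsetSum _ fun h _ => (hm h).const_mul (ENNReal.ofReal (c h))]
      exact Finset.sum_congr rfl fun h _ => (lintegral_const_mul _ (hm h)).symm
    rw [hsum D (fun _ _ => rfl) (fun _ _ => rfl) a ha, hsum D' hD hDi a' ha']
    -- Summed over the bit, the new weights are the old ones times subsampled mixture densities.
    -- Thus the total weight is an average of such densities over the hidden point, as Jensen's
    -- inequality requires.
    have hmix (D₀ : Fin n → Fin m → Z) (c : I → ℝ) (z : Vec d) :
        ∑ y : I × Bool, c y.1 * E D₀ y.1 y.2 z = ∑ h, c h * mixDensity q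
          ((√v)⁻¹ • ((1 / (m : ℝ)) • ∇ (ℓ (D₀ i j)) (w h)))
          ((√v)⁻¹ • ((1 / b) • (∇ (ℓ (D₀ i j)) p.1.x - ∇ (ℓ (D₀ i j)) (w h)))) z := by
      rw [Fintype.sum_prod_type]
      refine Finset.sum_congr rfl fun h _ => ?_
      dsimp only
      rw [← Finset.mul_sum, sum_bitWeight_mul_exp_eq_mixDensity]
    have hmixpos (D₀ : Fin n → Fin m → Z) (c : I → ℝ) (hc : ∀ h, 0 ≤ c h) (hcs : 0 < ∑ h, c h)
        (z : Vec d) : 0 < ∑ y : I × Bool, c y.1 * E D₀ y.1 y.2 z := by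
      rw [hmix]
      obtain ⟨h, -, hh⟩ := Finset.exists_ne_zero_of_sum_ne_zero hcs.ne'
      exact Finset.sum_pos' (fun h _ => mul_nonneg (hc h) (mixDensity_pos hq0 hq1 z).le)
        ⟨h, Finset.mem_univ h, mul_pos (lt_of_le_of_ne (hc h) (Ne.symm hh))
          (mixDensity_pos hq0 hq1 z)⟩
    set R : Vec d → ℝ≥0∞ := fun z => ENNReal.ofReal ((∑ y : I × Bool, a y.1 * E D y.1 y.2 z) ^ (N + 1)
      / (∑ y : I × Bool, a' y.1 * E D' y.1 y.2 z) ^ N) with hR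
    have hRm : Measurable R := by fun_prop
    -- The induction hypothesis is used for each fixed value of the split noise, with each candidate
    -- duplicated into `x` and `w h`. The candidate points are the same for both datasets; only the
    -- weights differ.
    have hstep (e) : ∑ y : I × Bool, ENNReal.ofReal (a y.1 * E D y.1 y.2 e.2.2.2) * V D y.1 y.2 e
        ≤ ENNReal.ofReal (Real.exp ε) * (∑ y : I × Bool,
            ENNReal.ofReal (a' y.1 * E D' y.1 y.2 e.2.2.2) * V D' y.1 y.2 e)
          + ENNReal.ofReal (Real.exp (-(ε * N))) * Λ ^ k * R e.2.2.2 :=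
      ih (t + 1) (I × Bool) (fun y => if y.2 = true then p.1.x else w y.1)
        (fun y => a y.1 * E D y.1 y.2 e.2.2.2) (fun y => a' y.1 * E D' y.1 y.2 e.2.2.2)
        (fun y => mul_nonneg (ha _) (hE0 ..)) (fun y => mul_nonneg (ha' _) (hE0 ..))
        (hmixpos D a ha hA _) (hmixpos D' a' ha' hA' _) (X e)
    have hRint : ∫⁻ e, R e.2.2.2 ∂(splitLaw d n m q v (ν t) i)
        ≤ Λ * ENNReal.ofReal ((∑ h, a h) ^ (N + 1) / (∑ h, a' h) ^ N) := by
      rw [lintegral_splitLaw_snd q v (ν t) i hRm]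
      simp only [hR, hmix]
      exact lintegral_sum_pow_div_le (stdGaussian (Vec d)) ha ha' hA hA'
        (fun h z => mixDensity_pos hq0 hq1 z) (fun h z => mixDensity_pos hq0 hq1 z)
        (fun h => by fun_prop) (fun h => by fun_prop) N
        (fun h k => hΛ _ _ _ _ (hu _ _) (hΔ _ _ _) (hu _ _) (hΔ _ _ _))
    have hc : ENNReal.ofReal (Real.exp (-(ε * N))) * Λ ^ k ≠ ∞ :=
      ENNReal.mul_ne_top ENNReal.ofReal_ne_top (ENNReal.pow_ne_top hΛtop)
    calc _ ≤ _ := lintegral_mono hstep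
      _ = ENNReal.ofReal (Real.exp ε) * ∫⁻ e, (∑ y : I × Bool,
            ENNReal.ofReal (a' y.1 * E D' y.1 y.2 e.2.2.2) * V D' y.1 y.2 e)
              ∂(splitLaw d n m q v (ν t) i)
          + ENNReal.ofReal (Real.exp (-(ε * N))) * Λ ^ k
            * ∫⁻ e, R e.2.2.2 ∂(splitLaw d n m q v (ν t) i) := by
        rw [lintegral_add_right _ (by fun_prop), lintegral_const_mul' _ _ ENNReal.ofReal_ne_top,
          lintegral_const_mul' _ _ hc]
      _ ≤ _ := by
        refine add_le_add_right ?_ _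
        rw [pow_succ, ← mul_assoc, mul_assoc _ Λ]
        exact mul_le_mul_right hRint _

end PrivacyInduction


/-! ### From Rényi moments to local differential privacy -/

section Privacy

variable {d n m : ℕ} {Z U : Type*} [MeasurableSpace U]

/-- The constant in the choice of the privacy variance. -/
noncomputable def varianceConst (K : ℝ) : ℝ := 16 * renyiConst * (1 + K) ^ 2

/-- The constant in the condition on the number of rounds. -/
noncomputable def roundsConst (K : ℝ) : ℝ := renyiConst * (1 + K) / 250

lemma varianceConst_pos {K : ℝ} (hK : 0 < K) : 0 < varianceConst K := by
  have := renyiConst_pos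
  unfold varianceConst; positivity

lemma roundsConst_pos {K : ℝ} (hK : 0 < K) : 0 < roundsConst K := by
  have := renyiConst_pos
  unfold roundsConst; positivity

/-- The order `N` of the moments and the noise-to-sensitivity ratio `κ` fit together. -/
lemma exists_moment_order {K ε l q T : ℝ} (hK : 0 < K) (hε : 0 < ε) (hl : 0 < l) (hT : 0 < T)
    (hq : 0 < q) (hεK : ε ≤ K * l) (hεT : ε < roundsConst K * q ^ 2 * T) {κ : ℝ}
    (hκ : κ ^ 2 = ε ^ 2 / (varianceConst K * T * l * q ^ 2)) (hκ0 : 0 < κ) :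
    κ ≤ 1 ∧ ∃ N : ℕ, 2000 * ((N : ℝ) + 1) * κ ^ 2 ≤ 1 ∧
      -(ε * N) + T * (renyiConst * (2 * ((N : ℝ) + 1) * q * κ) ^ 2) ≤ -l := by
  have hD := renyiConst_pos
  have hc := varianceConst_pos hK
  have hcc : varianceConst K = 4000 * (1 + K) * roundsConst K := by
    unfold varianceConst roundsConst; ring
  -- This is where the lower bound on the number of rounds enters: it makes the noise large enough
  -- for moments of order `l/ε` to be in the Gaussian regime.
  have hκε : 4000 * (1 + K) * l * κ ^ 2 ≤ ε := by
    rw [hκ, hcc]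
    have hr := roundsConst_pos hK
    have : 4000 * (1 + K) * l * (ε ^ 2 / (4000 * (1 + K) * roundsConst K * T * l * q ^ 2))
        = ε * (ε / (roundsConst K * q ^ 2 * T)) := by field_simp
    rw [this]
    exact mul_le_of_le_one_right hε.le ((div_le_one (by positivity)).mpr hεT.le)
  -- With `N ≥ 2l/ε` the term `-εN` gives `-2l`, and the variance constant is tuned so that the
  -- accumulated moments cost at most `l`. Since `ε ≤ K l`, the rounding costs only a factor: `N + 1
  -- ≤ 2(1 + K) l/ε`.
  refine ⟨?_, ⌈2 * l / ε⌉₊, ?_, ?_⟩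
  · have h1 : 4000 * (1 + K) * l * κ ^ 2 ≤ K * l := hκε.trans hεK
    have h2 : κ ^ 2 ≤ 1 := by
      by_contra h
      push Not at h
      have : 4000 * (1 + K) * l * 1 < 4000 * (1 + K) * l * κ ^ 2 := by gcongr
      nlinarith
    exact (sq_le_one_iff₀ hκ0.le).mp h2
  · have hN := (Nat.ceil_lt_add_one (show 0 ≤ 2 * l / ε by positivity)).le
    have h3 : 1 ≤ K * l / ε := by rw [le_div_iff₀ hε]; linarith
    have hN1 : (⌈2 * l / ε⌉₊ : ℝ) + 1 ≤ 2 * (1 + K) * l / ε := by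
      have : 2 * (1 + K) * l / ε = 2 * l / ε + 2 * (K * l / ε) := by ring
      linarith
    calc 2000 * ((⌈2 * l / ε⌉₊ : ℝ) + 1) * κ ^ 2 ≤ 2000 * (2 * (1 + K) * l / ε) * κ ^ 2 := by gcongr
      _ = (4000 * (1 + K) * l * κ ^ 2) / ε := by ring
      _ ≤ 1 := (div_le_one hε).mpr hκε
  · have hN := (Nat.ceil_lt_add_one (show 0 ≤ 2 * l / ε by positivity)).le
    have hN2 := Nat.le_ceil (2 * l / ε)
    have h3 : 1 ≤ K * l / ε := by rw [le_div_iff₀ hε]; linarith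
    have hN1 : (⌈2 * l / ε⌉₊ : ℝ) + 1 ≤ 2 * (1 + K) * l / ε := by
      have : 2 * (1 + K) * l / ε = 2 * l / ε + 2 * (K * l / ε) := by ring
      linarith
    rw [div_le_iff₀ hε] at hN2
    have h4 : T * (renyiConst * (2 * ((⌈2 * l / ε⌉₊ : ℝ) + 1) * q * κ) ^ 2)
        ≤ T * (renyiConst * (2 * (2 * (1 + K) * l / ε) * q * κ) ^ 2) := by gcongr
    have h5 : T * (renyiConst * (2 * (2 * (1 + K) * l / ε) * q * κ) ^ 2) = l := by
      rw [mul_pow _ κ, hκ, varianceConst]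
      field_simp
      ring
    linarith

variable {ℓ : Z → Vec d → ℝ} {C : ℕ → Fin n → U → Vec d → Vec d} {ν : ℕ → Fin n → Measure U}
  [∀ t i, IsProbabilityMeasure (ν t i)] {G K ε δ b : ℝ} {T : ℕ}

/-- The messages of all rounds are locally differentially private. -/
lemma isLDP_transcript (η γ : ℝ) (x₀ : Vec d) (hℓ : ∀ z, Measurable (∇ (ℓ z)))
    (hC : ∀ t i, Measurable (Function.uncurry (C t i))) (hG : 0 < G)
    (hℓG : ∀ z, HasBoundedGradient G (ℓ z)) (hm : 1 ≤ m) (hb : 0 < b) (hbm : b ≤ m) (hK : 0 < K)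
    (hε : 0 < ε) (hδ : 0 < δ) (hδ1 : δ < 1) (hεK : ε ≤ K * Real.log (1 / δ)) (hT : 0 < T)
    (hεT : ε < roundsConst K * b ^ 2 * T / (m : ℝ) ^ 2) (i : Fin n) :
    IsLDP ε δ (noiseLaw d n m (b / m)
        (varianceConst K * (G ^ 2 * T * Real.log (1 / δ) / ((m : ℝ) ^ 2 * ε ^ 2))) ν)
      (transcript ℓ η γ b C x₀ T) i := by
  intro D D' hD ⟨j, hDi⟩ S hS
  have hm0 : (0 : ℝ) < m := by exact_mod_cast hm
  have hT0 : (0 : ℝ) < T := by exact_mod_cast hT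
  set l := Real.log (1 / δ) with hl
  have hl0 : 0 < l := Real.log_pos (by rw [lt_div_iff₀ hδ]; linarith)
  have hc := varianceConst_pos hK
  set v := varianceConst K * (G ^ 2 * T * l / ((m : ℝ) ^ 2 * ε ^ 2)) with hv
  have hv0 : 0 < v := by positivity
  set q := b / m with hq
  have hq0 : 0 < q := by positivity
  have hq1 : q ≤ 1 := (div_le_one hm0).mpr hbm
  -- The sensitivity of a sampled gradient in units of the noise; the always-present term `∇ℓ/m` is
  -- smaller by the factor `q = b/m`.
  set κ := G / (b * √v) with hκ
  have hsv : 0 < √v := Real.sqrt_pos.mpr hv0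
  have hκ0 : 0 < κ := by positivity
  have hκ2 : κ ^ 2 = ε ^ 2 / (varianceConst K * T * l * q ^ 2) := by
    rw [hκ, div_pow, mul_pow, Real.sq_sqrt hv0.le, hv, hq]
    field_simp
  have hεT' : ε < roundsConst K * q ^ 2 * T := by
    refine hεT.trans_eq ?_
    rw [hq]; ring
  obtain ⟨hκ1, N, hN, hNε⟩ := exists_moment_order hK hε hl0 hT0 hq0 hεK hεT' hκ2 hκ0
  have hu : ∀ z (w : Vec d), ‖(√v)⁻¹ • ((1 / (m : ℝ)) • ∇ (ℓ z) w)‖ ≤ q * κ := fun z w => by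
    rw [norm_smul, norm_smul, Real.norm_of_nonneg (by positivity), Real.norm_of_nonneg (by positivity)]
    calc (√v)⁻¹ * (1 / (m : ℝ) * ‖∇ (ℓ z) w‖) ≤ (√v)⁻¹ * (1 / (m : ℝ) * G) := by
          gcongr; exact hℓG z w
      _ = q * κ := by rw [hq, hκ]; field_simp
  have hΔ : ∀ z (x w : Vec d), ‖(√v)⁻¹ • ((1 / b) • (∇ (ℓ z) x - ∇ (ℓ z) w))‖ ≤ 2 * κ :=
    fun z x w => by
    rw [norm_smul, norm_smul, Real.norm_of_nonneg (by positivity), Real.norm_of_nonneg (by positivity)]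
    calc (√v)⁻¹ * (1 / b * ‖∇ (ℓ z) x - ∇ (ℓ z) w‖) ≤ (√v)⁻¹ * (1 / b * (G + G)) := by
          gcongr; exact (norm_sub_le _ _).trans (add_le_add (hℓG z x) (hℓG z w))
      _ = 2 * κ := by rw [hκ]; field_simp; ring
  have hmS : Measurable fun (w : ℕ → Fin n → Vec d) (t : Fin T) i => w t i := by fun_prop
  have key := expectedValue_le_of_moment (φ := Set.indicator {w | (fun (t : Fin T) i => w t i) ∈ S} 1)
    ℓ η γ b C ν hℓ hC hq0.le hq1 hv0 hD hDi (measurable_one.indicator (hmS hS))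
    (fun w => Set.indicator_le' (fun _ _ => le_rfl) (fun _ _ => zero_le_one) w)
    ENNReal.ofReal_ne_top hu hΔ
    (fun u Δ u' Δ' h1 h2 h3 h4 => lintegral_mixDensity_ratio_le hq0 hq1 hκ0 hκ1 h1 h2 h3 h4 hN)
    -- Initially the hidden point is known to be `x₀`, so there is a single candidate and both
    -- weights are one.
    (ε := ε) T 0 Unit (fun _ => x₀) (fun _ => 1) (fun _ => 1) (fun _ => zero_le_one)
    (fun _ => zero_le_one) (by simp) (by simp) (initState n m x₀, 0)
  have hset : (initState n m x₀).setPoint i j x₀ = initState n m x₀ :=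
    State.setPoint_self i j (initState n m x₀)
  simp only [Finset.univ_unique, Finset.sum_const, Finset.card_singleton, one_smul,
    ENNReal.ofReal_one, one_mul, one_pow, div_one, mul_one, hset] at key
  rw [measure_transcript_mem ℓ η γ b C q v ν D hℓ hC x₀ T hS,
    measure_transcript_mem ℓ η γ b C q v ν D' hℓ hC x₀ T hS]
  refine key.trans (add_le_add_right ?_ _)
  rw [← ENNReal.ofReal_pow (Real.exp_pos _).le, ← ENNReal.ofReal_mul (Real.exp_pos _).le,
    ← Real.exp_nat_mul, ← Real.exp_add]
  refine ENNReal.ofReal_le_ofReal ?_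
  refine (Real.exp_le_exp.mpr hNε).trans (le_of_eq ?_)
  rw [hl, one_div, Real.log_inv, neg_neg, Real.exp_log hδ]

end Privacy


/-! ### Averages of smooth functions and the descent inequality -/

section Smoothness

variable {d : ℕ} {L : ℝ}

lemma hasGradientAt_const_mul_sum {ι : Type*} [Fintype ι] {φ : ι → Vec d → ℝ}
    (h : ∀ i, Differentiable ℝ (φ i)) (c : ℝ) (x : Vec d) :
    HasGradientAt (fun y => c * ∑ i, φ i y) (c • ∑ i, ∇ (φ i) x) x := by
  rw [hasGradientAt_iff_hasFDerivAt, map_smul, map_sum]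
  exact (HasFDerivAt.fun_sum fun i _ =>
    hasGradientAt_iff_hasFDerivAt.mp ((h i) x).hasGradientAt).const_mul c

lemma IsLSmooth.average {k : ℕ} (hk : 1 ≤ k) {φ : Fin k → Vec d → ℝ}
    (h : ∀ i, IsLSmooth L (φ i)) : IsLSmooth L fun x => (1 / (k : ℝ)) * ∑ i, φ i x := by
  have hg := hasGradientAt_const_mul_sum (fun i => (h i).1) (1 / (k : ℝ))
  have hk0 : (0 : ℝ) < k := by exact_mod_cast hk
  refine ⟨fun x => (hg x).differentiableAt, fun x y => ?_⟩
  rw [(hg x).gradient, (hg y).gradient, ← smul_sub, ← Finset.sum_sub_distrib, norm_smul,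
    Real.norm_of_nonneg (by positivity)]
  calc 1 / (k : ℝ) * ‖∑ i, (∇ (φ i) x - ∇ (φ i) y)‖
      ≤ 1 / (k : ℝ) * ∑ _i : Fin k, L * ‖x - y‖ := by
        gcongr
        exact (norm_sum_le _ _).trans (Finset.sum_le_sum fun i _ => (h i).2 x y)
    _ = L * ‖x - y‖ := by
        rw [Finset.sum_const, Finset.card_univ, Fintype.card_fin, nsmul_eq_mul]
        field_simp

lemma HasBoundedGradient.average {k : ℕ} (hk : 1 ≤ k) {G : ℝ} {φ : Fin k → Vec d → ℝ}
    (hφ : ∀ i, Differentiable ℝ (φ i)) (h : ∀ i, HasBoundedGradient G (φ i)) :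
    HasBoundedGradient G fun x => (1 / (k : ℝ)) * ∑ i, φ i x := by
  intro x
  have hk0 : (0 : ℝ) < k := by exact_mod_cast hk
  rw [(hasGradientAt_const_mul_sum hφ (1 / (k : ℝ)) x).gradient, norm_smul,
    Real.norm_of_nonneg (by positivity)]
  calc 1 / (k : ℝ) * ‖∑ i, ∇ (φ i) x‖ ≤ 1 / (k : ℝ) * ∑ _i : Fin k, G := by
        gcongr
        exact (norm_sum_le _ _).trans (Finset.sum_le_sum fun i _ => h i x)
    _ = G := by
        rw [Finset.sum_const, Finset.card_univ, Fintype.card_fin, nsmul_eq_mul]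
        field_simp

/-- The quadratic upper bound of a smooth function. -/
lemma IsLSmooth.le_quadratic {φ : Vec d → ℝ} (h : IsLSmooth L φ) (x v : Vec d) :
    φ (x + v) ≤ φ x + inner ℝ (∇ φ x) v + L / 2 * ‖v‖ ^ 2 := by
  set ψ : ℝ → ℝ := fun s => φ (x + s • v) - s * inner ℝ (∇ φ x) v - s ^ 2 * (L / 2 * ‖v‖ ^ 2)
  have hd : ∀ s, HasDerivAt ψ (inner ℝ (∇ φ (x + s • v)) v - inner ℝ (∇ φ x) v
      - (2 * s) * (L / 2 * ‖v‖ ^ 2)) s := by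
    intro s
    have h1 : HasDerivAt (fun s : ℝ => x + s • v) v s := by
      simpa using ((hasDerivAt_id s).smul_const v).const_add x
    have h2 := (hasGradientAt_iff_hasFDerivAt.mp
      (h.1 (x + s • v)).hasGradientAt).comp_hasDerivAt s h1
    rw [InnerProductSpace.toDual_apply_apply] at h2
    have h3 := (h2.sub ((hasDerivAt_id s).mul_const (inner ℝ (∇ φ x) v))).sub
      (((hasDerivAt_id s).pow 2).mul_const (L / 2 * ‖v‖ ^ 2))
    refine h3.congr_deriv ?_
    simp
  -- By Cauchy–Schwarz and the Lipschitz gradient, the derivative at `s` is at most `sL‖v‖² - sL‖v‖²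
  -- = 0`.
  have hanti : AntitoneOn ψ (Set.Icc 0 1) := by
    refine antitoneOn_of_deriv_nonpos (convex_Icc 0 1)
      (fun s _ => (hd s).continuousAt.continuousWithinAt)
      (fun s _ => (hd s).differentiableAt.differentiableWithinAt) fun s hs => ?_
    rw [interior_Icc] at hs
    rw [(hd s).deriv, ← inner_sub_left]
    have h1 := real_inner_le_norm (∇ φ (x + s • v) - ∇ φ x) v
    have h2 := h.2 (x + s • v) x
    rw [add_sub_cancel_left, norm_smul, Real.norm_of_nonneg hs.1.le] at h2
    nlinarith [mul_le_mul_of_nonneg_right h2 (norm_nonneg v)]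
  have := hanti (Set.left_mem_Icc.mpr zero_le_one) (Set.right_mem_Icc.mpr zero_le_one) zero_le_one
  simp only [ψ, one_smul, zero_smul, add_zero] at this
  linarith

end Smoothness

/-! ### Bias–variance decomposition -/

section SecondMoments

/-- Young's inequality for the square of the norm of a sum. -/
lemma norm_add_sq_le_young {E : Type*} [SeminormedAddCommGroup E] (a b : E) {θ : ℝ} (hθ : 0 < θ) :
    ‖a + b‖ ^ 2 ≤ (1 + θ) * ‖a‖ ^ 2 + (1 + 1 / θ) * ‖b‖ ^ 2 := by
  have h1 : ‖a + b‖ ^ 2 ≤ (‖a‖ + ‖b‖) ^ 2 := by gcongr; exact norm_add_le a b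
  have h2 : 0 ≤ (θ * ‖a‖ - ‖b‖) ^ 2 / θ := by positivity
  have h3 : (θ * ‖a‖ - ‖b‖) ^ 2 / θ = θ * ‖a‖ ^ 2 - 2 * ‖a‖ * ‖b‖ + 1 / θ * ‖b‖ ^ 2 := by
    field_simp
    ring
  nlinarith

variable {E : Type*} [NormedAddCommGroup E] [InnerProductSpace ℝ E] [CompleteSpace E] {Ω : Type*} [MeasurableSpace Ω] {P : Measure Ω} [IsProbabilityMeasure P]

/-- The decomposition of the second moment around a point into variance and squared bias. -/
lemma integral_norm_sub_sq {X : Ω → E} (hX : MemLp X 2 P) (a : E) :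
    ∫ w, ‖X w - a‖ ^ 2 ∂P = ∫ w, ‖X w - ∫ u, X u ∂P‖ ^ 2 ∂P + ‖∫ u, X u ∂P - a‖ ^ 2 := by
  set μ := ∫ u, X u ∂P with hμ
  have hXi : Integrable X P := hX.integrable one_le_two
  have e : ∀ w, ‖X w - a‖ ^ 2 = ‖X w - μ‖ ^ 2 + 2 * inner ℝ (μ - a) (X w - μ) + ‖μ - a‖ ^ 2 := by
    intro w
    rw [show X w - a = (X w - μ) + (μ - a) by abel, norm_add_sq_real, real_inner_comm]
  have hi : Integrable (fun w => X w - μ) P := hXi.sub (integrable_const μ)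
  have hz : ∫ w, (X w - μ) ∂P = 0 := by
    rw [integral_sub hXi (integrable_const μ)]; simp [← hμ]
  have i1 : Integrable (fun w => ‖X w - μ‖ ^ 2) P := (hX.sub (memLp_const μ)).integrable_norm_pow
    two_ne_zero
  have i2 : Integrable (fun w => 2 * inner ℝ (μ - a) (X w - μ)) P := (hi.const_inner _).const_mul 2
  simp_rw [e]
  have i3 : Integrable (fun w => ‖X w - μ‖ ^ 2 + 2 * inner ℝ (μ - a) (X w - μ)) P := i1.add i2
  rw [integral_add i3 (integrable_const _), integral_add i1 i2, integral_const_mul,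
    integral_inner hi, hz]
  simp

end SecondMoments

/-! ### Variance of sums of independent random vectors -/

section IndependentSums

variable {d : ℕ}

lemma memLp_pi_eval {ι : Type*} [Fintype ι] {Ω : ι → Type*} [∀ i, MeasurableSpace (Ω i)]
    {μ : ∀ i, Measure (Ω i)} [∀ i, IsProbabilityMeasure (μ i)] {E : Type*} [NormedAddCommGroup E]
    (i : ι) {X : Ω i → E} (hX : MemLp X 2 (μ i)) : MemLp (fun r => X (r i)) 2 (Measure.pi μ) :=
  hX.comp_measurePreserving (measurePreserving_eval μ i)

lemma integral_pi_eval {ι : Type*} [Fintype ι] {Ω : ι → Type*} [∀ i, MeasurableSpace (Ω i)]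
    {μ : ∀ i, Measure (Ω i)} [∀ i, IsProbabilityMeasure (μ i)] {E : Type*} [NormedAddCommGroup E]
    [NormedSpace ℝ E] (i : ι) {X : Ω i → E} (hX : AEStronglyMeasurable X (μ i)) :
    ∫ r, X (r i) ∂(Measure.pi μ) = ∫ w, X w ∂(μ i) := by
  have h := (measurePreserving_eval μ i)
  conv_rhs => rw [← h.map_eq]
  rw [integral_map h.measurable.aemeasurable (by rw [h.map_eq]; exact hX)]

lemma MemLp.apply_euclidean {Ω : Type*} [MeasurableSpace Ω] {P : Measure Ω} {X : Ω → Vec d}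
    (hX : MemLp X 2 P) (k : Fin d) : MemLp (fun w => X w k) 2 P :=
  (EuclideanSpace.proj (𝕜 := ℝ) k).comp_memLp' hX

lemma integral_apply_euclidean {Ω : Type*} [MeasurableSpace Ω] {P : Measure Ω} {X : Ω → Vec d}
    (hX : Integrable X P) (k : Fin d) : (∫ w, X w ∂P) k = ∫ w, X w k ∂P :=
  ((EuclideanSpace.proj (𝕜 := ℝ) k).integral_comp_comm hX).symm

/-- The variance of a random vector is the sum of the variances of its coordinates. -/
lemma integral_norm_sub_integral_sq_eq_sum_variance {Ω : Type*} [MeasurableSpace Ω] {P : Measure Ω}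
    [IsProbabilityMeasure P] {X : Ω → Vec d} (hX : MemLp X 2 P) :
    ∫ w, ‖X w - ∫ u, X u ∂P‖ ^ 2 ∂P = ∑ k, Var[fun w => X w k; P] := by
  have hXk := fun k => MemLp.apply_euclidean hX k
  simp_rw [EuclideanSpace.real_norm_sq_eq, PiLp.sub_apply,
    integral_apply_euclidean (hX.integrable one_le_two)]
  have hi : ∀ k, Integrable (fun w => (X w k - ∫ u, X u k ∂P) ^ 2) P :=
    fun k => ((hXk k).sub (memLp_const _)).integrable_sq
  rw [integral_finsetSum _ fun k _ => hi k]
  exact Finset.sum_congr rfl fun k _ => (variance_eq_integral (hXk k).1.aemeasurable).symm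

/-- The variance of a sum of independent random vectors is the sum of their variances. -/
lemma integral_norm_sum_pi_sub_sq {ι : Type*} [Fintype ι] {Ω : ι → Type*}
    [∀ i, MeasurableSpace (Ω i)] {μ : ∀ i, Measure (Ω i)} [∀ i, IsProbabilityMeasure (μ i)]
    {X : ∀ i, Ω i → Vec d} (hX : ∀ i, MemLp (X i) 2 (μ i)) :
    ∫ r, ‖∑ i, X i (r i) - ∑ i, ∫ w, X i w ∂(μ i)‖ ^ 2 ∂(Measure.pi μ)
      = ∑ i, ∫ w, ‖X i w - ∫ u, X i u ∂(μ i)‖ ^ 2 ∂(μ i) := by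
  have hm := fun i => memLp_pi_eval (μ := μ) i (hX i)
  have hsum : ∑ i, ∫ w, X i w ∂(μ i) = ∫ r, ∑ i, X i (r i) ∂(Measure.pi μ) := by
    rw [integral_finsetSum _ fun i _ => (hm i).integrable one_le_two]
    exact Finset.sum_congr rfl fun i _ => (integral_pi_eval i (hX i).1).symm
  rw [hsum, integral_norm_sub_integral_sq_eq_sum_variance (memLp_finsetSum _ fun i _ => hm i)]
  simp_rw [fun i => integral_norm_sub_integral_sq_eq_sum_variance (hX i)]
  rw [Finset.sum_comm]
  refine Finset.sum_congr rfl fun k _ => ?_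
  rw [← variance_sum_pi fun i => MemLp.apply_euclidean (hX i) k]
  congr 1
  ext r
  simp

end IndependentSums


lemma memLp_two_of_finite {α E : Type*} [Finite α] [MeasurableSpace α]
    [MeasurableSingletonClass α] [NormedAddCommGroup E] {P : Measure α} [IsFiniteMeasure P]
    (X : α → E) : MemLp X 2 P :=
  (memLp_two_iff_integrable_sq_norm Integrable.of_finite.1).mpr Integrable.of_finite

/-! ### Mean and variance of the SAGA estimator -/

section Minibatch

variable {d m : ℕ} {Z : Type*} {L q b : ℝ}

lemma integral_bernoulli {E : Type*} [NormedAddCommGroup E] [NormedSpace ℝ E] [CompleteSpace E]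
    (hq0 : 0 ≤ q) (hq1 : q ≤ 1) (F : Bool → E) :
    ∫ B, F B ∂(bernoulliMeasure true false (Set.projIcc (0 : ℝ) 1 zero_le_one q))
      = q • F true + (1 - q) • F false := by
  rw [integral_bernoulliMeasure, Set.projIcc_of_mem _ ⟨hq0, hq1⟩]

variable {ℓ : Z → Vec d → ℝ} (hℓ : ∀ z, IsLSmooth L (ℓ z)) (hm : 1 ≤ m)

include hℓ in
lemma gradient_localLoss (Di : Fin m → Z) (x : Vec d) :
    ∇ (localLoss ℓ Di) x = (1 / (m : ℝ)) • ∑ j, ∇ (ℓ (Di j)) x :=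
  (hasGradientAt_const_mul_sum (fun j => (hℓ (Di j)).1) (1 / (m : ℝ)) x).gradient

lemma sagaEstimator_eq_sum (b : ℝ) (Di : Fin m → Z) (x : Vec d) (w : Fin m → Vec d)
    (batch : Fin m → Bool) :
    sagaEstimator ℓ b Di x w batch = ∑ j, sampleTerm ℓ m b (Di j) x (w j) (batch j) := by
  unfold sagaEstimator sampleTerm
  rw [Finset.sum_filter, Finset.sum_add_distrib, Finset.smul_sum, Finset.smul_sum]

include hm in
lemma integral_sampleTerm (hb : 0 < b) (hbm : b ≤ m) (z : Z) (x w : Vec d) :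
    ∫ B, sampleTerm ℓ m b z x w B
        ∂(bernoulliMeasure true false (Set.projIcc (0 : ℝ) 1 zero_le_one (b / m)))
      = (1 / (m : ℝ)) • ∇ (ℓ z) x := by
  have hm0 : (0 : ℝ) < m := by exact_mod_cast hm
  rw [integral_bernoulli (by positivity) ((div_le_one hm0).mpr hbm)]
  simp only [sampleTerm, if_true, Bool.false_eq_true, if_false, smul_zero, zero_add, smul_add,
    smul_smul, smul_sub]
  rw [show b / m * (1 / b) = 1 / (m : ℝ) by field_simp]
  module

include hm in
-- The variance is at most the second moment about any point. About the value for an undrawn sample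
-- this moment is `(b/m) · b⁻² ‖∇ℓ(x) - ∇ℓ(w)‖²`.
lemma variance_sampleTerm_le (hb : 0 < b) (hbm : b ≤ m) (z : Z) (x w : Vec d) :
    ∫ B, ‖sampleTerm ℓ m b z x w B - ∫ B', sampleTerm ℓ m b z x w B'
          ∂(bernoulliMeasure true false (Set.projIcc (0 : ℝ) 1 zero_le_one (b / m)))‖ ^ 2
        ∂(bernoulliMeasure true false (Set.projIcc (0 : ℝ) 1 zero_le_one (b / m)))
      ≤ 1 / (b * m) * ‖∇ (ℓ z) x - ∇ (ℓ z) w‖ ^ 2 := by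
  have hm0 : (0 : ℝ) < m := by exact_mod_cast hm
  set P := bernoulliMeasure true false (Set.projIcc (0 : ℝ) 1 zero_le_one (b / m)) with hP
  have h := integral_norm_sub_sq (P := P) (memLp_two_of_finite (sampleTerm ℓ m b z x w))
    ((1 / (m : ℝ)) • ∇ (ℓ z) w)
  have h2 : ∫ B, ‖sampleTerm ℓ m b z x w B - (1 / (m : ℝ)) • ∇ (ℓ z) w‖ ^ 2 ∂P
      = 1 / (b * m) * ‖∇ (ℓ z) x - ∇ (ℓ z) w‖ ^ 2 := by
    rw [hP, integral_bernoulli (by positivity) ((div_le_one hm0).mpr hbm)]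
    simp only [sampleTerm, if_true, Bool.false_eq_true, if_false, smul_zero, zero_add,
      add_sub_cancel_right, sub_self, norm_smul, norm_zero]
    rw [Real.norm_of_nonneg (by positivity)]
    simp only [smul_eq_mul]
    field_simp
    ring
  rw [← h2, h]
  exact le_add_of_nonneg_right (by positivity)

include hℓ hm in
lemma integral_sagaEstimator (hb : 0 < b) (hbm : b ≤ m) (Di : Fin m → Z) (x : Vec d)
    (w : Fin m → Vec d) :
    ∫ β, sagaEstimator ℓ b Di x w β ∂(batchLaw m (b / m)) = ∇ (localLoss ℓ Di) x := by
  rw [gradient_localLoss hℓ]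
  simp_rw [sagaEstimator_eq_sum, batchLaw]
  rw [integral_finsetSum _ fun j _ => Integrable.of_finite, Finset.smul_sum]
  refine Finset.sum_congr rfl fun j _ => ?_
  rw [← integral_sampleTerm hm hb hbm (Di j) x (w j)]
  exact integral_pi_eval (μ := fun _ : Fin m => bernoulliMeasure true false
    (Set.projIcc (0 : ℝ) 1 zero_le_one (b / m))) j (X := sampleTerm ℓ m b (Di j) x (w j))
    (Integrable.of_finite).1

include hℓ hm in
lemma variance_sagaEstimator_le (hb : 0 < b) (hbm : b ≤ m) (Di : Fin m → Z) (x : Vec d)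
    (w : Fin m → Vec d) :
    ∫ β, ‖sagaEstimator ℓ b Di x w β - ∇ (localLoss ℓ Di) x‖ ^ 2 ∂(batchLaw m (b / m))
      ≤ L ^ 2 / (b * m) * ∑ j, ‖x - w j‖ ^ 2 := by
  have hm0 : (0 : ℝ) < m := by exact_mod_cast hm
  have h := integral_norm_sum_pi_sub_sq
    (μ := fun _ : Fin m => bernoulliMeasure true false
      (Set.projIcc (0 : ℝ) 1 zero_le_one (b / m)))
    (X := fun j => sampleTerm ℓ m b (Di j) x (w j)) fun j => memLp_two_of_finite _
  have e : ∑ j, ∫ B, sampleTerm ℓ m b (Di j) x (w j) B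
      ∂(bernoulliMeasure true false (Set.projIcc (0 : ℝ) 1 zero_le_one (b / m)))
      = ∇ (localLoss ℓ Di) x := by
    rw [gradient_localLoss hℓ, Finset.smul_sum]
    exact Finset.sum_congr rfl fun j _ => integral_sampleTerm hm hb hbm (Di j) x (w j)
  rw [e] at h
  simp_rw [sagaEstimator_eq_sum, batchLaw]
  rw [h, Finset.mul_sum]
  refine Finset.sum_le_sum fun j _ => (variance_sampleTerm_le hm hb hbm (Di j) x (w j)).trans ?_
  have hg := (hℓ (Di j)).2 x (w j)
  calc 1 / (b * m) * ‖∇ (ℓ (Di j)) x - ∇ (ℓ (Di j)) (w j)‖ ^ 2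
      ≤ 1 / (b * m) * (L * ‖x - w j‖) ^ 2 := by gcongr
    _ = L ^ 2 / (b * m) * ‖x - w j‖ ^ 2 := by ring

end Minibatch

/-! ### Second moments of the Gaussian perturbation -/

section GaussianMoments

variable {d : ℕ} {v : ℝ}

lemma memLp_id_gaussianLaw : MemLp (fun z => z) 2 (gaussianLaw d v) := by
  unfold gaussianLaw
  rw [memLp_map_measure_iff (by fun_prop) (by fun_prop)]
  exact MemLp.const_smul (IsGaussian.memLp_two_id (μ := stdGaussian (Vec d))) (√v)

lemma integral_id_gaussianLaw : ∫ z, z ∂(gaussianLaw d v) = 0 := by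
  unfold gaussianLaw
  rw [integral_map (by fun_prop) (by fun_prop), integral_smul]
  simp

lemma integral_norm_sq_stdGaussian : ∫ z, ‖z‖ ^ 2 ∂(stdGaussian (Vec d)) = d := by
  have h := integral_norm_sub_integral_sq_eq_sum_variance
    (X := fun z => z) (IsGaussian.memLp_two_id (μ := stdGaussian (Vec d)))
  simp only [integral_id_stdGaussian, sub_zero] at h
  rw [h]
  have hk : ∀ k : Fin d, Var[fun z : Vec d => z k; stdGaussian (Vec d)] = 1 := by
    intro k
    have := variance_dual_stdGaussian (innerSL ℝ (EuclideanSpace.single k (1 : ℝ)))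
    rw [innerSL_apply_norm, PiLp.norm_single] at this
    rw [show (1 : ℝ) = ‖(1 : ℝ)‖ ^ 2 by simp, ← this]
    congr 1
    ext z
    rw [innerSL_apply_apply, EuclideanSpace.inner_single_left]
    simp
  simp [hk]

lemma integral_norm_sq_gaussianLaw (hv : 0 ≤ v) : ∫ z, ‖z‖ ^ 2 ∂(gaussianLaw d v) = d * v := by
  unfold gaussianLaw
  rw [integral_map (by fun_prop) (by fun_prop)]
  simp_rw [norm_smul, mul_pow]
  rw [integral_const_mul, integral_norm_sq_stdGaussian, Real.norm_of_nonneg (Real.sqrt_nonneg v),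
    Real.sq_sqrt hv, mul_comm]

lemma integral_norm_gaussianLaw_add_sq (hv : 0 ≤ v) (a : Vec d) :
    ∫ z, ‖a + z‖ ^ 2 ∂(gaussianLaw d v) = d * v + ‖a‖ ^ 2 := by
  have h := integral_norm_sub_sq (memLp_id_gaussianLaw (d := d) (v := v)) (-a)
  simp only [integral_id_gaussianLaw, sub_zero, sub_neg_eq_add, zero_add,
    integral_norm_sq_gaussianLaw hv] at h
  rw [← h]
  simp_rw [add_comm a]

end GaussianMoments

/-! ### Mean and variance of a client's message -/

section ClientMoments

variable {d m : ℕ} {Z U : Type*} [MeasurableSpace U] {L b ω v : ℝ} {ℓ : Z → Vec d → ℝ}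

lemma IsCompressor.memLp {ν : Measure U} [IsProbabilityMeasure ν] {C : U → Vec d → Vec d}
    (hC : IsCompressor ω ν C) (x : Vec d) : MemLp (fun u => C u x) 2 ν := by
  have hmeas : Measurable fun u => C u x := hC.measurable.comp measurable_prodMk_right
  have h : MemLp (fun u => C u x - x) 2 ν :=
    (memLp_two_iff_integrable_sq_norm (hmeas.sub_const x).aestronglyMeasurable).mpr
      (hC.integrable_sq x)
  refine (h.add (memLp_const x)).ae_eq (ae_of_all _ fun u => ?_)
  simp

lemma IsCompressor.integral_norm_sub_sq_le {ν : Measure U} [IsProbabilityMeasure ν]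
    {C : U → Vec d → Vec d} (hC : IsCompressor ω ν C) (x a : Vec d) :
    ∫ u, ‖C u x - a‖ ^ 2 ∂ν ≤ ω * ‖x‖ ^ 2 + ‖x - a‖ ^ 2 := by
  rw [integral_norm_sub_sq (hC.memLp x) a, hC.unbiased x]
  gcongr
  exact hC.variance_le x

/-- The law of the randomness of one client in one round. -/
noncomputable def clientLaw (d m : ℕ) (q v : ℝ) (ν : Measure U) : Measure (ClientNoise d m U) :=
  (batchLaw m q).prod ((gaussianLaw d v).prod ν)

instance (q v : ℝ) (ν : Measure U) [IsProbabilityMeasure ν] :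
    IsProbabilityMeasure (clientLaw d m q v ν) := by
  unfold clientLaw; infer_instance

/-- The message of a client as a function of its own randomness. -/
noncomputable def clientMessage (ℓ : Z → Vec d → ℝ) (b : ℝ) (C : U → Vec d → Vec d)
    (Di : Fin m → Z) (x s : Vec d) (w : Fin m → Vec d) (r : ClientNoise d m U) : Vec d :=
  C r.2.2 (sagaEstimator ℓ b Di x w r.1 + r.2.1 - s)

variable {ν : Measure U} [IsProbabilityMeasure ν] {C : U → Vec d → Vec d}
  (hC : IsCompressor ω ν C) (Di : Fin m → Z) (x s : Vec d) (w : Fin m → Vec d)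

include hC in
omit [IsProbabilityMeasure ν] in
lemma measurable_clientMessage : Measurable (clientMessage ℓ b C Di x s w) := by
  have h1 : Measurable fun r : ClientNoise d m U => sagaEstimator ℓ b Di x w r.1 :=
    (measurable_of_finite (sagaEstimator ℓ b Di x w)).comp measurable_fst
  exact hC.measurable.comp ((measurable_snd.comp measurable_snd).prodMk
    ((h1.add (measurable_fst.comp measurable_snd)).sub_const s))

variable (hℓ : ∀ z, IsLSmooth L (ℓ z)) (hm : 1 ≤ m) (hb : 0 < b) (hbm : b ≤ m) (hω : 0 ≤ ω)
  (hv : 0 ≤ v)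

include hC hℓ hm hb hbm hω hv in
-- Integrates out the compressor, the perturbation and the minibatch, in this order. The compressor
-- adds `ω` times the second moment of its argument, whose squared mean is the shift error, so the
-- estimator variance and the noise are multiplied by `1 + ω`. A lower integral is used because
-- square integrability is deduced from this bound.
lemma lintegral_clientMessage_le :
    ∫⁻ r, ENNReal.ofReal (‖clientMessage ℓ b C Di x s w r - (∇ (localLoss ℓ Di) x - s)‖ ^ 2)
        ∂(clientLaw d m (b / m) v ν)
      ≤ ENNReal.ofReal ((1 + ω) * (L ^ 2 / (b * m) * ∑ j, ‖x - w j‖ ^ 2 + d * v)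
          + ω * ‖∇ (localLoss ℓ Di) x - s‖ ^ 2) := by
  set e := ∇ (localLoss ℓ Di) x - s with he
  have hmeas : Measurable fun r =>
      ENNReal.ofReal (‖clientMessage ℓ b C Di x s w r - e‖ ^ 2) :=
    (((measurable_clientMessage hC Di x s w).sub_const e).norm.pow_const 2).ennreal_ofReal
  unfold clientLaw
  rw [lintegral_prod _ hmeas.aemeasurable]
  have hinner : ∀ β, ∫⁻ p, ENNReal.ofReal (‖clientMessage ℓ b C Di x s w (β, p) - e‖ ^ 2)
        ∂((gaussianLaw d v).prod ν)
      ≤ ENNReal.ofReal (ω * (d * v + ‖sagaEstimator ℓ b Di x w β - s‖ ^ 2)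
          + (d * v + ‖sagaEstimator ℓ b Di x w β - s - e‖ ^ 2)) := by
    intro β
    have hβ : Measurable fun p : Vec d × U =>
        ENNReal.ofReal (‖clientMessage ℓ b C Di x s w (β, p) - e‖ ^ 2) :=
      hmeas.comp measurable_prodMk_left
    rw [lintegral_prod _ hβ.aemeasurable]
    set g := sagaEstimator ℓ b Di x w β
    have hstep : ∀ ξ : Vec d,
        ∫⁻ u, ENNReal.ofReal (‖clientMessage ℓ b C Di x s w (β, ξ, u) - e‖ ^ 2) ∂ν
          ≤ ENNReal.ofReal (ω * ‖(g - s) + ξ‖ ^ 2 + ‖(g - s - e) + ξ‖ ^ 2) := by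
      intro ξ
      have hi : Integrable (fun u => ‖C u (g + ξ - s) - e‖ ^ 2) ν :=
        ((hC.memLp (g + ξ - s)).sub (memLp_const e)).integrable_norm_pow two_ne_zero
      rw [show (fun u => ENNReal.ofReal (‖clientMessage ℓ b C Di x s w (β, ξ, u) - e‖ ^ 2))
        = fun u => ENNReal.ofReal (‖C u (g + ξ - s) - e‖ ^ 2) from rfl,
        ← ofReal_integral_eq_lintegral_ofReal hi (ae_of_all _ fun u => by positivity)]
      refine ENNReal.ofReal_le_ofReal ((hC.integral_norm_sub_sq_le _ e).trans (le_of_eq ?_))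
      rw [show g + ξ - s = (g - s) + ξ by abel, show g - s + ξ - e = (g - s - e) + ξ by abel]
    refine (lintegral_mono hstep).trans (le_of_eq ?_)
    have hi : ∀ a : Vec d, Integrable (fun ξ => ‖a + ξ‖ ^ 2) (gaussianLaw d v) := fun a =>
      ((memLp_const a).add memLp_id_gaussianLaw).integrable_norm_pow two_ne_zero
    have hi' : Integrable (fun ξ => ω * ‖(g - s) + ξ‖ ^ 2 + ‖(g - s - e) + ξ‖ ^ 2)
      (gaussianLaw d v) := ((hi _).const_mul ω).add (hi _)
    rw [← ofReal_integral_eq_lintegral_ofReal hi'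
      (ae_of_all _ fun ξ => by positivity), integral_add ((hi _).const_mul ω) (hi _),
      integral_const_mul, integral_norm_gaussianLaw_add_sq hv, integral_norm_gaussianLaw_add_sq hv]
  refine (lintegral_mono hinner).trans ?_
  have hfin : ∀ f : (Fin m → Bool) → ℝ, Integrable f (batchLaw m (b / m)) :=
    fun f => Integrable.of_finite
  have hnn : 0 ≤ (d : ℝ) * v := by positivity
  rw [← ofReal_integral_eq_lintegral_ofReal (hfin _) (ae_of_all _ fun β => by positivity)]
  refine ENNReal.ofReal_le_ofReal ?_
  rw [integral_add (hfin _) (hfin _), integral_const_mul, integral_add (hfin _) (hfin _),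
    integral_add (hfin _) (hfin _),
    integral_norm_sub_sq (memLp_two_of_finite (sagaEstimator ℓ b Di x w)) s,
    integral_sagaEstimator hℓ hm hb hbm]
  have h2 := variance_sagaEstimator_le hℓ hm hb hbm Di x w
  have h3 : ∀ β, sagaEstimator ℓ b Di x w β - s - e
      = sagaEstimator ℓ b Di x w β - ∇ (localLoss ℓ Di) x := fun β => by rw [he]; abel
  simp_rw [h3, integral_const]
  simp only [probReal_univ, one_smul]
  rw [← he]
  nlinarith [mul_le_mul_of_nonneg_left h2 hω]

include hC hℓ hm hb hbm hω hv in
lemma memLp_clientMessage :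
    MemLp (clientMessage ℓ b C Di x s w) 2 (clientLaw d m (b / m) v ν) := by
  have hmeas := measurable_clientMessage (ℓ := ℓ) (b := b) hC Di x s w
  set e := ∇ (localLoss ℓ Di) x - s
  have h : MemLp (fun r => clientMessage ℓ b C Di x s w r - e) 2 (clientLaw d m (b / m) v ν) := by
    rw [memLp_two_iff_integrable_sq_norm (hmeas.sub_const e).aestronglyMeasurable]
    refine ⟨((hmeas.sub_const e).norm.pow_const 2).aestronglyMeasurable, ?_⟩
    rw [hasFiniteIntegral_iff_ofReal (ae_of_all _ fun r => by positivity)]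
    exact (lintegral_clientMessage_le hC Di x s w hℓ hm hb hbm hω hv).trans_lt ENNReal.ofReal_lt_top
  refine (h.add (memLp_const e)).ae_eq (ae_of_all _ fun r => ?_)
  simp

include hC hℓ hm hb hbm hω hv in
lemma integral_clientMessage :
    ∫ r, clientMessage ℓ b C Di x s w r ∂(clientLaw d m (b / m) v ν)
      = ∇ (localLoss ℓ Di) x - s := by
  have hi := (memLp_clientMessage (v := v) hC Di x s w hℓ hm hb hbm hω hv).integrable one_le_two
  have hg : Integrable (fun z : Vec d => z) (gaussianLaw d v) :=
    memLp_id_gaussianLaw.integrable one_le_two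
  unfold clientLaw at hi ⊢
  rw [integral_prod _ hi]
  have hinner : ∀ᵐ β ∂(batchLaw m (b / m)),
      ∫ p, clientMessage ℓ b C Di x s w (β, p) ∂((gaussianLaw d v).prod ν)
        = sagaEstimator ℓ b Di x w β - s := by
    filter_upwards [hi.prod_right_ae] with β hβ
    rw [integral_prod _ hβ]
    simp only [clientMessage, hC.unbiased]
    have hg' : Integrable (fun z => sagaEstimator ℓ b Di x w β + z) (gaussianLaw d v) :=
      (integrable_const _).add hg
    rw [integral_sub hg' (integrable_const _), integral_add (integrable_const _) hg,
      integral_id_gaussianLaw]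
    simp
  rw [integral_congr_ae hinner, integral_sub Integrable.of_finite (integrable_const _),
    integral_sagaEstimator hℓ hm hb hbm]
  simp

include hC hℓ hm hb hbm hω hv in
lemma variance_clientMessage_le :
    ∫ r, ‖clientMessage ℓ b C Di x s w r - (∇ (localLoss ℓ Di) x - s)‖ ^ 2
        ∂(clientLaw d m (b / m) v ν)
      ≤ (1 + ω) * (L ^ 2 / (b * m) * ∑ j, ‖x - w j‖ ^ 2 + d * v)
          + ω * ‖∇ (localLoss ℓ Di) x - s‖ ^ 2 := by
  have hm0 : (0 : ℝ) < m := by exact_mod_cast hm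
  rw [integral_eq_lintegral_of_nonneg_ae (ae_of_all _ fun r => by positivity)
    (((measurable_clientMessage hC Di x s w).sub_const _).norm.pow_const 2).aestronglyMeasurable]
  exact ENNReal.toReal_le_of_le_ofReal (by positivity)
    (lintegral_clientMessage_le hC Di x s w hℓ hm hb hbm hω hv)

end ClientMoments


/-! ### Pathwise bounds for the parts of the Lyapunov function -/

section Potential

variable {d n m : ℕ} {Z U : Type*}

/-- The mean squared distance of the references of the clients to their gradients. -/
noncomputable def shiftError (ℓ : Z → Vec d → ℝ) (D : Fin n → Fin m → Z) (st : State d n m) : ℝ :=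
  1 / (n : ℝ) * ∑ i, ‖∇ (localLoss ℓ (D i)) st.x - st.shift i‖ ^ 2

/-- The mean squared distance of the SAGA points to the model. -/
noncomputable def tableError (st : State d n m) : ℝ :=
  1 / ((n : ℝ) * m) * ∑ i, ∑ j, ‖st.x - st.table i j‖ ^ 2

/-- The Lyapunov function, with weights `a` and `c` and a lower bound `f₀` of the loss. -/
noncomputable def potential (ℓ : Z → Vec d → ℝ) (D : Fin n → Fin m → Z) (f₀ a c : ℝ)
    (st : State d n m) : ℝ :=
  globalLoss ℓ D st.x - f₀ + a * shiftError ℓ D st + c * tableError st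

/-- The direction of the server update. -/
noncomputable def direction (ℓ : Z → Vec d → ℝ) (b : ℝ) (C : Fin n → U → Vec d → Vec d)
    (D : Fin n → Fin m → Z) (st : State d n m) (r : Fin n → ClientNoise d m U) : Vec d :=
  st.serverShift + (1 / (n : ℝ)) • ∑ i, message ℓ b C D st r i

lemma shiftError_nonneg (ℓ : Z → Vec d → ℝ) (D : Fin n → Fin m → Z) (st : State d n m) :
    0 ≤ shiftError ℓ D st := by
  unfold shiftError; positivity

lemma tableError_nonneg (st : State d n m) : 0 ≤ tableError st := by
  unfold tableError; positivity

lemma average_le {k : ℕ} (hk : 1 ≤ k) {F F' : Fin k → ℝ} {c y : ℝ}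
    (h : ∀ i, F i ≤ c * F' i + y) :
    1 / (k : ℝ) * ∑ i, F i ≤ c * (1 / (k : ℝ) * ∑ i, F' i) + y := by
  have hk0 : (0 : ℝ) < k := by exact_mod_cast hk
  calc 1 / (k : ℝ) * ∑ i, F i ≤ 1 / (k : ℝ) * ∑ i, (c * F' i + y) := by
        gcongr with i
        exact h i
    _ = c * (1 / (k : ℝ) * ∑ i, F' i) + y := by
        rw [Finset.sum_add_distrib, ← Finset.mul_sum, Finset.sum_const, Finset.card_univ,
          Fintype.card_fin, nsmul_eq_mul]
        field_simp

variable {ℓ : Z → Vec d → ℝ} {L : ℝ} (hℓ : ∀ z, IsLSmooth L (ℓ z)) (hn : 1 ≤ n) (hm : 1 ≤ m)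
  {η γ b q : ℝ} (C : Fin n → U → Vec d → Vec d) (D : Fin n → Fin m → Z) (st : State d n m)
  (r : Fin n → ClientNoise d m U)

include hℓ hm in
lemma isLSmooth_localLoss (Di : Fin m → Z) : IsLSmooth L (localLoss ℓ Di) :=
  IsLSmooth.average hm fun j => hℓ (Di j)

include hℓ hn hm in
lemma isLSmooth_globalLoss : IsLSmooth L (globalLoss ℓ D) :=
  IsLSmooth.average hn fun i => isLSmooth_localLoss hℓ hm (D i)

include hℓ hm in
lemma gradient_globalLoss (x : Vec d) :
    ∇ (globalLoss ℓ D) x = (1 / (n : ℝ)) • ∑ i, ∇ (localLoss ℓ (D i)) x :=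
  (hasGradientAt_const_mul_sum (fun i => (isLSmooth_localLoss hℓ hm (D i)).1) (1 / (n : ℝ))
    x).gradient

include hℓ hn hm in
lemma globalLoss_round_le (η γ b : ℝ) :
    globalLoss ℓ D (round ℓ η γ b C D st r).x ≤ globalLoss ℓ D st.x
      - η * inner ℝ (∇ (globalLoss ℓ D) st.x) (direction ℓ b C D st r)
      + L / 2 * η ^ 2 * ‖direction ℓ b C D st r‖ ^ 2 := by
  have h := (isLSmooth_globalLoss hℓ hn hm D).le_quadratic st.x (-(η • direction ℓ b C D st r))
  rw [inner_neg_right, inner_smul_right, norm_neg, norm_smul, mul_pow, Real.norm_eq_abs,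
    sq_abs, ← sub_eq_add_neg] at h
  have e : (round ℓ η γ b C D st r).x = st.x - η • direction ℓ b C D st r := rfl
  rw [e]
  linarith

include hℓ hn hm in
lemma shiftError_round_le (η b : ℝ) (hγ : 0 < γ) (hγ1 : γ ≤ 1) :
    shiftError ℓ D (round ℓ η γ b C D st r)
      ≤ (1 + γ / 2) * (1 / (n : ℝ) * ∑ i, ‖γ • message ℓ b C D st r i
          - (∇ (localLoss ℓ (D i)) st.x - st.shift i)‖ ^ 2)
        + 3 / γ * L ^ 2 * η ^ 2 * ‖direction ℓ b C D st r‖ ^ 2 := by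
  refine average_le hn fun i => ?_
  set y := direction ℓ b C D st r
  set g := ∇ (localLoss ℓ (D i)) st.x
  set μ := message ℓ b C D st r i
  have e : ∇ (localLoss ℓ (D i)) (round ℓ η γ b C D st r).x - (round ℓ η γ b C D st r).shift i
      = (g - st.shift i - γ • μ) + (∇ (localLoss ℓ (D i)) (st.x - η • y) - g) := by
    change ∇ (localLoss ℓ (D i)) (st.x - η • y) - (st.shift i + γ • μ) = _
    abel
  rw [e]
  -- The parameter `γ/2` is small enough not to destroy the contraction of the shift update; the
  -- price is the factor `1 + 2/γ ≤ 3/γ` on the movement of the gradient.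
  have h1 := norm_add_sq_le_young (g - st.shift i - γ • μ)
    (∇ (localLoss ℓ (D i)) (st.x - η • y) - g) (half_pos hγ)
  have h2 := (isLSmooth_localLoss hℓ hm (D i)).2 (st.x - η • y) st.x
  rw [sub_sub_cancel_left, norm_neg, norm_smul] at h2
  have h3 : ‖∇ (localLoss ℓ (D i)) (st.x - η • y) - g‖ ^ 2 ≤ L ^ 2 * η ^ 2 * ‖y‖ ^ 2 := by
    calc _ ≤ (L * (‖η‖ * ‖y‖)) ^ 2 := by gcongr
      _ = L ^ 2 * η ^ 2 * ‖y‖ ^ 2 := by rw [mul_pow, mul_pow, Real.norm_eq_abs, sq_abs]; ring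
  have h4 : 1 + 1 / (γ / 2) ≤ 3 / γ := by
    rw [le_div_iff₀ hγ]
    have : (1 + 1 / (γ / 2)) * γ = γ + 2 := by field_simp
    linarith
  rw [norm_sub_rev (γ • μ)]
  calc _ ≤ _ := h1
    _ ≤ (1 + γ / 2) * ‖g - st.shift i - γ • μ‖ ^ 2 + 3 / γ * (L ^ 2 * η ^ 2 * ‖y‖ ^ 2) := by
      gcongr
    _ = _ := by ring

include hn hm in
-- A drawn sample gets the old model as its point, so its new distance is the length of the step.
-- For an undrawn one, Young's inequality with parameter `q/2` is harmless, because `(1 + q/2)(1 -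
-- q) ≤ 1 - q/2` after averaging.
lemma tableError_round_le (η γ b : ℝ) (hq : 0 < q) (hq1 : q ≤ 1) :
    tableError (round ℓ η γ b C D st r)
      ≤ (1 + q / 2) * (1 / ((n : ℝ) * m) * ∑ i, ∑ j,
          (if (r i).1 j = true then 0 else 1) * ‖st.x - st.table i j‖ ^ 2)
        + 3 / q * η ^ 2 * ‖direction ℓ b C D st r‖ ^ 2 := by
  set y := direction ℓ b C D st r
  have h4 : 1 + 1 / (q / 2) ≤ 3 / q := by
    rw [le_div_iff₀ hq]
    have : (1 + 1 / (q / 2)) * q = q + 2 := by field_simp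
    linarith
  have hη : ‖η • y‖ ^ 2 = η ^ 2 * ‖y‖ ^ 2 := by
    rw [norm_smul, mul_pow, Real.norm_eq_abs, sq_abs]
  have hij : ∀ i j, ‖(round ℓ η γ b C D st r).x - (round ℓ η γ b C D st r).table i j‖ ^ 2
      ≤ (1 + q / 2) * ((if (r i).1 j = true then 0 else 1) * ‖st.x - st.table i j‖ ^ 2)
        + 3 / q * η ^ 2 * ‖y‖ ^ 2 := by
    intro i j
    change ‖(st.x - η • y) - (if (r i).1 j = true then st.x else st.table i j)‖ ^ 2 ≤ _
    split_ifs with h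
    · rw [sub_sub_cancel_left, norm_neg, hη]
      have : (1 : ℝ) ≤ 3 / q := by rw [le_div_iff₀ hq]; linarith
      nlinarith [mul_nonneg (sub_nonneg.mpr this) (show 0 ≤ η ^ 2 * ‖y‖ ^ 2 by positivity)]
    · rw [show st.x - η • y - st.table i j = (st.x - st.table i j) + -(η • y) by abel, one_mul]
      refine (norm_add_sq_le_young _ _ (half_pos hq)).trans ?_
      rw [norm_neg, hη, mul_assoc (3 / q)]
      gcongr
  have h := average_le hn fun i => average_le hm fun j => hij i j
  unfold tableError
  simp only [← Finset.mul_sum] at h ⊢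
  have e : ∀ X : ℝ, 1 / ((n : ℝ) * m) * X = 1 / (n : ℝ) * (1 / (m : ℝ) * X) := fun X => by
    rw [← mul_assoc, one_div_mul_one_div]
  rw [e, e]
  exact h

end Potential


/-! ### Conditional moments of one round -/

section RoundMoments

variable {d n m : ℕ} {Z U : Type*} [MeasurableSpace U] {ℓ : Z → Vec d → ℝ} {L b ω v : ℝ}
  {C : Fin n → U → Vec d → Vec d} {ν : Fin n → Measure U} [∀ i, IsProbabilityMeasure (ν i)]
  (hC : ∀ i, IsCompressor ω (ν i) (C i)) (D : Fin n → Fin m → Z) (st : State d n m)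
  (hst : st.serverShift = (1 / (n : ℝ)) • ∑ i, st.shift i)
  (hℓ : ∀ z, IsLSmooth L (ℓ z)) (hn : 1 ≤ n) (hm : 1 ≤ m) (hb : 0 < b) (hbm : b ≤ m) (hω : 0 ≤ ω)
  (hv : 0 ≤ v)

lemma roundLaw_eq (q v : ℝ) (ν : Fin n → Measure U) :
    roundLaw d n m q v ν = Measure.pi fun i => clientLaw d m q v (ν i) := rfl

omit [MeasurableSpace U] in
lemma message_eq (ℓ : Z → Vec d → ℝ) (b : ℝ) (C : Fin n → U → Vec d → Vec d)
    (D : Fin n → Fin m → Z) (st : State d n m) (r : Fin n → ClientNoise d m U) (i : Fin n) :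
    message ℓ b C D st r i
      = clientMessage ℓ b (C i) (D i) st.x (st.shift i) (st.table i) (r i) := rfl

include hC hℓ hm hb hbm hω hv in
lemma memLp_message (i : Fin n) :
    MemLp (fun r => message ℓ b C D st r i) 2 (roundLaw d n m (b / m) v ν) :=
  memLp_pi_eval (μ := fun i => clientLaw d m (b / m) v (ν i)) i
    (memLp_clientMessage (hC i) (D i) st.x (st.shift i) (st.table i) hℓ hm hb hbm hω hv)

include hC hℓ hm hb hbm hω hv in
lemma memLp_direction :
    MemLp (direction ℓ b C D st) 2 (roundLaw d n m (b / m) v ν) := by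
  have h1 : MemLp (fun r => ∑ i, message ℓ b C D st r i) 2 (roundLaw d n m (b / m) v ν) :=
    memLp_finsetSum _ fun i _ => memLp_message hC D st hℓ hm hb hbm hω hv i
  have h2 : MemLp (fun r => (1 / (n : ℝ)) • ∑ i, message ℓ b C D st r i) 2
    (roundLaw d n m (b / m) v ν) := h1.const_smul (1 / (n : ℝ))
  have h3 : MemLp (fun _ : Fin n → ClientNoise d m U => st.serverShift) 2
    (roundLaw d n m (b / m) v ν) := memLp_const _
  exact h3.add h2

include hC hℓ hm hb hbm hω hv in
lemma integral_message (i : Fin n) :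
    ∫ r, message ℓ b C D st r i ∂(roundLaw d n m (b / m) v ν)
      = ∇ (localLoss ℓ (D i)) st.x - st.shift i := by
  simp_rw [roundLaw_eq, message_eq]
  rw [integral_pi_eval (μ := fun i => clientLaw d m (b / m) v (ν i)) i
    (X := clientMessage ℓ b (C i) (D i) st.x (st.shift i) (st.table i))
    (measurable_clientMessage (hC i) _ _ _ _).aestronglyMeasurable]
  exact integral_clientMessage (hC i) (D i) st.x (st.shift i) (st.table i) hℓ hm hb hbm hω hv

include hC hst hℓ hm hb hbm hω hv in
-- The messages estimate `∇f_i - s_i`, and the server adds back the average of the `s_i`; the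
-- invariant `hst` makes the shifts cancel.
lemma integral_direction :
    ∫ r, direction ℓ b C D st r ∂(roundLaw d n m (b / m) v ν) = ∇ (globalLoss ℓ D) st.x := by
  have hi := fun i => (memLp_message (v := v) hC D st hℓ hm hb hbm hω hv i).integrable one_le_two
  have hi' : Integrable (fun r => (1 / (n : ℝ)) • ∑ i, message ℓ b C D st r i)
    (roundLaw d n m (b / m) v ν) := (integrable_finsetSum _ fun i _ => hi i).smul (1 / (n : ℝ))
  unfold direction
  rw [integral_add (integrable_const _) hi', integral_smul, integral_finsetSum _ fun i _ => hi i, gradient_globalLoss hℓ hm, hst]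
  simp_rw [integral_message hC D st hℓ hm hb hbm hω hv]
  rw [Finset.sum_sub_distrib, smul_sub]
  simp

include hC hℓ hm hb hbm hω hv in
lemma variance_message_le (i : Fin n) :
    ∫ r, ‖message ℓ b C D st r i - (∇ (localLoss ℓ (D i)) st.x - st.shift i)‖ ^ 2
        ∂(roundLaw d n m (b / m) v ν)
      ≤ (1 + ω) * (L ^ 2 / (b * m) * ∑ j, ‖st.x - st.table i j‖ ^ 2 + d * v)
          + ω * ‖∇ (localLoss ℓ (D i)) st.x - st.shift i‖ ^ 2 := by
  refine le_of_eq_of_le ?_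
    (variance_clientMessage_le (hC i) (D i) st.x (st.shift i) (st.table i) hℓ hm hb hbm hω hv)
  exact integral_pi_eval (μ := fun i => clientLaw d m (b / m) v (ν i)) i
    (X := fun w => ‖clientMessage ℓ b (C i) (D i) st.x (st.shift i) (st.table i) w
      - (∇ (localLoss ℓ (D i)) st.x - st.shift i)‖ ^ 2)
    (((measurable_clientMessage (hC i) _ _ _ _).sub_const _).norm.pow_const 2).aestronglyMeasurable

/-- The bound on the average variance of the messages of the clients. -/
noncomputable def varianceBound (ℓ : Z → Vec d → ℝ) (L b ω v : ℝ) (D : Fin n → Fin m → Z)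
    (st : State d n m) : ℝ :=
  (1 + ω) * (L ^ 2 / b * tableError st + d * v) + ω * shiftError ℓ D st

include hn in
lemma average_variance_message_le {V : Fin n → ℝ}
    (hV : ∀ i, V i ≤ (1 + ω) * (L ^ 2 / (b * m) * ∑ j, ‖st.x - st.table i j‖ ^ 2 + d * v)
          + ω * ‖∇ (localLoss ℓ (D i)) st.x - st.shift i‖ ^ 2) :
    1 / (n : ℝ) * ∑ i, V i ≤ varianceBound ℓ L b ω v D st := by
  have h := average_le (c := 1) (y := (1 + ω) * (d * v)) hn fun i =>
    (hV i).trans_eq (show _ = 1 * ((1 + ω) * (L ^ 2 / (b * m)) * ∑ j, ‖st.x - st.table i j‖ ^ 2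
      + ω * ‖∇ (localLoss ℓ (D i)) st.x - st.shift i‖ ^ 2) + (1 + ω) * (d * v) by ring)
  refine h.trans_eq ?_
  unfold varianceBound tableError shiftError
  rw [Finset.sum_add_distrib, ← Finset.mul_sum, ← Finset.mul_sum]
  rw [← div_div, ← one_div_mul_one_div]
  ring

include hC hst hℓ hn hm hb hbm hω hv in
-- Independence of the clients turns the variance of their average into `1/n` times the average
-- variance.
lemma variance_direction_le :
    ∫ r, ‖direction ℓ b C D st r - ∇ (globalLoss ℓ D) st.x‖ ^ 2 ∂(roundLaw d n m (b / m) v ν)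
      ≤ 1 / (n : ℝ) * varianceBound ℓ L b ω v D st := by
  have hn0 : (0 : ℝ) < n := by exact_mod_cast hn
  have hX := fun i => (memLp_clientMessage (v := v) (hC i) (D i) st.x (st.shift i) (st.table i) hℓ
    hm hb hbm hω hv)
  have hmean := fun i => integral_clientMessage (v := v) (hC i) (D i) st.x (st.shift i)
    (st.table i) hℓ hm hb hbm hω hv
  have h := integral_norm_sum_pi_sub_sq (μ := fun i => clientLaw d m (b / m) v (ν i))
    (X := fun i => clientMessage ℓ b (C i) (D i) st.x (st.shift i) (st.table i)) hX
  simp_rw [hmean] at h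
  have e : ∀ r, ‖direction ℓ b C D st r - ∇ (globalLoss ℓ D) st.x‖ ^ 2
      = (1 / (n : ℝ)) ^ 2 * ‖∑ i, clientMessage ℓ b (C i) (D i) st.x (st.shift i) (st.table i) (r i)
          - ∑ i, (∇ (localLoss ℓ (D i)) st.x - st.shift i)‖ ^ 2 := by
    intro r
    have : direction ℓ b C D st r - ∇ (globalLoss ℓ D) st.x = (1 / (n : ℝ)) •
        (∑ i, clientMessage ℓ b (C i) (D i) st.x (st.shift i) (st.table i) (r i)
          - ∑ i, (∇ (localLoss ℓ (D i)) st.x - st.shift i)) := by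
      unfold direction
      simp_rw [message_eq]
      rw [hst, gradient_globalLoss hℓ hm, Finset.sum_sub_distrib, smul_sub, smul_sub]
      abel
    rw [this, norm_smul, mul_pow, Real.norm_eq_abs, sq_abs]
  simp_rw [e]
  rw [integral_const_mul, roundLaw_eq, h, sq, mul_assoc]
  gcongr
  exact average_variance_message_le D st hn fun i =>
    variance_clientMessage_le (hC i) (D i) st.x (st.shift i) (st.table i) hℓ hm hb hbm hω hv

include hC hst hℓ hn hm hb hbm hω hv in
lemma integral_norm_direction_sq_le :
    ∫ r, ‖direction ℓ b C D st r‖ ^ 2 ∂(roundLaw d n m (b / m) v ν)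
      ≤ 1 / (n : ℝ) * varianceBound ℓ L b ω v D st + ‖∇ (globalLoss ℓ D) st.x‖ ^ 2 := by
  have h := integral_norm_sub_sq (memLp_direction (v := v) hC D st hℓ hm hb hbm hω hv) 0
  rw [integral_direction hC D st hst hℓ hm hb hbm hω hv] at h
  simp only [sub_zero] at h
  rw [h]
  gcongr
  exact variance_direction_le hC D st hst hℓ hn hm hb hbm hω hv

include hC hℓ hn hm hb hbm hω hv in
-- Bias–variance around the target: the mean of `γ • message` misses it by `(γ - 1)` times the
-- current error, and the variance scales with `γ²`.
lemma average_shift_update_le (γ : ℝ) :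
    1 / (n : ℝ) * ∑ i, ∫ r, ‖γ • message ℓ b C D st r i
          - (∇ (localLoss ℓ (D i)) st.x - st.shift i)‖ ^ 2 ∂(roundLaw d n m (b / m) v ν)
      ≤ γ ^ 2 * varianceBound ℓ L b ω v D st + (1 - γ) ^ 2 * shiftError ℓ D st := by
  have hi : ∀ i, ∫ r, ‖γ • message ℓ b C D st r i
        - (∇ (localLoss ℓ (D i)) st.x - st.shift i)‖ ^ 2 ∂(roundLaw d n m (b / m) v ν)
      = γ ^ 2 * (∫ r, ‖message ℓ b C D st r i
          - (∇ (localLoss ℓ (D i)) st.x - st.shift i)‖ ^ 2 ∂(roundLaw d n m (b / m) v ν))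
        + (1 - γ) ^ 2 * ‖∇ (localLoss ℓ (D i)) st.x - st.shift i‖ ^ 2 := by
    intro i
    have h := integral_norm_sub_sq ((memLp_message (v := v) hC D st hℓ hm hb hbm hω hv
      i).const_smul γ) (∇ (localLoss ℓ (D i)) st.x - st.shift i)
    simp only [Pi.smul_apply] at h
    rw [integral_smul, integral_message hC D st hℓ hm hb hbm hω hv] at h
    rw [h]
    set e := ∇ (localLoss ℓ (D i)) st.x - st.shift i
    simp_rw [← smul_sub, norm_smul, mul_pow, Real.norm_eq_abs, sq_abs]
    rw [integral_const_mul, show γ • e - e = (γ - 1) • e by module, norm_smul, mul_pow,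
      Real.norm_eq_abs, sq_abs]
    ring
  simp_rw [hi]
  rw [Finset.sum_add_distrib, ← Finset.mul_sum, ← Finset.mul_sum, mul_add, ← mul_assoc,
    mul_comm (1 / (n : ℝ)) (γ ^ 2), mul_assoc, ← mul_assoc (1 / (n : ℝ)),
    mul_comm (1 / (n : ℝ)) ((1 - γ) ^ 2), mul_assoc ((1 - γ) ^ 2)]
  unfold shiftError
  gcongr
  exact average_variance_message_le D st hn fun i =>
    variance_message_le hC D st hℓ hm hb hbm hω hv i

omit [∀ i, IsProbabilityMeasure (ν i)] in
lemma measurable_batch_indicator (i : Fin n) (j : Fin m) :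
    Measurable fun r : Fin n → ClientNoise d m U => if (r i).1 j = true then (0 : ℝ) else 1 :=
  Measurable.ite (measurableSet_bool_apply (β := fun r : Fin n → ClientNoise d m U => (r i).1)
    (measurable_fst.comp (measurable_pi_apply i)) j) measurable_const measurable_const

lemma integrable_batch_indicator (q : ℝ) (i : Fin n) (j : Fin m) :
    Integrable (fun r => if (r i).1 j = true then (0 : ℝ) else 1) (roundLaw d n m q v ν) :=
  Integrable.of_bound (measurable_batch_indicator i j).aestronglyMeasurable 1
    (ae_of_all _ fun r => by split_ifs <;> simp)

lemma integral_batch_indicator {q : ℝ} (hq0 : 0 ≤ q) (hq1 : q ≤ 1) (i : Fin n) (j : Fin m) :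
    ∫ r, (if (r i).1 j = true then (0 : ℝ) else 1) ∂(roundLaw d n m q v ν) = 1 - q := by
  have hj : ∫ β, (if β j = true then (0 : ℝ) else 1) ∂(batchLaw m q) = 1 - q := by
    unfold batchLaw
    rw [integral_pi_eval (μ := fun _ : Fin m => bernoulliMeasure true false
      (Set.projIcc (0 : ℝ) 1 zero_le_one q)) j (X := fun B => if B = true then (0 : ℝ) else 1) Integrable.of_finite.1,
      integral_bernoulli hq0 hq1]
    simp
  have hm1 : Measurable fun β : Fin m → Bool => if β j = true then (0 : ℝ) else 1 :=
    measurable_of_finite _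
  rw [← hj, roundLaw_eq, integral_pi_eval (μ := fun i => clientLaw d m q v (ν i)) i
    (X := fun c => if c.1 j = true then (0 : ℝ) else 1) (hm1.comp measurable_fst).aestronglyMeasurable]
  unfold clientLaw
  rw [integral_fun_fst (fun β : Fin m → Bool => if β j = true then (0 : ℝ) else 1)]
  simp

end RoundMoments


/-- The conditions on the weights `a` and `c` of the Lyapunov function under which it decreases in
expectation, up to the noise; `W` bounds the total weight of the squared update direction. -/
structure AdmissibleWeights (n : ℕ) (L b ω η γ q a c W : ℝ) : Prop where
  shift_nonneg : 0 ≤ a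
  table_nonneg : 0 ≤ c
  weight_nonneg : 0 ≤ W
  direction_le : L / 2 * η ^ 2 + a * (3 / γ * L ^ 2 * η ^ 2) + c * (3 / q * η ^ 2) ≤ W
  gradient_le : W ≤ 4 / 5 * η
  shift_le : W * (1 / n * ω) + a * ((1 + γ / 2) * (γ ^ 2 * ω + (1 - γ) ^ 2)) ≤ a
  table_le : W * (1 / n * ((1 + ω) * (L ^ 2 / b)))
    + a * ((1 + γ / 2) * (γ ^ 2 * ((1 + ω) * (L ^ 2 / b)))) + c * ((1 + q / 2) * (1 - q)) ≤ c

/-- The increase of the Lyapunov function in one round that is due to the perturbations. -/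
noncomputable def noiseIncrement (n d : ℕ) (ω v γ a W : ℝ) : ℝ :=
  W * (1 / n * ((1 + ω) * (d * v))) + a * ((1 + γ / 2) * (γ ^ 2 * ((1 + ω) * (d * v))))

/-! ### Expected descent of the Lyapunov function in one round -/

section OneRound

variable {d n m : ℕ} {Z U : Type*} [MeasurableSpace U] {ℓ : Z → Vec d → ℝ}
  {L b ω v η γ a c W f₀ : ℝ}
  {C : Fin n → U → Vec d → Vec d} {ν : Fin n → Measure U} [∀ i, IsProbabilityMeasure (ν i)]
  (hC : ∀ i, IsCompressor ω (ν i) (C i)) (D : Fin n → Fin m → Z) (st : State d n m)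
  (hst : st.serverShift = (1 / (n : ℝ)) • ∑ i, st.shift i)
  (hℓ : ∀ z, IsLSmooth L (ℓ z)) (hn : 1 ≤ n) (hm : 1 ≤ m) (hb : 0 < b) (hbm : b ≤ m) (hω : 0 ≤ ω)
  (hv : 0 ≤ v) (hγ : 0 < γ) (hγ1 : γ ≤ 1)
  (hW : AdmissibleWeights n L b ω η γ (b / m) a c W)
  (hf₀ : ∀ x, f₀ ≤ globalLoss ℓ D x)

omit [MeasurableSpace U] in
include hf₀ in
lemma potential_nonneg (ha : 0 ≤ a) (hc : 0 ≤ c) : 0 ≤ potential ℓ D f₀ a c st := by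
  have h1 := mul_nonneg ha (shiftError_nonneg ℓ D st)
  have h2 := mul_nonneg hc (tableError_nonneg st)
  have h3 := hf₀ st.x
  unfold potential
  linarith

/-- An upper bound on the Lyapunov function after a round, as a function of the randomness. -/
noncomputable def potentialBound (ℓ : Z → Vec d → ℝ) (L b η γ f₀ a c : ℝ)
    (C : Fin n → U → Vec d → Vec d) (D : Fin n → Fin m → Z) (st : State d n m)
    (r : Fin n → ClientNoise d m U) : ℝ :=
  globalLoss ℓ D st.x - f₀ - η * inner ℝ (∇ (globalLoss ℓ D) st.x) (direction ℓ b C D st r)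
    + (L / 2 * η ^ 2 + a * (3 / γ * L ^ 2 * η ^ 2) + c * (3 / (b / m) * η ^ 2))
      * ‖direction ℓ b C D st r‖ ^ 2
    + a * ((1 + γ / 2) * (1 / (n : ℝ) * ∑ i, ‖γ • message ℓ b C D st r i
          - (∇ (localLoss ℓ (D i)) st.x - st.shift i)‖ ^ 2))
    + c * ((1 + b / m / 2) * (1 / ((n : ℝ) * m) * ∑ i, ∑ j,
          (if (r i).1 j = true then 0 else 1) * ‖st.x - st.table i j‖ ^ 2))

omit [MeasurableSpace U] in
include hℓ hn hm hb hbm hγ hγ1 in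
lemma potential_round_le (ha : 0 ≤ a) (hc : 0 ≤ c) (r : Fin n → ClientNoise d m U) :
    potential ℓ D f₀ a c (round ℓ η γ b C D st r)
      ≤ potentialBound ℓ L b η γ f₀ a c C D st r := by
  have hm0 : (0 : ℝ) < m := by exact_mod_cast hm
  have h1 := globalLoss_round_le hℓ hn hm C D st r η γ b
  have h2 := mul_le_mul_of_nonneg_left (shiftError_round_le hℓ hn hm C D st r η b hγ hγ1) ha
  have h3 := mul_le_mul_of_nonneg_left (tableError_round_le hn hm C D st r (ℓ := ℓ) η γ b
    (show 0 < b / m by positivity) ((div_le_one hm0).mpr hbm)) hc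
  unfold potential potentialBound
  linarith

include hC hst hℓ hn hm hb hbm hω hv hγ hW in
lemma integral_potentialBound_le :
    Integrable (potentialBound ℓ L b η γ f₀ a c C D st) (roundLaw d n m (b / m) v ν) ∧
      ∫ r, potentialBound ℓ L b η γ f₀ a c C D st r ∂(roundLaw d n m (b / m) v ν)
        + η / 5 * ‖∇ (globalLoss ℓ D) st.x‖ ^ 2
      ≤ potential ℓ D f₀ a c st + noiseIncrement n d ω v γ a W := by
  have hn0 : (0 : ℝ) < n := by exact_mod_cast hn
  have hm0 : (0 : ℝ) < m := by exact_mod_cast hm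
  set κ := roundLaw d n m (b / m) v ν with hκ
  set g := ∇ (globalLoss ℓ D) st.x with hg
  set c₂ := L / 2 * η ^ 2 + a * (3 / γ * L ^ 2 * η ^ 2) + c * (3 / (b / m) * η ^ 2) with hc₂
  have hdir := memLp_direction (v := v) hC D st hℓ hm hb hbm hω hv
  have i1 : Integrable (fun r => η * inner ℝ g (direction ℓ b C D st r)) κ :=
    ((hdir.integrable one_le_two).const_inner g).const_mul η
  have i2 : Integrable (fun r => c₂ * ‖direction ℓ b C D st r‖ ^ 2) κ :=
    (hdir.integrable_norm_pow two_ne_zero).const_mul c₂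
  have i3i : ∀ i, Integrable (fun r => ‖γ • message ℓ b C D st r i
      - (∇ (localLoss ℓ (D i)) st.x - st.shift i)‖ ^ 2) κ := fun i =>
    (((memLp_message (v := v) hC D st hℓ hm hb hbm hω hv i).const_smul γ).sub
      (memLp_const _)).integrable_norm_pow two_ne_zero
  have i3 : Integrable (fun r => a * ((1 + γ / 2) * (1 / (n : ℝ) * ∑ i, ‖γ • message ℓ b C D st r i
      - (∇ (localLoss ℓ (D i)) st.x - st.shift i)‖ ^ 2))) κ :=
    (((integrable_finsetSum _ fun i _ => i3i i).const_mul _).const_mul _).const_mul _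
  have i4ij : ∀ i j, Integrable (fun r : Fin n → ClientNoise d m U =>
      (if (r i).1 j = true then (0 : ℝ) else 1) * ‖st.x - st.table i j‖ ^ 2) κ := fun i j =>
    (integrable_batch_indicator (b / m) i j).mul_const _
  have i4 : Integrable (fun r : Fin n → ClientNoise d m U => c * ((1 + b / m / 2) *
      (1 / ((n : ℝ) * m) * ∑ i, ∑ j,
        (if (r i).1 j = true then 0 else 1) * ‖st.x - st.table i j‖ ^ 2))) κ :=
    (((integrable_finsetSum _ fun i _ => integrable_finsetSum _ fun j _ =>
      i4ij i j).const_mul _).const_mul _).const_mul _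
  have i0 : Integrable (fun _ : Fin n → ClientNoise d m U => globalLoss ℓ D st.x - f₀) κ :=
    integrable_const _
  have i01 : Integrable (fun r => globalLoss ℓ D st.x - f₀
    - η * inner ℝ g (direction ℓ b C D st r)) κ := i0.sub i1
  have i012 : Integrable (fun r => globalLoss ℓ D st.x - f₀
    - η * inner ℝ g (direction ℓ b C D st r) + c₂ * ‖direction ℓ b C D st r‖ ^ 2) κ := i01.add i2
  have i0123 : Integrable (fun r => globalLoss ℓ D st.x - f₀
    - η * inner ℝ g (direction ℓ b C D st r) + c₂ * ‖direction ℓ b C D st r‖ ^ 2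
    + a * ((1 + γ / 2) * (1 / (n : ℝ) * ∑ i, ‖γ • message ℓ b C D st r i
      - (∇ (localLoss ℓ (D i)) st.x - st.shift i)‖ ^ 2))) κ := i012.add i3
  refine ⟨i0123.add i4, ?_⟩
  unfold potentialBound
  rw [← hg, ← hc₂, integral_add i0123 i4, integral_add i012 i3, integral_add i01 i2,
    integral_sub i0 i1, integral_const_mul, integral_const_mul, integral_const_mul,
    integral_const_mul, integral_const_mul, integral_const_mul, integral_const_mul,
    integral_const_mul, integral_inner (hdir.integrable one_le_two), integral_const,
    probReal_univ, one_smul,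
    integral_direction hC D st hst hℓ hm hb hbm hω hv, ← hg, real_inner_self_eq_norm_sq,
    integral_finsetSum _ fun i _ => i3i i,
    integral_finsetSum _ fun i _ => integrable_finsetSum _ fun j _ => i4ij i j]
  have e4 : 1 / ((n : ℝ) * m) * ∑ i, ∫ r : Fin n → ClientNoise d m U, ∑ j,
      (if (r i).1 j = true then (0 : ℝ) else 1) * ‖st.x - st.table i j‖ ^ 2 ∂κ
      = (1 - b / m) * tableError st := by
    unfold tableError
    rw [mul_left_comm]
    congr 1
    rw [Finset.mul_sum]
    refine Finset.sum_congr rfl fun i _ => ?_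
    rw [integral_finsetSum _ fun j _ => i4ij i j, Finset.mul_sum]
    refine Finset.sum_congr rfl fun j _ => ?_
    rw [integral_mul_const, hκ,
      integral_batch_indicator (by positivity) ((div_le_one hm0).mpr hbm) i j]
  rw [e4]
  have hΨ := tableError_nonneg st
  have hS := shiftError_nonneg ℓ D st
  have ha := hW.shift_nonneg
  have h2 := integral_norm_direction_sq_le (v := v) hC D st hst hℓ hn hm hb hbm hω hv
  have h3 := average_shift_update_le (v := v) hC D st hℓ hn hm hb hbm hω hv γ
  have hVb : 0 ≤ varianceBound ℓ L b ω v D st := by unfold varianceBound; positivity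
  have hV0 : 0 ≤ 1 / (n : ℝ) * varianceBound ℓ L b ω v D st + ‖g‖ ^ 2 := by positivity
  -- The squared mean of the direction costs at most `4η/5 ‖g‖²` of the linear gain `η ‖g‖²`, which
  -- leaves `η/5`.
  have h2' : c₂ * ∫ r, ‖direction ℓ b C D st r‖ ^ 2 ∂κ
      ≤ W * (1 / (n : ℝ) * varianceBound ℓ L b ω v D st) + 4 / 5 * η * ‖g‖ ^ 2 := by
    have hi0 : 0 ≤ ∫ r, ‖direction ℓ b C D st r‖ ^ 2 ∂κ :=
      integral_nonneg fun r => by positivity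
    have hW0 := hW.weight_nonneg
    calc _ ≤ W * ∫ r, ‖direction ℓ b C D st r‖ ^ 2 ∂κ := by gcongr; exact hW.direction_le
      _ ≤ W * (1 / (n : ℝ) * varianceBound ℓ L b ω v D st + ‖g‖ ^ 2) := by gcongr
      _ = W * (1 / (n : ℝ) * varianceBound ℓ L b ω v D st) + W * ‖g‖ ^ 2 := by ring
      _ ≤ _ := by gcongr; exact hW.gradient_le
  have h3' := mul_le_mul_of_nonneg_left (mul_le_mul_of_nonneg_left h3
    (show 0 ≤ 1 + γ / 2 by positivity)) ha
  have h5 := mul_le_mul_of_nonneg_right hW.shift_le hS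
  have h6 := mul_le_mul_of_nonneg_right hW.table_le hΨ
  unfold potential noiseIncrement
  unfold varianceBound at h2' h3'
  linarith

include hC hst hℓ hn hm hb hbm hω hv hγ hγ1 hW hf₀ in
lemma lintegral_potential_round_le (hη : 0 ≤ η) :
    ∫⁻ r, ENNReal.ofReal (potential ℓ D f₀ a c (round ℓ η γ b C D st r))
        ∂(roundLaw d n m (b / m) v ν)
      + ENNReal.ofReal (η / 5 * ‖∇ (globalLoss ℓ D) st.x‖ ^ 2)
      ≤ ENNReal.ofReal (potential ℓ D f₀ a c st)
        + ENNReal.ofReal (noiseIncrement n d ω v γ a W) := by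
  obtain ⟨hi, hle⟩ := integral_potentialBound_le (f₀ := f₀) hC D st hst hℓ hn hm hb hbm hω hv hγ
    hW
  have hp := fun r => potential_round_le (η := η) (f₀ := f₀) (C := C) D st hℓ hn hm hb hbm hγ hγ1
    hW.shift_nonneg hW.table_nonneg r
  have h0 : ∀ r, 0 ≤ potentialBound ℓ L b η γ f₀ a c C D st r := fun r =>
    (potential_nonneg D _ hf₀ hW.shift_nonneg hW.table_nonneg).trans (hp r)
  calc _ ≤ ∫⁻ r, ENNReal.ofReal (potentialBound ℓ L b η γ f₀ a c C D st r)
        ∂(roundLaw d n m (b / m) v ν)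
      + ENNReal.ofReal (η / 5 * ‖∇ (globalLoss ℓ D) st.x‖ ^ 2) := by
        gcongr with r
        exact hp r
    _ ≤ ENNReal.ofReal (potential ℓ D f₀ a c st + noiseIncrement n d ω v γ a W) := by
        rw [← ofReal_integral_eq_lintegral_ofReal hi (ae_of_all _ h0),
          ← ENNReal.ofReal_add (integral_nonneg h0) (by positivity)]
        exact ENNReal.ofReal_le_ofReal hle
    _ ≤ _ := ENNReal.ofReal_add_le

end OneRound

/-! ### Telescoping along the run -/

section Trajectory

variable {d n m : ℕ} {Z U : Type*} [MeasurableSpace U] {ℓ : Z → Vec d → ℝ}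
  {L b ω v η γ a c W f₀ G : ℝ}
  {C : ℕ → Fin n → U → Vec d → Vec d} {ν : ℕ → Fin n → Measure U}
  [∀ t i, IsProbabilityMeasure (ν t i)]
  (hC : ∀ t i, IsCompressor ω (ν t i) (C t i)) (D : Fin n → Fin m → Z) (x₀ : Vec d)
  (hℓ : ∀ z, IsLSmooth L (ℓ z)) (hℓG : ∀ z, HasBoundedGradient G (ℓ z))
  (hn : 1 ≤ n) (hm : 1 ≤ m) (hb : 0 < b) (hbm : b ≤ m) (hω : 0 ≤ ω)
  (hv : 0 ≤ v) (hη : 0 ≤ η) (hγ : 0 < γ) (hγ1 : γ ≤ 1)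
  (hW : AdmissibleWeights n L b ω η γ (b / m) a c W)
  (hf₀ : ∀ x, f₀ ≤ globalLoss ℓ D x)

omit [MeasurableSpace U] in
lemma serverShift_run (ℓ : Z → Vec d → ℝ) (η γ b : ℝ) (C : ℕ → Fin n → U → Vec d → Vec d)
    (r : Noise d n m U) (t : ℕ) :
    (run ℓ η γ b C x₀ D r t).serverShift
      = (1 / (n : ℝ)) • ∑ i, (run ℓ η γ b C x₀ D r t).shift i := by
  induction t with
  | zero => simp [run, initState]
  | succ t ih =>
    simp only [run, round]
    rw [ih, Finset.sum_add_distrib, smul_add, ← Finset.smul_sum, smul_comm γ]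

include hC hℓ hℓG hn hm in
lemma integrable_gradient_run (q v : ℝ) (t : ℕ) :
    Integrable (fun r => ‖∇ (globalLoss ℓ D) (run ℓ η γ b C x₀ D r t).x‖ ^ 2)
      (noiseLaw d n m q v ν) := by
  have hmeas : Measurable fun r => ‖∇ (globalLoss ℓ D) (run ℓ η γ b C x₀ D r t).x‖ ^ 2 :=
    (((isLSmooth_globalLoss hℓ hn hm D).continuous_gradient.measurable.comp
      (measurable_state_x.comp (measurable_run ℓ η γ b C
        (fun z => (hℓ z).continuous_gradient.measurable) (fun t i => (hC t i).measurable)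
        x₀ D t))).norm.pow_const 2)
  refine Integrable.of_bound hmeas.aestronglyMeasurable (G ^ 2) (ae_of_all _ fun r => ?_)
  have hG : HasBoundedGradient G (globalLoss ℓ D) :=
    HasBoundedGradient.average hn (fun i => (isLSmooth_localLoss hℓ hm (D i)).1) fun i =>
      HasBoundedGradient.average hm (fun j => (hℓ (D i j)).1) fun j => hℓG (D i j)
  rw [Real.norm_of_nonneg (by positivity)]
  gcongr
  exact hG _

include hℓ hn hm in
omit [MeasurableSpace U] in
lemma measurable_potential : Measurable (potential ℓ D f₀ a c) := by
  have hx := measurable_state_x (d := d) (n := n) (m := m)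
  have hg := fun i => (isLSmooth_localLoss hℓ hm (D i)).continuous_gradient.measurable
  have h1 : Measurable (shiftError ℓ D) :=
    (Finset.measurable_sum _ fun i _ => ((((hg i).comp hx).sub
      ((measurable_pi_apply i).comp measurable_state_shift)).norm.pow_const 2)).const_mul _
  have h2 : Measurable (tableError (d := d) (n := n) (m := m)) :=
    (Finset.measurable_sum _ fun i _ => Finset.measurable_sum _ fun j _ =>
      ((hx.sub ((measurable_pi_apply j).comp
        ((measurable_pi_apply i).comp measurable_state_table))).norm.pow_const 2)).const_mul _
  exact ((((isLSmooth_globalLoss hℓ hn hm D).1.continuous.measurable.comp hx).sub_const f₀).add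
    (h1.const_mul a)).add (h2.const_mul c)

include hC hℓ hℓG hn hm hb hbm hω hv hη hγ hγ1 hW hf₀ in
/-- The telescoped descent of the Lyapunov function. -/
lemma sum_integral_gradient_run_le (hN : 0 ≤ noiseIncrement n d ω v γ a W) (T : ℕ) :
    η / 5 * ∑ t ∈ Finset.range T,
        ∫ r, ‖∇ (globalLoss ℓ D) (run ℓ η γ b C x₀ D r t).x‖ ^ 2 ∂(noiseLaw d n m (b / m) v ν)
      ≤ potential ℓ D f₀ a c (initState n m x₀) + T * noiseIncrement n d ω v γ a W := by
  set P := noiseLaw d n m (b / m) v ν with hP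
  set N := noiseIncrement n d ω v γ a W
  -- Telescoping with lower integrals of the nonnegative potential avoids proving its integrability
  -- along the run. The gradient terms are integrable because they are bounded.
  set E : ℕ → ℝ≥0∞ := fun t =>
    ∫⁻ r, ENNReal.ofReal (potential ℓ D f₀ a c (run ℓ η γ b C x₀ D r t)) ∂P
  set I : ℕ → ℝ := fun t => ∫ r, ‖∇ (globalLoss ℓ D) (run ℓ η γ b C x₀ D r t).x‖ ^ 2 ∂P
  have hI : ∀ t, 0 ≤ I t := fun t => integral_nonneg fun r => by positivity
  have hℓm : ∀ z, Measurable (∇ (ℓ z)) := fun z => (hℓ z).continuous_gradient.measurable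
  have hCm : ∀ t i, Measurable (Function.uncurry (C t i)) := fun t i => (hC t i).measurable
  have hrun := fun t => measurable_run ℓ η γ b C hℓm hCm x₀ D t
  have hpm := measurable_potential (f₀ := f₀) (a := a) (c := c) D hℓ hn hm
  have hstep : ∀ t, E (t + 1) + ENNReal.ofReal (η / 5 * I t) ≤ E t + ENNReal.ofReal N := by
    intro t
    have hgi := (integrable_gradient_run (η := η) (γ := γ) (b := b) hC D x₀ hℓ hℓG hn hm (b / m) v
      t).const_mul (η / 5)
    have e1 : ENNReal.ofReal (η / 5 * I t) = ∫⁻ r, ENNReal.ofReal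
        (η / 5 * ‖∇ (globalLoss ℓ D) (run ℓ η γ b C x₀ D r t).x‖ ^ 2) ∂P := by
      rw [← ofReal_integral_eq_lintegral_ofReal hgi (ae_of_all _ fun r => by positivity),
        integral_const_mul]
    have e2 : E (t + 1) = ∫⁻ r, ∫⁻ ρ, ENNReal.ofReal (potential ℓ D f₀ a c
        (round ℓ η γ b (C t) D (run ℓ η γ b C x₀ D r t) ρ)) ∂(roundLaw d n m (b / m) v (ν t))
        ∂P := by
      exact lintegral_noiseLaw_past (b / m) v ν t (hrun t)
        (fun r y => run_update ℓ η γ b C x₀ D r le_rfl y)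
        (F := fun st ρ => ENNReal.ofReal (potential ℓ D f₀ a c (round ℓ η γ b (C t) D st ρ)))
        (hpm.comp (measurable_round hℓm (hCm t) η γ b D measurable_fst
          measurable_snd)).ennreal_ofReal
    have hmE : Measurable fun r =>
        ENNReal.ofReal (potential ℓ D f₀ a c (run ℓ η γ b C x₀ D r t)) :=
      (hpm.comp (hrun t)).ennreal_ofReal
    have hmI : Measurable fun r => ENNReal.ofReal
        (η / 5 * ‖∇ (globalLoss ℓ D) (run ℓ η γ b C x₀ D r t).x‖ ^ 2) :=
      ((((isLSmooth_globalLoss hℓ hn hm D).continuous_gradient.measurable.comp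
        (measurable_state_x.comp (hrun t))).norm.pow_const 2).const_mul (η / 5)).ennreal_ofReal
    rw [e1, e2, ← lintegral_add_right _ hmI]
    calc _ ≤ ∫⁻ r, (ENNReal.ofReal (potential ℓ D f₀ a c (run ℓ η γ b C x₀ D r t))
          + ENNReal.ofReal N) ∂P := lintegral_mono fun r =>
            lintegral_potential_round_le (hC t) D _ (serverShift_run D x₀ ℓ η γ b C r t) hℓ hn hm hb
              hbm hω hv hγ hγ1 hW hf₀ hη
      _ = _ := by
        rw [lintegral_add_left hmE, lintegral_const, measure_univ, mul_one]
  have htel : ∀ t, E t + ENNReal.ofReal (η / 5 * ∑ s ∈ Finset.range t, I s)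
      ≤ ENNReal.ofReal (potential ℓ D f₀ a c (initState n m x₀)) + ENNReal.ofReal (t * N) := by
    intro t
    induction t with
    | zero => simp [E, run]
    | succ t ih =>
      have hs : 0 ≤ ∑ s ∈ Finset.range t, I s := Finset.sum_nonneg fun s _ => hI s
      rw [Finset.sum_range_succ, mul_add, ENNReal.ofReal_add (mul_nonneg (by positivity) hs)
        (mul_nonneg (by positivity) (hI t)), add_comm (ENNReal.ofReal (η / 5 * _)), ← add_assoc]
      calc _ ≤ E t + ENNReal.ofReal N + ENNReal.ofReal (η / 5 * ∑ s ∈ Finset.range t, I s) := by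
            exact add_le_add (hstep t) le_rfl
        _ = E t + ENNReal.ofReal (η / 5 * ∑ s ∈ Finset.range t, I s) + ENNReal.ofReal N := by ring
        _ ≤ _ := by
            refine (add_le_add_left ih _).trans_eq ?_
            rw [add_assoc, ← ENNReal.ofReal_add (by positivity) hN]
            congr 2
            push_cast
            ring
  have hp0 := potential_nonneg (f₀ := f₀) (a := a) (c := c) D (initState n m x₀) hf₀
    hW.shift_nonneg hW.table_nonneg
  have h := le_add_self.trans (htel T)
  rw [← ENNReal.ofReal_add hp0 (by positivity)] at h
  exact (ENNReal.ofReal_le_ofReal_iff (by positivity)).mp h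

end Trajectory


/-! ### Choice of stepsizes, weights and number of rounds -/

section Parameters

lemma batchSize_pos {m : ℕ} (hm : 1 ≤ m) : 0 < batchSize m := by
  have hm0 : (0 : ℝ) < m := by exact_mod_cast hm
  unfold batchSize; positivity

/-- The feedback of the direction through the SAGA points is proportional to `1/(b q²)`. The batch
size of order `m^(2/3)` makes this independent of `m`. -/
lemma batchSize_mul_sq {m : ℕ} (hm : 1 ≤ m) : batchSize m * (batchSize m / m) ^ 2 = 27 := by
  have hm0 : (0 : ℝ) < m := by exact_mod_cast hm
  have h : ((m : ℝ) ^ (2 / 3 : ℝ)) ^ 3 = (m : ℝ) ^ 2 := by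
    rw [← Real.rpow_natCast, ← Real.rpow_mul hm0.le, ← Real.rpow_natCast]
    norm_num
  unfold batchSize
  field_simp
  linear_combination 27 * h

variable {n : ℕ} {ω L η : ℝ}

lemma shiftStepsize_sq (hω : 0 ≤ ω) :
    shiftStepsize ω ^ 2 = (1 + 2 * ω) / (2 * (1 + ω) ^ 3) :=
  Real.sq_sqrt (by positivity)

lemma shiftStepsize_pos (hω : 0 ≤ ω) : 0 < shiftStepsize ω := Real.sqrt_pos.mpr (by positivity)

lemma shiftStepsize_mul_le_one (hω : 0 ≤ ω) : shiftStepsize ω * (1 + ω) ≤ 1 := by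
  rw [← sq_le_one_iff₀ (mul_nonneg (shiftStepsize_pos hω).le (by positivity)), mul_pow,
    shiftStepsize_sq hω, div_mul_eq_mul_div, div_le_one (by positivity)]
  nlinarith [pow_pos (show 0 < 1 + ω by positivity) 2]

lemma two_thirds_le_shiftStepsize_mul (hω : 0 ≤ ω) : 2 / 3 ≤ shiftStepsize ω * (1 + ω) := by
  refine le_of_sq_le_sq ?_ (mul_nonneg (shiftStepsize_pos hω).le (by positivity))
  rw [mul_pow, shiftStepsize_sq hω, div_mul_eq_mul_div, le_div_iff₀ (by positivity)]
  nlinarith [pow_pos (show 0 < 1 + ω by positivity) 2]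

lemma shiftStepsize_le_one (hω : 0 ≤ ω) : shiftStepsize ω ≤ 1 := by
  nlinarith [shiftStepsize_mul_le_one hω, mul_nonneg (shiftStepsize_pos hω).le hω]

lemma sq_mul_stepsize_le (hω : 0 ≤ ω) (hL : 0 < L) (hη : 0 < η)
    (hηm : η ≤ maxStepsize n ω L) : 9 * (L * η) ^ 2 ≤ min 1 (n / (1 + ω) ^ 3) := by
  unfold maxStepsize at hηm
  rw [le_div_iff₀ (by positivity)] at hηm
  have h1 := hηm.trans (min_le_left _ _)
  have h2 := hηm.trans (min_le_right _ _)
  have h0 : 0 ≤ η * (3 * L) := by positivity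
  refine le_min ?_ ?_
  · nlinarith
  · have := pow_le_pow_left₀ h0 h2 2
    rw [Real.sq_sqrt (by positivity)] at this
    linarith

lemma mul_stepsize_le (hL : 0 < L) (hηm : η ≤ maxStepsize n ω L) : 3 * (L * η) ≤ 1 := by
  unfold maxStepsize at hηm
  rw [le_div_iff₀ (by positivity)] at hηm
  linarith [hηm.trans (min_le_left _ _)]

/-- The weight of the squared update direction. -/
noncomputable def directionWeight (L η : ℝ) : ℝ := 12 / 5 * L * η ^ 2

/-- The weight of the shift error in the Lyapunov function. -/
noncomputable def shiftWeight (n : ℕ) (ω L η : ℝ) : ℝ :=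
  2 * directionWeight L η * ω / (n * shiftStepsize ω)

/-- The weight of the table error in the Lyapunov function. -/
noncomputable def tableWeight (n m : ℕ) (ω L η : ℝ) : ℝ :=
  8 * directionWeight L η * ((1 + ω) * (L ^ 2 / batchSize m)) / (n * (batchSize m / m))

/-- The variance enters the shifts with the factor `(2 + γ) γω ≤ 3`, by `γ(1 + ω) ≤ 1`. Together
with the direct contribution to the direction, each variance term `y` is therefore counted at most
four times. -/
lemma shiftWeight_mul_le (hn : 1 ≤ n) (hω : 0 ≤ ω) (hL : 0 < L) (hη : 0 < η) {y : ℝ}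
    (hy : 0 ≤ y) :
    shiftWeight n ω L η * ((1 + shiftStepsize ω / 2) * (shiftStepsize ω ^ 2 * y))
      ≤ 3 * directionWeight L η * (1 / n * y) := by
  have hn0 : (0 : ℝ) < n := by exact_mod_cast hn
  have hγ := shiftStepsize_pos hω
  have hγ1 := shiftStepsize_le_one hω
  have hg := shiftStepsize_mul_le_one hω
  have hW : 0 < directionWeight L η := by unfold directionWeight; positivity
  unfold shiftWeight
  set γ := shiftStepsize ω
  set W := directionWeight L η
  have e : 2 * W * ω / (n * γ) * ((1 + γ / 2) * (γ ^ 2 * y))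
      = (2 + γ) * (γ * ω) * (W * (1 / n * y)) := by
    field_simp
  have h : (2 + γ) * (γ * ω) ≤ 3 * 1 := by
    gcongr
    · linarith
    · nlinarith
  rw [e]
  calc _ ≤ 3 * 1 * (W * (1 / n * y)) := by gcongr
    _ = _ := by ring

lemma admissibleWeights {m : ℕ} (hn : 1 ≤ n) (hm : 1 ≤ m) (hbm : batchSize m ≤ m) (hω : 0 ≤ ω)
    (hL : 0 < L) (hη : 0 < η) (hηm : η ≤ maxStepsize n ω L) :
    AdmissibleWeights n L (batchSize m) ω η (shiftStepsize ω) (batchSize m / m)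
      (shiftWeight n ω L η) (tableWeight n m ω L η) (directionWeight L η) := by
  have hn0 : (0 : ℝ) < n := by exact_mod_cast hn
  have hm0 : (0 : ℝ) < m := by exact_mod_cast hm
  have hγ := shiftStepsize_pos hω
  have hγ1 := shiftStepsize_le_one hω
  have hg := shiftStepsize_mul_le_one hω
  have hγsq := shiftStepsize_sq hω
  have hb := batchSize_pos hm
  have hbq := batchSize_mul_sq hm
  have hW : 0 < directionWeight L η := by unfold directionWeight; positivity
  have hq : 0 < batchSize m / m := by positivity
  have hq1 : batchSize m / m ≤ 1 := (div_le_one hm0).mpr hbm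
  have hh := (sq_mul_stepsize_le hω hL hη hηm).trans (min_le_right _ _)
  rw [le_div_iff₀ (by positivity)] at hh
  have hΩ : 1 ≤ 1 + ω := by linarith
  have ha : 0 ≤ shiftWeight n ω L η := by unfold shiftWeight; positivity
  have hc : 0 ≤ tableWeight n m ω L η := by unfold tableWeight; positivity
  refine ⟨ha, hc, hW.le, ?_, ?_, ?_, ?_⟩
  · have h1 : shiftWeight n ω L η * (3 / shiftStepsize ω * L ^ 2 * η ^ 2)
        ≤ 2 / 3 * directionWeight L η := by
      have e : shiftWeight n ω L η * (3 / shiftStepsize ω * L ^ 2 * η ^ 2)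
          = 6 * directionWeight L η * (ω * (L * η) ^ 2) / (n * shiftStepsize ω ^ 2) := by
        unfold shiftWeight
        field_simp
        ring
      rw [e, hγsq, div_le_iff₀ (by positivity)]
      have e2 : 2 / 3 * directionWeight L η * (n * ((1 + 2 * ω) / (2 * (1 + ω) ^ 3)))
          = directionWeight L η * ((n * (1 + 2 * ω)) / (3 * (1 + ω) ^ 3)) := by
        field_simp
      rw [e2, mul_comm 6, mul_assoc]
      refine mul_le_mul_of_nonneg_left ?_ hW.le
      rw [le_div_iff₀ (by positivity)]
      nlinarith [mul_le_mul_of_nonneg_right hh hω]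
    have h2 : tableWeight n m ω L η * (3 / (batchSize m / m) * η ^ 2)
        ≤ 1 / 10 * directionWeight L η := by
      have e : tableWeight n m ω L η * (3 / (batchSize m / m) * η ^ 2)
          = 24 * directionWeight L η * ((1 + ω) * (L * η) ^ 2)
            / (n * (batchSize m * (batchSize m / m) ^ 2)) := by
        unfold tableWeight
        field_simp
        ring
      rw [e, hbq, div_le_iff₀ (by positivity)]
      have h3 : (1 + ω) * (L * η) ^ 2 ≤ (1 + ω) ^ 3 * (L * η) ^ 2 := by
        gcongr
        exact le_self_pow₀ hΩ (by norm_num)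
      nlinarith
    have h3 : L / 2 * η ^ 2 = 5 / 24 * directionWeight L η := by unfold directionWeight; ring
    linarith
  · have := mul_stepsize_le hL hηm
    unfold directionWeight
    nlinarith
  · have h1 : (1 + shiftStepsize ω / 2) * (shiftStepsize ω ^ 2 * ω + (1 - shiftStepsize ω) ^ 2)
        ≤ 1 - shiftStepsize ω / 2 := by
      have h2 : shiftStepsize ω ^ 2 * ω + (1 - shiftStepsize ω) ^ 2 ≤ 1 - shiftStepsize ω := by
        nlinarith
      nlinarith
    have h2 : shiftWeight n ω L η * (shiftStepsize ω / 2) = directionWeight L η * (1 / n * ω) := by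
      unfold shiftWeight
      field_simp
    nlinarith [mul_le_mul_of_nonneg_left h1 ha]
  · have h1 := shiftWeight_mul_le hn hω hL hη
      (show 0 ≤ (1 + ω) * (L ^ 2 / batchSize m) by positivity)
    -- The gain `q/2` of the table error pays for the estimator variance four times: once in the
    -- direction and three times through the shifts.
    have h2 : tableWeight n m ω L η * (batchSize m / m / 2)
        = 4 * directionWeight L η * (1 / n * ((1 + ω) * (L ^ 2 / batchSize m))) := by
      unfold tableWeight
      field_simp
      ring
    have h3 : (1 + batchSize m / m / 2) * (1 - batchSize m / m) ≤ 1 - batchSize m / m / 2 := by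
      nlinarith
    nlinarith [mul_le_mul_of_nonneg_left h3 hc]

lemma noiseIncrement_nonneg_and_le {d : ℕ} {v : ℝ} (hn : 1 ≤ n) (hω : 0 ≤ ω) (hL : 0 < L)
    (hη : 0 < η) (hv : 0 ≤ v) :
    0 ≤ noiseIncrement n d ω v (shiftStepsize ω) (shiftWeight n ω L η) (directionWeight L η) ∧
      noiseIncrement n d ω v (shiftStepsize ω) (shiftWeight n ω L η) (directionWeight L η)
        ≤ 48 / 5 * (L * η ^ 2 * ((1 + ω) * (d * v)) / n) := by
  have hγ := shiftStepsize_pos hω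
  have hW : 0 < directionWeight L η := by unfold directionWeight; positivity
  have h1 := shiftWeight_mul_le hn hω hL hη (show 0 ≤ (1 + ω) * (d * v) by positivity)
  constructor
  · unfold noiseIncrement shiftWeight; positivity
  · unfold noiseIncrement
    have e : 48 / 5 * (L * η ^ 2 * ((1 + ω) * (d * v)) / n)
        = 4 * directionWeight L η * (1 / n * ((1 + ω) * (d * v))) := by
      unfold directionWeight; ring
    rw [e]
    linarith

lemma shiftWeight_le_betaParam (hn : 1 ≤ n) (hω : 0 ≤ ω) (hL : 0 < L) (hη : 0 < η)
    (hηm : η ≤ maxStepsize n ω L) : shiftWeight n ω L η ≤ 12 / 5 * (betaParam n ω / L) := by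
  have hn0 : (0 : ℝ) < n := by exact_mod_cast hn
  have hγ := shiftStepsize_pos hω
  have hg := two_thirds_le_shiftStepsize_mul hω
  have hh := sq_mul_stepsize_le hω hL hη hηm
  unfold shiftWeight betaParam directionWeight
  set μ := min 1 ((n : ℝ) / (1 + ω) ^ 3)
  set γ := shiftStepsize ω
  have e1 : 2 * (12 / 5 * L * η ^ 2) * ω / (n * γ)
      = (24 / 5 * (L * η) ^ 2 * ω) / (n * γ * L) := by field_simp; ring
  have e2 : 12 / 5 * ((1 + ω) ^ 2 * μ / (3 * n) / L)
      = 4 / 5 * (1 + ω) ^ 2 * μ * γ / (n * γ * L) := by field_simp; ring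
  rw [e1, e2]
  refine div_le_div_of_nonneg_right ?_ (by positivity)
  have h1 : (L * η) ^ 2 * ω ≤ μ / 9 * (1 + ω) := by
    gcongr <;> linarith
  have hμ : 0 ≤ μ := by positivity
  nlinarith [mul_le_mul_of_nonneg_left hg (mul_nonneg hμ (show 0 ≤ 1 + ω by linarith))]

lemma potential_init_le {d m : ℕ} {Z : Type*} {ℓ : Z → Vec d → ℝ} {D : Fin n → Fin m → Z}
    (hn : 1 ≤ n) (hω : 0 ≤ ω) (hL : 0 < L) (hη : 0 < η) (hηm : η ≤ maxStepsize n ω L)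
    (hD : BddBelow (Set.range (globalLoss ℓ D))) (x₀ : Vec d) (c : ℝ) :
    potential ℓ D (⨅ x, globalLoss ℓ D x) (shiftWeight n ω L η) c (initState n m x₀)
      ≤ 12 / 5 * initialPotential ℓ L ω D x₀ := by
  have hn0 : (0 : ℝ) < n := by exact_mod_cast hn
  have hS : shiftError ℓ D (initState n m x₀)
      = 1 / n * ∑ i, ‖∇ (localLoss ℓ (D i)) x₀‖ ^ 2 := by simp [shiftError, initState]
  have hT : tableError (initState n m x₀) = 0 := by simp [tableError, initState]
  have hf : ⨅ x, globalLoss ℓ D x ≤ globalLoss ℓ D x₀ := ciInf_le hD x₀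
  have h1 := mul_le_mul_of_nonneg_right (shiftWeight_le_betaParam hn hω hL hη hηm)
    (shiftError_nonneg ℓ D (initState n m x₀))
  have e : 12 / 5 * (betaParam n ω / L) * shiftError ℓ D (initState n m x₀)
      = 12 / 5 * (betaParam n ω / (L * n) * ∑ i, ‖∇ (localLoss ℓ (D i)) x₀‖ ^ 2) := by
    rw [hS]; field_simp
  unfold potential initialPotential
  rw [hT, mul_zero, add_zero]
  change globalLoss ℓ D x₀ - _ + _ ≤ _
  linarith

lemma initialPotential_nonneg {d m : ℕ} {Z : Type*} {ℓ : Z → Vec d → ℝ} {D : Fin n → Fin m → Z}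
    (hω : 0 ≤ ω) (hL : 0 < L) (hD : BddBelow (Set.range (globalLoss ℓ D))) (x₀ : Vec d) :
    0 ≤ initialPotential ℓ L ω D x₀ := by
  have hf : ⨅ x, globalLoss ℓ D x ≤ globalLoss ℓ D x₀ := ciInf_le hD x₀
  have : 0 ≤ betaParam n ω / (L * n) * ∑ i, ‖∇ (localLoss ℓ (D i)) x₀‖ ^ 2 := by
    unfold betaParam; positivity
  unfold initialPotential
  linarith

variable {d m : ℕ} {G ε δ : ℝ} (hd : 1 ≤ d) (hn : 1 ≤ n) (hm : 1 ≤ m) (hL : 0 < L) (hG : 0 < G)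
  (hω : 0 ≤ ω) (hε : 0 < ε) (hδ : 0 < δ) (hδ1 : δ < 1)

include hδ hδ1 in
lemma log_one_div_pos : 0 < Real.log (1 / δ) := Real.log_pos (by rwa [lt_div_iff₀ hδ, one_mul])

include hd hn hm hL hG hω hε hδ hδ1 in
lemma utilityOrder_pos : 0 < utilityOrder d n m G L ω ε δ := by
  have hd0 : (0 : ℝ) < d := by exact_mod_cast hd
  have hn0 : (0 : ℝ) < n := by exact_mod_cast hn
  have hm0 : (0 : ℝ) < m := by exact_mod_cast hm
  have hl := log_one_div_pos hδ hδ1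
  unfold utilityOrder; positivity

include hd hn hm hL hG hω hε hδ hδ1 in
lemma roundsOrder_pos : 0 < roundsOrder d n m G L ω ε δ := by
  have hd0 : (0 : ℝ) < d := by exact_mod_cast hd
  have hn0 : (0 : ℝ) < n := by exact_mod_cast hn
  have hm0 : (0 : ℝ) < m := by exact_mod_cast hm
  have hl := log_one_div_pos hδ hδ1
  unfold roundsOrder; positivity

include hn hω in
-- `τ` is the reciprocal of the square root, so the factor `max {1, τ}` in the number of rounds
-- compensates the reduction of the stepsize.
lemma min_mul_max_tau : min 1 (√((n : ℝ) / (1 + ω) ^ 3)) * max 1 (tau n ω) = 1 := by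
  have hn0 : (0 : ℝ) < n := by exact_mod_cast hn
  have hΩ : 0 < 1 + ω := by linarith
  have hτ : tau n ω = (√((n : ℝ) / (1 + ω) ^ 3))⁻¹ := by
    rw [← Real.sqrt_inv, inv_div, Real.sqrt_div' _ hn0.le, tau, Real.sqrt_eq_rpow, Real.sqrt_eq_rpow,
      ← Real.rpow_natCast, ← Real.rpow_mul hΩ.le]
    norm_num
  have hs : 0 < √((n : ℝ) / (1 + ω) ^ 3) := Real.sqrt_pos.mpr (by positivity)
  rw [hτ]
  rcases le_total 1 (√((n : ℝ) / (1 + ω) ^ 3)) with h | h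
  · rw [min_eq_left h, max_eq_left (inv_le_one_of_one_le₀ h), one_mul]
  · rw [min_eq_right h, max_eq_right ((one_le_inv₀ hs).mpr h), mul_inv_cancel₀ hs.ne']

include hd hn hm hL hG hω hε hδ hδ1 in
lemma maxStepsize_mul_roundsOrder :
    3 * (maxStepsize n ω L * roundsOrder d n m G L ω ε δ * utilityOrder d n m G L ω ε δ) = 1 := by
  have hd0 : (0 : ℝ) < d := by exact_mod_cast hd
  have hn0 : (0 : ℝ) < n := by exact_mod_cast hn
  have hm0 : (0 : ℝ) < m := by exact_mod_cast hm
  have hl := log_one_div_pos hδ hδ1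
  have hmm := min_mul_max_tau hn hω
  have h1 : √((1 + ω) * L * d * Real.log (1 / δ)) = √L * √((1 + ω) * d * Real.log (1 / δ)) := by
    rw [← Real.sqrt_mul hL.le]; congr 1; ring
  have h2 : √((n : ℝ) * L) = √n * √L := Real.sqrt_mul hn0.le L
  have hs1 : 0 < √((1 + ω) * d * Real.log (1 / δ)) := Real.sqrt_pos.mpr (by positivity)
  have hs2 : 0 < √(n : ℝ) := Real.sqrt_pos.mpr hn0
  have hs3 : √L * √L = L := Real.mul_self_sqrt hL.le
  unfold maxStepsize roundsOrder utilityOrder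
  rw [h1, h2]
  set s := √((1 + ω) * d * Real.log (1 / δ))
  calc _ = (min 1 (√((n : ℝ) / (1 + ω) ^ 3)) * max 1 (tau n ω)) * ((√L * √L) / L) := by
        field_simp
    _ = 1 := by rw [hmm, hs3, div_self hL.ne', one_mul]

include hn hL hω hδ hδ1 in
lemma utilityOrder_sq :
    utilityOrder d n m G L ω ε δ ^ 2
      = G ^ 2 * ((1 + ω) * L * d * Real.log (1 / δ)) / (n * m ^ 2 * ε ^ 2) := by
  have hl := log_one_div_pos hδ hδ1
  have hΩ : 0 < 1 + ω := by linarith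
  unfold utilityOrder
  rw [div_pow, mul_pow, mul_pow, mul_pow, Real.sq_sqrt (by positivity), Real.sq_sqrt (by positivity)]

/-- The final bound, from the telescoped descent and the choice of the number of rounds. -/
lemma utility_bound_of_descent {η η' R Y T a A Φ c v s I : ℝ} (hη : 0 < η) (hη' : η ≤ η')
    (hR : 0 < R) (hY : 0 < Y) (hT : 0 < T) (ha : 0 < a) (haT : a * R ≤ T) (hTA : T ≤ A * R)
    (hΦ : 0 ≤ Φ) (hc : 0 < c) (hRY : 3 * (η' * R * Y) = 1) (hv : s * v = c * T * Y ^ 2)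
    (hI : η / 5 * I ≤ 12 / 5 * Φ + T * (48 / 5 * (η ^ 2 * (s * v)))) :
    1 / T * I ≤ (36 + 16 * c) * (η' / η) * (Φ / a + A) * Y := by
  have hη'0 : 0 < η' := hη.trans_le hη'
  have hA : 0 < A := pos_of_mul_pos_left (hT.trans_le hTA) hR.le
  -- The noise variance grows linearly in `T`, so the noise term is of order `ηTY²` against
  -- `Φ/(ηT)`. With `T` of order `R` and `3 η' R Y = 1`, both become multiples of `Y`.
  have h1 : 1 / T * I ≤ 12 * (Φ / (η * T)) + 48 * c * (η * T * Y) * Y := by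
    rw [hv] at hI
    have e : 1 / T * I = (η / 5 * I) * (5 / (η * T)) := by field_simp
    have e' : 12 * (Φ / (η * T)) + 48 * c * (η * T * Y) * Y
        = (12 / 5 * Φ + T * (48 / 5 * (η ^ 2 * (c * T * Y ^ 2)))) * (5 / (η * T)) := by
      field_simp
    rw [e, e']
    gcongr
  have h2 : Φ / (η * T) ≤ 3 * (η' / η) * (Φ / a) * Y := by
    have e : 3 * (η' / η) * (Φ / a) * Y = Φ / (η * (a * R)) * (3 * (η' * R * Y)) := by field_simp
    rw [e, hRY, mul_one]
    gcongr
  have h3 : η * T * Y ≤ A / 3 := by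
    calc η * T * Y ≤ η' * (A * R) * Y := by gcongr
      _ = A / 3 * (3 * (η' * R * Y)) := by ring
      _ = A / 3 := by rw [hRY, mul_one]
  have h4 : 1 ≤ η' / η := (one_le_div hη).mpr hη'
  calc 1 / T * I ≤ 12 * (Φ / (η * T)) + 48 * c * (η * T * Y) * Y := h1
    _ ≤ 12 * (3 * (η' / η) * (Φ / a) * Y) + 48 * c * (A / 3) * Y := by gcongr
    _ = 36 * (η' / η) * (Φ / a) * Y + 1 * (16 * c * A * Y) := by ring
    _ ≤ 36 * (η' / η) * (Φ / a) * Y + η' / η * (16 * c * A * Y) := by gcongr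
    _ ≤ 36 * (η' / η) * (Φ / a) * Y + η' / η * (16 * c * A * Y)
        + (36 * (η' / η) * A * Y + 16 * c * (η' / η) * (Φ / a) * Y) :=
      le_add_of_nonneg_right (by positivity)
    _ = _ := by ring

end Parameters

end SoteriaFL

theorem corollary3 (K : ℝ) (hK : 0 < K) :
    ∃ c c' C : ℝ, 0 < c ∧ 0 < c' ∧ 0 < C ∧
      ∀ (Z : Type*) (U : Type*) [MeasurableSpace U] (d n m T : ℕ)
        (ℓ : Z → SoteriaFL.Vec d → ℝ) (ν : ℕ → Fin n → Measure U)
        (Cmp : ℕ → Fin n → U → SoteriaFL.Vec d → SoteriaFL.Vec d)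
        (x₀ : SoteriaFL.Vec d) (G L ω ε δ η σ2 a A : ℝ),
        -- sizes; the sampling probability `b / m = 3 m^{2/3} / m` is at most `1`
        1 ≤ d → 1 ≤ n → 1 ≤ m → SoteriaFL.batchSize m ≤ m →
        -- smoothness and bounded gradients, for every possible data sample
        0 < L → 0 < G →
        (∀ z, SoteriaFL.IsLSmooth L (ℓ z)) →
        (∀ z, SoteriaFL.HasBoundedGradient G (ℓ z)) →
        -- compression operators
        0 ≤ ω → (∀ t i, IsProbabilityMeasure (ν t i)) →
        (∀ t i, SoteriaFL.IsCompressor ω (ν t i) (Cmp t i)) →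
        -- privacy parameters
        0 < ε → 0 < δ → δ < 1 → ε ≤ K * Real.log (1 / δ) →
        ε < c' * SoteriaFL.batchSize m ^ 2 * T / (m : ℝ) ^ 2 →
        -- stepsize, privacy variance and number of communication rounds
        0 < η → η ≤ SoteriaFL.maxStepsize n ω L →
        σ2 = c * (G ^ 2 * T * Real.log (1 / δ) / ((m : ℝ) ^ 2 * ε ^ 2)) →
        0 < a → a * SoteriaFL.roundsOrder d n m G L ω ε δ ≤ T →
        T ≤ A * SoteriaFL.roundsOrder d n m G L ω ε δ →
        -- privacy
        (∀ i : Fin n, SoteriaFL.IsLDP ε δ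
          (SoteriaFL.noiseLaw d n m (SoteriaFL.batchSize m / m) σ2 ν)
          (SoteriaFL.transcript ℓ η (SoteriaFL.shiftStepsize ω) (SoteriaFL.batchSize m) Cmp x₀ T)
          i) ∧
        -- utility
        (∀ D : Fin n → Fin m → Z, BddBelow (Set.range (SoteriaFL.globalLoss ℓ D)) →
          (∀ t, Integrable (fun r => ‖∇ (SoteriaFL.globalLoss ℓ D) (SoteriaFL.run ℓ η
              (SoteriaFL.shiftStepsize ω) (SoteriaFL.batchSize m) Cmp x₀ D r t).x‖ ^ 2)
            (SoteriaFL.noiseLaw d n m (SoteriaFL.batchSize m / m) σ2 ν)) ∧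
          (1 / (T : ℝ)) * ∑ t ∈ Finset.range T,
              ∫ r, ‖∇ (SoteriaFL.globalLoss ℓ D) (SoteriaFL.run ℓ η
                (SoteriaFL.shiftStepsize ω) (SoteriaFL.batchSize m) Cmp x₀ D r t).x‖ ^ 2
              ∂(SoteriaFL.noiseLaw d n m (SoteriaFL.batchSize m / m) σ2 ν)
            ≤ C * (SoteriaFL.maxStepsize n ω L / η)
                * (SoteriaFL.initialPotential ℓ L ω D x₀ / a + A)
                * SoteriaFL.utilityOrder d n m G L ω ε δ) := by
  have hc := SoteriaFL.varianceConst_pos hK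
  refine ⟨SoteriaFL.varianceConst K, SoteriaFL.roundsConst K,
    36 + 16 * SoteriaFL.varianceConst K, hc, SoteriaFL.roundsConst_pos hK, by positivity, ?_⟩
  intro Z U _ d n m T ℓ ν Cmp x₀ G L ω ε δ η σ2 a A hd hn hm hbm hL hG hℓ hℓG hω hν hC hε hδ hδ1
    hεK hεT hη hηm hσ ha haT hTA
  have hb := SoteriaFL.batchSize_pos hm
  have hR := SoteriaFL.roundsOrder_pos hd hn hm hL hG hω hε hδ hδ1
  have hY := SoteriaFL.utilityOrder_pos hd hn hm hL hG hω hε hδ hδ1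
  have hT : (0 : ℝ) < T := (mul_pos ha hR).trans_le haT
  have hl := SoteriaFL.log_one_div_pos hδ hδ1
  have hv : 0 ≤ σ2 := by rw [hσ]; positivity
  have hγ := SoteriaFL.shiftStepsize_pos hω
  refine ⟨fun i => ?_, fun D hD => ⟨fun t =>
    SoteriaFL.integrable_gradient_run hC D x₀ hℓ hℓG hn hm _ _ t, ?_⟩⟩
  · rw [hσ]
    exact SoteriaFL.isLDP_transcript η _ x₀ (fun z => (hℓ z).continuous_gradient.measurable)
      (fun t i => (hC t i).measurable) hG hℓG hm hb hbm hK hε hδ hδ1 hεK (by exact_mod_cast hT)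
      hεT i
  · obtain ⟨hN0, hN⟩ := SoteriaFL.noiseIncrement_nonneg_and_le (d := d) hn hω hL hη hv
    have hdesc := SoteriaFL.sum_integral_gradient_run_le hC D x₀ hℓ hℓG hn hm hb hbm hω hv hη.le hγ
      (SoteriaFL.shiftStepsize_le_one hω) (SoteriaFL.admissibleWeights hn hm hbm hω hL hη hηm)
      (fun x => ciInf_le hD x) hN0 T
    have hinit := SoteriaFL.potential_init_le hn hω hL hη hηm hD x₀
      (SoteriaFL.tableWeight n m ω L η)
    -- This `s` collects the factors of `η² σ2` in the noise increment; the privacy variance then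
    -- satisfies `s σ2 = c T Y²`.
    refine SoteriaFL.utility_bound_of_descent (v := σ2) (s := L * (1 + ω) * d / n) hη hηm hR hY hT
      ha haT hTA (SoteriaFL.initialPotential_nonneg hω hL hD x₀) hc
      (SoteriaFL.maxStepsize_mul_roundsOrder hd hn hm hL hG hω hε hδ hδ1) ?_ ?_
    · have hn0 : (0 : ℝ) < n := by exact_mod_cast hn
      have hm0 : (0 : ℝ) < m := by exact_mod_cast hm
      rw [SoteriaFL.utilityOrder_sq hn hL hω hδ hδ1, hσ]
      field_simp
    · refine hdesc.trans (add_le_add hinit (mul_le_mul_of_nonneg_left (hN.trans_eq ?_) hT.le))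
      ring
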